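/- **Conventions.** For a strict partition $\lambda=(\lambda_1>\dots>\lambda_\ell>0)$ of $n$, let $\mathrm{ShSYT}(\lambda)$ be the set of standard shifted tableaux of shape $\lambda$: fillings of the shifted Young diagram (row $r$ has $\lambda_r$ cells and starts on the main diagonal; rows are numbered from bottom to top) by $1,\dots,n$, each used once, increasing along rows and up columns. The reading word of $T$ is obtained by reading rows left to right, from the top row to the bottom row. Let $\mathrm{Des}(T)$ be the set of $i$ that lie to the right of $i+1$ in the reading word, and $\mathrm{Peak}(T)=\{i>1 : i-1\notin \mathrm{Des}(T),\ i\in\mathrm{Des}(T)\}$. For $1<i<n-1$ the involution $\mathrm{b}_i$ on $\mathrm{ShSYT}(\lambda)$ interchanges the entries $a,a+1$ if $\{i-1,i,i+1,i+2\}=\{a,a+1,c,d\}$ where $c\in\{a-1,a+2\}$ lies between $a$ and $a+1$ in the reading word and $d$ lies to the left of $c$; it fixes $T$ if there is no such $a$ (there is at most one). A morphism between sets with a subset statistic and involutions with the same index set is a map that preserves the statistic and commutes with each involution; an isomorphism is a bijective morphism. **Theorem.** Let $n\ge 0$, let $\mathcal A$ be a non-empty finite set, let $\mathrm{Peak}$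 assign to each $T\in\mathcal A$ a subset of $\{2,\dots,n\}$ without consecutive elements, and let $\{\varphi_i\}_{1<i<n}$ be involutions on $\mathcal A$ such that: * (i) $\varphi_i(T)=T$ if and only if $i,i+1\notin\mathrm{Peak}(T)$; * (ii) if $\varphi_i(T)\ne T$, then $i\in\mathrm{Peak}(T)\Leftrightarrow i+1\in\mathrm{Peak}(\varphi_i(T))$, and $h\in\mathrm{Peak}(T)\Leftrightarrow h\in\mathrm{Peak}(\varphi_i(T))$ for all $h\le i-3$ and all $h\ge i+4$; * (iii) $\varphi_j\varphi_i=\varphi_i\varphi_j$ whenever $|i-j|\ge 4$; * (v) for every $T\in\mathcal A$ and all $1<j<i<n$ with $i-j\le 3$, there are a strict partition $\lambda$ of $i-j+4$ and an isomorphism from the class $[T]_{(j,i)}$ generated from $T$ by $\varphi_j,\dots,\varphi_i$ to $\mathrm{ShSYT}(\lambda)$. Here $[T]_{(j,i)}$ has the statistic $\mathrm{Peak}_{(j,i)}(U)=\{h-j+2 : h\in\mathrm{Peak}(U),\ j\le h\le i+1\}$, $\mathrm{ShSYT}(\lambda)$ has the statistic $\mathrm{Peak}$, and $\varphi_k$ corresponds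 to $\mathrm{b}_{k-j+2}$ for $j\le k\le i$. If $n=2$, assume in addition that $\mathrm{Peak}$ is constant on $\mathcal A$. Suppose that for some strict partition $\lambda$ of $n$ there is a morphism from $\mathcal A$, with the statistic $\mathrm{Peak}_n(T)=\mathrm{Peak}(T)\cap\{2,\dots,n-1\}$ and the involutions $\{\varphi_i\}_{1<i<n-1}$, to $\mathrm{ShSYT}(\lambda)$ with $\mathrm{Peak}$ and $\{\mathrm{b}_i\}_{1<i<n-1}$. Then there is a unique strict partition $\mu$ of $n+1$ for which there exists a morphism from $\mathcal A$, with $\mathrm{Peak}$ and $\{\varphi_i\}_{1<i<n}$, to $\mathrm{ShSYT}(\mu)$ with $\mathrm{Peak}$ and $\{\mathrm{b}_i\}_{1<i<n}$. -/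

import Mathlib

/-- A strict partition of `n`: a strictly decreasing sequence of positive integers of sum `n`. -/
@[ext]
structure StrictPartition (n : ℕ) where
  parts : List ℕ
  decreasing : parts.Pairwise (· > ·)
  pos : ∀ a ∈ parts, 0 < a
  sum_eq : parts.sum = n

namespace StrictPartition

/-- The length of row `r` (rows are numbered from `0`; it is `0` beyond the last row). -/
def row {n : ℕ} (lam : StrictPartition n) (r : ℕ) : ℕ := lam.parts.getD r 0

/-- The shifted Young diagram. The cell `(r, c)` lies in row `r`, counted from the bottom, and in
column `c`; row `r` begins on the main diagonal, in column `r`. -/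
def cells {n : ℕ} (lam : StrictPartition n) : Set (ℕ × ℕ) :=
  {p | p.1 ≤ p.2 ∧ p.2 < p.1 + lam.row p.1}

theorem row_succ_lt {n : ℕ} (lam : StrictPartition n) (r : ℕ) (h : 0 < lam.row (r + 1)) :
    lam.row (r + 1) < lam.row r := by
  unfold row at *
  by_cases hr : r + 1 < lam.parts.length
  · have h0 : r < lam.parts.length := by omega
    rw [List.getD_eq_getElem _ _ hr, List.getD_eq_getElem _ _ h0]
    exact List.pairwise_iff_getElem.mp lam.decreasing r (r + 1) h0 hr (by omega)
  · rw [List.getD_eq_default _ _ (by omega)] at h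
    omega

theorem below_mem {n : ℕ} (lam : StrictPartition n) {r c : ℕ} (h : (r + 1, c) ∈ lam.cells) :
    (r, c) ∈ lam.cells := by
  obtain ⟨h1, h2⟩ := h
  simp only at h1 h2
  have := lam.row_succ_lt r (by omega)
  exact ⟨by simp only; omega, by simp only; omega⟩

theorem below_mem_of_le {n : ℕ} (lam : StrictPartition n) {r r' c : ℕ} (hr : r ≤ r')
    (h : (r', c) ∈ lam.cells) : (r, c) ∈ lam.cells := by
  induction r', hr using Nat.le_induction with
  | base => exact h
  | succ m _ ih => exact ih (lam.below_mem h)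

theorem left_mem {n : ℕ} (lam : StrictPartition n) {r c c' : ℕ} (hrc : r ≤ c) (hc : c ≤ c')
    (h : (r, c') ∈ lam.cells) : (r, c) ∈ lam.cells := by
  obtain ⟨h1, h2⟩ := h
  simp only at h1 h2
  exact ⟨hrc, by simp only; omega⟩

end StrictPartition

/-- Standard shifted tableaux of shape `lam`: fillings of the shifted Young diagram with
`1, ..., n`, each used once, that increase along rows and up columns. (The function `entry` is `0`
outside the diagram, so that two tableaux are equal if and only if they have the same entries.) -/
@[ext]
structure ShSYT {n : ℕ} (lam : StrictPartition n) where
  entry : ℕ × ℕ → ℕ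
  entry_eq_zero : ∀ p, p ∉ lam.cells → entry p = 0
  bijOn : Set.BijOn entry lam.cells (Set.Icc 1 n)
  row_lt : ∀ r c c', c < c' → (r, c) ∈ lam.cells → (r, c') ∈ lam.cells →
    entry (r, c) < entry (r, c')
  col_lt : ∀ r r' c, r < r' → (r, c) ∈ lam.cells → (r', c) ∈ lam.cells →
    entry (r, c) < entry (r', c)

namespace ShSYT

variable {n : ℕ} {lam : StrictPartition n}

/-- The letter `x` is to the left of the letter `y` in the reading word of `T` (the rows are read
from left to right, from the top row to the bottom row). -/
def Before (T : ShSYT lam) (x y : ℕ) : Prop :=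
  ∃ p ∈ lam.cells, ∃ q ∈ lam.cells, T.entry p = x ∧ T.entry q = y ∧
    (q.1 < p.1 ∨ (p.1 = q.1 ∧ p.2 < q.2))

/-- The letter `y` is between the letters `x` and `z` in the reading word of `T`. -/
def Between (T : ShSYT lam) (x y z : ℕ) : Prop :=
  (T.Before x y ∧ T.Before y z) ∨ (T.Before z y ∧ T.Before y x)

/-- The descent set: all `i` that are to the right of `i + 1` in the reading word. -/
def des (T : ShSYT lam) : Set ℕ := {i | T.Before (i + 1) i}

/-- The peak set: all `i > 1` with `i - 1` not a descent and `i` a descent. -/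
def peak (T : ShSYT lam) : Set ℕ := {i | 1 < i ∧ i - 1 ∉ T.des ∧ i ∈ T.des}

/-- `{a, a + 1, c, d} = {i - 1, i, i + 1, i + 2}`, the letter `c` is consecutive with `a, a + 1`
and between them in the reading word, and `d` is to the left of `c`: in this case the elementary
shifted dual equivalence involution `b i` interchanges `a` and `a + 1`. -/
def IsMove (T : ShSYT lam) (i a : ℕ) : Prop :=
  1 ≤ i ∧ ∃ c d : ℕ, ({a, a + 1, c, d} : Finset ℕ) = {i - 1, i, i + 1, i + 2} ∧
    (c + 1 = a ∨ c = a + 2) ∧ T.Between a c (a + 1) ∧ T.Before d c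

theorem one_le_entry (T : ShSYT lam) {p : ℕ × ℕ} (hp : p ∈ lam.cells) : 1 ≤ T.entry p :=
  (T.bijOn.mapsTo hp).1

theorem row_le (T : ShSYT lam) {r c c' : ℕ} (h : c ≤ c') (h1 : (r, c) ∈ lam.cells)
    (h2 : (r, c') ∈ lam.cells) : T.entry (r, c) ≤ T.entry (r, c') := by
  rcases h.eq_or_lt with rfl | h
  · exact le_rfl
  · exact (T.row_lt r c c' h h1 h2).le

theorem col_le (T : ShSYT lam) {r r' c : ℕ} (h : r ≤ r') (h1 : (r, c) ∈ lam.cells)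
    (h2 : (r', c) ∈ lam.cells) : T.entry (r, c) ≤ T.entry (r', c) := by
  rcases h.eq_or_lt with rfl | h
  · exact le_rfl
  · exact (T.col_lt r r' c h h1 h2).le

theorem cell_eq (T : ShSYT lam) {p q : ℕ × ℕ} (hp : p ∈ lam.cells) (hq : q ∈ lam.cells)
    (h : T.entry p = T.entry q) : p = q := T.bijOn.injOn hp hq h

theorem before_asymm (T : ShSYT lam) {x y : ℕ} (h : T.Before x y) (h' : T.Before y x) : False := by
  obtain ⟨p, hp, q, hq, hx, hy, h⟩ := h
  obtain ⟨q', hq', p', hp', hy', hx', h'⟩ := h'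
  obtain rfl := T.cell_eq hp hp' (hx.trans hx'.symm)
  obtain rfl := T.cell_eq hq hq' (hy.trans hy'.symm)
  omega

theorem IsMove.pos {T : ShSYT lam} {i a : ℕ} (h : T.IsMove i a) : 1 ≤ a := by
  obtain ⟨-, c, d, -, -, hb, -⟩ := h
  rcases hb with ⟨⟨p, hp, -, -, h, -⟩, -⟩ | ⟨-, ⟨-, -, p, hp, -, h, -⟩⟩
  · exact h ▸ T.one_le_entry hp
  · exact h ▸ T.one_le_entry hp

theorem IsMove.mem {T : ShSYT lam} {i a : ℕ} (h : T.IsMove i a) : 1 ≤ a ∧ a + 1 ≤ n := by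
  refine ⟨h.pos, ?_⟩
  obtain ⟨-, c, d, -, -, hb, -⟩ := h
  rcases hb with ⟨-, ⟨-, -, p, hp, -, h, -⟩⟩ | ⟨⟨p, hp, -, -, h, -⟩, -⟩
  · exact h ▸ (T.bijOn.mapsTo hp).2
  · exact h ▸ (T.bijOn.mapsTo hp).2

theorem IsMove.not_row {T : ShSYT lam} {i a : ℕ} (h : T.IsMove i a) {r c c' : ℕ}
    (h1 : (r, c) ∈ lam.cells) (h2 : (r, c') ∈ lam.cells) (e1 : T.entry (r, c) = a)
    (e2 : T.entry (r, c') = a + 1) : False := by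
  have hcc : c < c' := by
    by_contra hlt
    have := T.row_le (not_lt.mp hlt) h2 h1
    omega
  obtain ⟨-, x, d, -, -, hb, -⟩ := h
  rcases hb with ⟨hb1, hb2⟩ | ⟨hb1, hb2⟩
  · obtain ⟨p, hp, q, hq, e3, e4, hpq⟩ := hb1
    obtain ⟨q', hq', s, hs, e5, e6, hqs⟩ := hb2
    obtain rfl := T.cell_eq hp h1 (e3.trans e1.symm)
    obtain rfl := T.cell_eq hs h2 (e6.trans e2.symm)
    obtain rfl := T.cell_eq hq hq' (e4.trans e5.symm)
    obtain ⟨q1, q2⟩ := q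
    simp only at hpq hqs
    obtain rfl : q1 = r := by omega
    have := T.row_lt _ c q2 (by omega) h1 hq
    have := T.row_lt _ q2 c' (by omega) hq h2
    omega
  · exact T.before_asymm (x := a) (y := a + 1) ⟨_, h1, _, h2, e1, e2, Or.inr ⟨rfl, hcc⟩⟩ (by
      obtain ⟨p, hp, q, hq, e3, e4, hpq⟩ := hb1
      obtain ⟨q', hq', s, hs, e5, e6, hqs⟩ := hb2
      obtain rfl := T.cell_eq hq hq' (e4.trans e5.symm)
      exact ⟨p, hp, s, hs, e3, e6, by omega⟩)

theorem IsMove.not_col {T : ShSYT lam} {i a : ℕ} (h : T.IsMove i a) {r r' c : ℕ}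
    (h1 : (r, c) ∈ lam.cells) (h2 : (r', c) ∈ lam.cells) (e1 : T.entry (r, c) = a)
    (e2 : T.entry (r', c) = a + 1) : False := by
  have hrr : r < r' := by
    by_contra hlt
    have := T.col_le (not_lt.mp hlt) h2 h1
    omega
  -- the two cells are adjacent
  have hr' : r' = r + 1 := by
    by_contra hne
    have hm : (r + 1, c) ∈ lam.cells := lam.below_mem_of_le (by omega) h2
    have := T.col_lt r (r + 1) c (by omega) h1 hm
    have := T.col_lt (r + 1) r' c (by omega) hm h2
    omega
  subst hr'
  have hrc : r + 1 ≤ c := h2.1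
  -- no entry `a + 2` lies to the right of the upper cell in its row, or above
  have key : ∀ s y, r + 1 ≤ s → c < y → (s, y) ∈ lam.cells → T.entry (s, y) ≤ a + 2 → False := by
    intro s y hs hy hm hle
    have m1 : (r + 1, y) ∈ lam.cells := lam.below_mem_of_le hs hm
    have m2 : (r + 1, c + 1) ∈ lam.cells := lam.left_mem (by omega) (by omega) m1
    have m3 : (r, c + 1) ∈ lam.cells := lam.below_mem m2
    have i1 := T.col_le hs m1 hm
    have i2 := T.row_le (show c + 1 ≤ y by omega) m2 m1
    have i3 := T.col_lt r (r + 1) (c + 1) (by omega) m3 m2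
    have i4 := T.row_lt r c (c + 1) (by omega) h1 m3
    have i5 : T.entry (r, c + 1) = a + 1 := by omega
    have := T.cell_eq m3 h2 (i5.trans e2.symm)
    simp at this
  obtain ⟨hi, x, d, hset, hx, hb, hd⟩ := h
  rcases hb with ⟨hb1, hb2⟩ | ⟨hb1, hb2⟩
  · exact T.before_asymm (x := a + 1) (y := a)
      ⟨_, h2, _, h1, e2, e1, Or.inl (by simp only; omega)⟩ (by
      obtain ⟨p, hp, q, hq, e3, e4, hpq⟩ := hb1
      obtain ⟨q', hq', s, hs, e5, e6, hqs⟩ := hb2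
      obtain rfl := T.cell_eq hq hq' (e4.trans e5.symm)
      exact ⟨p, hp, s, hs, e3, e6, by omega⟩)
  · obtain ⟨p, hp, q, hq, e3, e4, hpq⟩ := hb1
    obtain ⟨q', hq', s, hs, e5, e6, hqs⟩ := hb2
    obtain rfl := T.cell_eq hp h2 (e3.trans e2.symm)
    obtain rfl := T.cell_eq hs h1 (e6.trans e1.symm)
    obtain rfl := T.cell_eq hq hq' (e4.trans e5.symm)
    obtain ⟨q1, q2⟩ := q
    simp only at hpq hqs
    by_cases hq1 : q1 = r + 1
    · subst hq1
      refine key (r + 1) q2 le_rfl (by omega) hq ?_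
      omega
    · obtain rfl : q1 = r := by omega
      have hq2 : q2 < c := by omega
      have l1 := T.row_lt q1 q2 c hq2 hq h1
      have hxa : x + 1 = a := by omega
      -- the upper cell is on the main diagonal
      have hdiag : c = q1 + 1 := by
        by_contra hne
        have hle : q2 + 1 = c := by
          by_contra hne2
          have m : (q1, q2 + 1) ∈ lam.cells := lam.left_mem (by have := hq.1; simp only at this; omega) (by omega) h1
          have := T.row_lt q1 q2 (q2 + 1) (by omega) hq m
          have := T.row_lt q1 (q2 + 1) c (by omega) m h1
          omega
        have m : (q1 + 1, q2) ∈ lam.cells := lam.left_mem (by omega) (by omega) h2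
        have j1 := T.col_lt q1 (q1 + 1) q2 (by omega) hq m
        have j2 := T.row_lt (q1 + 1) q2 c (by omega) m h2
        have j3 : T.entry (q1 + 1, q2) = a := by omega
        have := T.cell_eq m h1 (j3.trans e1.symm)
        simp at this
      subst hdiag
      obtain ⟨⟨s1, s2⟩, hs', t, ht, e7, e8, hst⟩ := hd
      obtain rfl := T.cell_eq ht hq (e8.trans e4.symm)
      simp only at hst
      have hq1 : q1 ≤ q2 := hq.1
      have hs1 : q1 + 1 ≤ s1 := by
        rcases hst with hst | ⟨rfl, hst⟩
        · omega
        · have : s1 ≤ s2 := hs'.1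
          omega
      have hs12 : s1 ≤ s2 := hs'.1
      have hdle : d ≤ a + 2 := by
        have f1 := Finset.ext_iff.mp hset d
        have f2 := Finset.ext_iff.mp hset (i - 1)
        have f3 := Finset.ext_iff.mp hset a
        have f4 := Finset.ext_iff.mp hset x
        simp only [Finset.mem_insert, Finset.mem_singleton, or_true, true_or, true_iff,
          iff_true] at f1 f2 f3 f4
        omega
      rcases (show q1 + 1 ≤ s2 by omega).eq_or_lt with hs2 | hs2
      · obtain rfl : s1 = q1 + 1 := by omega
        subst hs2
        have f1 := Finset.ext_iff.mp hset (i - 1)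
        have f2 := Finset.ext_iff.mp hset i
        have f3 := Finset.ext_iff.mp hset (i + 1)
        have f4 := Finset.ext_iff.mp hset (i + 2)
        simp only [Finset.mem_insert, Finset.mem_singleton, or_true, true_or,
          iff_true] at f1 f2 f3 f4
        omega
      · exact key s1 s2 hs1 hs2 hs' (by omega)

/-- The tableau obtained from `T` by interchanging the entries `a` and `a + 1`. -/
def swap (T : ShSYT lam) {i a : ℕ} (h : T.IsMove i a) : ShSYT lam where
  entry p := Equiv.swap a (a + 1) (T.entry p)
  entry_eq_zero p hp := by
    have := h.pos
    rw [T.entry_eq_zero p hp]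
    exact Equiv.swap_apply_of_ne_of_ne (by omega) (by omega)
  bijOn := by
    have hm := h.mem
    refine Set.BijOn.comp (g := Equiv.swap a (a + 1)) (t := Set.Icc 1 n) ?_ T.bijOn
    have hmap : Set.MapsTo (Equiv.swap a (a + 1)) (Set.Icc 1 n) (Set.Icc 1 n) := by
      intro x hx
      rw [Equiv.swap_apply_def]
      split_ifs <;> simp only [Set.mem_Icc] at * <;> omega
    refine ⟨hmap, (Equiv.injective _).injOn, fun x hx => ⟨_, hmap hx, ?_⟩⟩
    exact Equiv.swap_apply_self _ _ _
  row_lt r c c' hc h1 h2 := by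
    have hlt := T.row_lt r c c' hc h1 h2
    have hno := fun e1 e2 => h.not_row h1 h2 e1 e2
    simp only [Equiv.swap_apply_def]
    split_ifs <;> first | omega | exact absurd ‹_› (fun e => hno ‹_› e)
  col_lt r r' c hr h1 h2 := by
    have hlt := T.col_lt r r' c hr h1 h2
    have hno := fun e1 e2 => h.not_col h1 h2 e1 e2
    simp only [Equiv.swap_apply_def]
    split_ifs <;> first | omega | exact absurd ‹_› (fun e => hno ‹_› e)

open Classical in
/-- The elementary shifted dual equivalence involution `b i` on standard shifted tableaux. At most
one of the three pairs `{i - 1, i}`, `{i, i + 1}`, `{i + 1, i + 2}` qualifies for the interchange,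
and `T` is a fixed point if none does. -/
noncomputable def b (i : ℕ) (T : ShSYT lam) : ShSYT lam :=
  if h : T.IsMove i (i - 1) then T.swap h
  else if h : T.IsMove i i then T.swap h
  else if h : T.IsMove i (i + 1) then T.swap h
  else T

end ShSYT

section Abstract

/-- `f` is a morphism from `s ⊆ A`, with the subset statistic `DA` and the involutions `α i`, to
`B`, with the subset statistic `DB` and the involutions `β i`, where `i` ranges over `I`. Only the
values of `f` on `s` matter. -/
def IsMorphismOn {A B : Type*} (s : Set A) (I : Set ℕ) (DA : A → Set ℕ) (α : ℕ → A → A)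
    (DB : B → Set ℕ) (β : ℕ → B → B) (f : A → B) : Prop :=
  ∀ a ∈ s, DA a = DB (f a) ∧ ∀ i ∈ I, f (α i a) = β i (f a)

/-- A peak map for objects of size `N`: the values are subsets of `{2, ..., N - 1}` without
consecutive elements. -/
def IsPeakMap {A : Type*} (N : ℕ) (Peak : A → Set ℕ) : Prop :=
  ∀ T, (∀ i ∈ Peak T, 2 ≤ i ∧ i < N) ∧ ∀ i ∈ Peak T, i + 1 ∉ Peak T

/-- The indices `1 < i < N - 1` of the involutions for objects of size `N`. -/
def indices (N : ℕ) : Set ℕ := {i | 1 < i ∧ i + 1 < N}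

/-- The restriction of the peak set to `{2, ..., m - 1}`. -/
def truncPeak {A : Type*} (m : ℕ) (Peak : A → Set ℕ) (T : A) : Set ℕ := Peak T ∩ {h | 2 ≤ h ∧ h < m}

/-- The restricted class of `T`, generated by `φ j, ..., φ i`. -/
def restrictedClass {A : Type*} (φ : ℕ → A → A) (j i : ℕ) (T : A) : Set A :=
  {U | Relation.ReflTransGen (fun X Y => ∃ k, j ≤ k ∧ k ≤ i ∧ Y = φ k X) T U}

/-- The restricted peak set: intersect with `{j, ..., i + 1}` and subtract `j - 2`. -/
def restrictedPeak {A : Type*} (Peak : A → Set ℕ) (j i : ℕ) (T : A) : Set ℕ :=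
  {m | ∃ h ∈ Peak T, j ≤ h ∧ h ≤ i + 1 ∧ m + j = h + 2}

variable {A : Type*} (N : ℕ) (Peak : A → Set ℕ) (φ : ℕ → A → A)

/-- The fixed points of `φ i` are the `T` with `i, i + 1 ∉ Peak T`. -/
def ConditionI : Prop :=
  ∀ i ∈ indices N, ∀ T, φ i T = T ↔ i ∉ Peak T ∧ i + 1 ∉ Peak T

/-- How the peak set changes under `φ i` at an object that is not fixed. -/
def ConditionII : Prop :=
  ∀ i ∈ indices N, ∀ T, φ i T ≠ T →
    (i ∈ Peak T ↔ i + 1 ∈ Peak (φ i T)) ∧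
    ∀ h, (h + 3 ≤ i ∨ i + 4 ≤ h) → (h ∈ Peak T ↔ h ∈ Peak (φ i T))

/-- `φ i` and `φ j` commute for `|i - j| ≥ 4`. -/
def ConditionIII : Prop :=
  ∀ i ∈ indices N, ∀ j ∈ indices N, (i + 4 ≤ j ∨ j + 4 ≤ i) → ∀ T, φ j (φ i T) = φ i (φ j T)

/-- Each restricted class for `1 ≤ i - j ≤ 3` is isomorphic to the standard shifted tableaux of
some strict shape, of size `i - j + 4`; here `φ j, ..., φ i` correspond to
`b 2, ..., b (i - j + 2)`. -/
def ConditionV : Prop :=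
  ∀ j ∈ indices N, ∀ i ∈ indices N, 1 + j ≤ i → i ≤ j + 3 → ∀ T : A,
    ∃ (lam : StrictPartition (i - j + 4)) (f : A → ShSYT lam),
      Set.BijOn f (restrictedClass φ j i T) Set.univ ∧
      IsMorphismOn (restrictedClass φ j i T) (indices (i - j + 4)) (restrictedPeak Peak j i)
        (fun k => φ (k + j - 2)) ShSYT.peak ShSYT.b f

end Abstract

/-! Uniqueness of the shape is a rigidity statement: the peak sets of all tableaux reached by the
involutions determine the cell of every letter (`pos_eq_of_bisim`). Two facts carry it. The
involutions that move letters up to `m` act transitively on the fillings with prescribed letters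
above `m` (`conn_of_agreeAbove`), and between two addable cells in reading order there is a
removable off-diagonal cell (`exists_between`). If two related tableaux first differ in the cell of
`m + 1`, one moves `m` into such a cell and `m - 1` before it; then `m` is a peak of only one of the
two.

Existence for `n ≥ 3` is a counting argument over a morphism `f` to the tableaux of shape `lam`. All
fibres of `f` have the same size (`fiberCard_eq`). An object with a peak at `n` lies over a tableau
in which `n - 1` precedes `n` (`readLT_of_mem_peak`), and under this proviso the number of such
objects over a tableau depends on the cell of `n` only (`peakCard_eq`). The last involution `φ (n -
1)` leaves the letters up to `n - 3` in place, by rigidity and condition (iii), and exchanges peaks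
at `n - 1` with peaks at `n`. For three cells that carry `n - 2, n - 1, n` this gives a linear
relation between fibre sizes and peak counts (`pattern_equation`).

Evaluated near the corners of `lam`, the relation shows that each relevant peak count is zero or a
full fibre, that there are at most two corners, and that `lam` arises from a shape with a single
corner by deleting this corner `c` (`exists_isNewCell`). The new morphism writes `n + 1` into `c`.
Peaks agree by the choice of `c`, and the earlier involutions do not see `n + 1`. For the last
involution it suffices that a tableau with a peak at `n - 1` is determined by its letters up to `n -
3` (`eq_of_mem_peak`), which holds because there are no three corners.

For `n ≤ 2` there are no involutions, and the peak set alone selects the new cell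
(`exists_isMorphismOn_of_le_two`). -/

/-! ### Reading order, and its translation into integer inequalities. -/

/-- The cell `p` precedes the cell `q` in the reading order. -/
def ReadLT (p q : ℕ × ℕ) : Prop := q.1 < p.1 ∨ (p.1 = q.1 ∧ p.2 < q.2)

/-- The cell `q` lies to the right of `p` in its row, or above `p` in its column. -/
def Dominates (q p : ℕ × ℕ) : Prop := (q.1 = p.1 ∧ p.2 < q.2) ∨ (q.2 = p.2 ∧ p.1 < q.1)

theorem ReadLT.trichotomy {p q : ℕ × ℕ} (h : p ≠ q) : ReadLT p q ∨ ReadLT q p := by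
  have : p.1 ≠ q.1 ∨ p.2 ≠ q.2 := by
    by_contra hc
    push Not at hc
    exact h (Prod.ext hc.1 hc.2)
  unfold ReadLT
  omega

theorem ReadLT.asymm {p q : ℕ × ℕ} (h : ReadLT p q) : ¬ ReadLT q p := by
  unfold ReadLT at *
  omega

theorem ReadLT.ne {p q : ℕ × ℕ} (h : ReadLT p q) : p ≠ q := by
  rintro rfl
  exact h.asymm h

theorem ReadLT.trans {p q r : ℕ × ℕ} (h : ReadLT p q) (h' : ReadLT q r) : ReadLT p r := by
  unfold ReadLT at *
  omega

namespace StrictPartition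

theorem mem_cells {n : ℕ} {lam : StrictPartition n} {r c : ℕ} :
    (r, c) ∈ lam.cells ↔ r ≤ c ∧ c < r + lam.row r := Iff.rfl

theorem mem_of_le {n : ℕ} (lam : StrictPartition n) {r c r' c' : ℕ} (h : (r', c') ∈ lam.cells)
    (hr : r ≤ r') (hc : c ≤ c') (hrc : r ≤ c) : (r, c) ∈ lam.cells :=
  lam.left_mem hrc hc (lam.below_mem_of_le hr h)

end StrictPartition

namespace ShSYT

variable {n : ℕ} {lam : StrictPartition n}

theorem entry_le (T : ShSYT lam) {r c r' c' : ℕ} (h : (r', c') ∈ lam.cells) (hr : r ≤ r')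
    (hc : c ≤ c') (hrc : r ≤ c) : T.entry (r, c) ≤ T.entry (r', c') :=
  (T.row_le hc (lam.mem_of_le h hr hc hrc) (lam.below_mem_of_le hr h)).trans
    (T.col_le hr (lam.below_mem_of_le hr h) h)

theorem entry_lt (T : ShSYT lam) {r c r' c' : ℕ} (h : (r', c') ∈ lam.cells) (hr : r ≤ r')
    (hc : c ≤ c') (hrc : r ≤ c) (hne : r < r' ∨ c < c') :
    T.entry (r, c) < T.entry (r', c') := by
  refine (T.entry_le h hr hc hrc).lt_of_ne fun he => ?_
  have := T.cell_eq (lam.mem_of_le h hr hc hrc) h he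
  simp only [Prod.mk.injEq] at this
  omega

theorem mem_iff_entry_pos (T : ShSYT lam) {p : ℕ × ℕ} : p ∈ lam.cells ↔ 1 ≤ T.entry p := by
  refine ⟨T.one_le_entry, fun h => ?_⟩
  by_contra hp
  rw [T.entry_eq_zero p hp] at h
  omega

theorem entry_le_size (T : ShSYT lam) (p : ℕ × ℕ) : T.entry p ≤ n := by
  by_cases hp : p ∈ lam.cells
  · exact (T.bijOn.mapsTo hp).2
  · rw [T.entry_eq_zero p hp]
    omega

theorem entry_lt_of_dominates (T : ShSYT lam) {p q : ℕ × ℕ} (hp : p ∈ lam.cells)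
    (hq : q ∈ lam.cells) (h : Dominates q p) : T.entry p < T.entry q := by
  obtain ⟨r, c⟩ := p
  obtain ⟨r', c'⟩ := q
  have := hp.1
  refine T.entry_lt hq ?_ ?_ this ?_ <;> simp only [Dominates] at h <;> omega

theorem ext_on_cells {S T : ShSYT lam} (h : ∀ p ∈ lam.cells, S.entry p = T.entry p) : S = T := by
  ext p
  by_cases hp : p ∈ lam.cells
  · exact h p hp
  · rw [S.entry_eq_zero p hp, T.entry_eq_zero p hp]

/-- The cell of the letter `x`. -/
noncomputable def pos (T : ShSYT lam) (x : ℕ) : ℕ × ℕ := Function.invFunOn T.entry lam.cells x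

theorem pos_mem (T : ShSYT lam) {x : ℕ} (h1 : 1 ≤ x) (h2 : x ≤ n) : T.pos x ∈ lam.cells :=
  Function.invFunOn_mem (T.bijOn.surjOn ⟨h1, h2⟩)

theorem entry_pos (T : ShSYT lam) {x : ℕ} (h1 : 1 ≤ x) (h2 : x ≤ n) : T.entry (T.pos x) = x :=
  Function.invFunOn_eq (T.bijOn.surjOn ⟨h1, h2⟩)

theorem pos_entry (T : ShSYT lam) {p : ℕ × ℕ} (hp : p ∈ lam.cells) : T.pos (T.entry p) = p :=
  T.cell_eq (T.pos_mem (T.one_le_entry hp) (T.entry_le_size p)) hp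
    (T.entry_pos (T.one_le_entry hp) (T.entry_le_size p))

theorem pos_eq (T : ShSYT lam) {p : ℕ × ℕ} {x : ℕ} (hx : 1 ≤ x) (h : T.entry p = x) :
    T.pos x = p := by
  subst h
  exact T.pos_entry (T.mem_iff_entry_pos.mpr hx)

/-- The position of the letter `x` in the reading word, measured by an integer. -/
noncomputable def key (T : ShSYT lam) (x : ℕ) : ℤ := (T.pos x).2 - (T.pos x).1 * n

/-- Column indices below `n` make `key` lexicographic. The bottom row contains a cell in every
column up to `p.2`, with strictly increasing entries. -/
theorem col_lt_size (T : ShSYT lam) {p : ℕ × ℕ} (hp : p ∈ lam.cells) : p.2 < n := by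
  obtain ⟨r, c⟩ := p
  have h0 : (0, c) ∈ lam.cells := lam.below_mem_of_le (Nat.zero_le r) hp
  have key : ∀ d, d ≤ c → d + 1 ≤ T.entry (0, d) := by
    intro d
    induction d with
    | zero => exact fun hd => T.one_le_entry (lam.mem_of_le h0 le_rfl hd le_rfl)
    | succ d ih =>
      intro hd
      have h2 := ih (by omega)
      have h3 := T.entry_lt (r := 0) (c := d) (lam.mem_of_le h0 le_rfl hd (by omega)) le_rfl
        (by omega) (by omega) (by omega)
      omega
  have h1 := key c le_rfl
  have h2 := T.entry_le_size (0, c)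
  simp only
  omega

/-- Turns relative positions of letters into linear inequalities, so that the case analyses for `b`
can be left to `omega`. -/
theorem readLT_iff_key (T : ShSYT lam) {x y : ℕ} (hx : 1 ≤ x) (hx' : x ≤ n) (hy : 1 ≤ y)
    (hy' : y ≤ n) : ReadLT (T.pos x) (T.pos y) ↔ T.key x < T.key y := by
  have h1 := T.col_lt_size (T.pos_mem hx hx')
  have h2 := T.col_lt_size (T.pos_mem hy hy')
  unfold ReadLT key
  generalize T.pos x = p at *
  generalize T.pos y = q at *
  obtain ⟨a, b⟩ := p
  obtain ⟨c, d⟩ := q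
  simp only at *
  zify at *
  rcases lt_trichotomy a c with h | rfl | h
  · have : ((a : ℤ) + 1) * n ≤ c * n := by
      apply mul_le_mul_of_nonneg_right <;> omega
    rw [add_mul] at this
    omega
  · omega
  · have : ((c : ℤ) + 1) * n ≤ a * n := by
      apply mul_le_mul_of_nonneg_right <;> omega
    rw [add_mul] at this
    omega

theorem before_iff_readLT (T : ShSYT lam) {x y : ℕ} (hx : 1 ≤ x) (hx' : x ≤ n) (hy : 1 ≤ y)
    (hy' : y ≤ n) : T.Before x y ↔ ReadLT (T.pos x) (T.pos y) := by
  constructor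
  · rintro ⟨p, hp, q, hq, rfl, rfl, h⟩
    rwa [T.pos_entry hp, T.pos_entry hq]
  · exact fun h => ⟨_, T.pos_mem hx hx', _, T.pos_mem hy hy', T.entry_pos hx hx',
      T.entry_pos hy hy', h⟩

theorem before_iff (T : ShSYT lam) {x y : ℕ} (hx : 1 ≤ x) (hx' : x ≤ n) (hy : 1 ≤ y)
    (hy' : y ≤ n) : T.Before x y ↔ T.key x < T.key y := by
  rw [T.before_iff_readLT hx hx' hy hy', T.readLT_iff_key hx hx' hy hy']

theorem Before.range {T : ShSYT lam} {x y : ℕ} (h : T.Before x y) :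
    (1 ≤ x ∧ x ≤ n) ∧ 1 ≤ y ∧ y ≤ n := by
  obtain ⟨p, hp, q, hq, rfl, rfl, -⟩ := h
  exact ⟨⟨T.one_le_entry hp, T.entry_le_size p⟩, T.one_le_entry hq, T.entry_le_size q⟩

theorem key_ne (T : ShSYT lam) {x y : ℕ} (hx : 1 ≤ x) (hx' : x ≤ n) (hy : 1 ≤ y)
    (hy' : y ≤ n) (hne : x ≠ y) : T.key x ≠ T.key y := by
  have hp : T.pos x ≠ T.pos y := by
    intro h
    apply hne
    rw [← T.entry_pos hx hx', ← T.entry_pos hy hy', h]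
  rcases ReadLT.trichotomy hp with h | h
  · exact ((T.readLT_iff_key hx hx' hy hy').mp h).ne
  · exact ((T.readLT_iff_key hy hy' hx hx').mp h).ne'

theorem mem_peak_iff (T : ShSYT lam) {h : ℕ} :
    h ∈ T.peak ↔ 1 < h ∧ h < n ∧ T.key (h - 1) < T.key h ∧ T.key (h + 1) < T.key h := by
  unfold peak des
  simp only [Set.mem_ofPred_eq]
  constructor
  · rintro ⟨h1, h2, h3⟩
    obtain ⟨⟨-, h4⟩, -, -⟩ := h3.range
    rw [T.before_iff (by omega) (by omega) (by omega) (by omega)] at h2 h3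
    rw [Nat.sub_add_cancel (by omega)] at h2
    have := T.key_ne (x := h - 1) (y := h) (by omega) (by omega) (by omega) (by omega) (by omega)
    exact ⟨h1, by omega, by omega, h3⟩
  · rintro ⟨h1, h2, h3, h4⟩
    rw [T.before_iff (by omega) (by omega) (by omega) (by omega),
      T.before_iff (by omega) (by omega) (by omega) (by omega), Nat.sub_add_cancel (by omega)]
    exact ⟨h1, by omega, h4⟩

theorem succ_mem_peak_iff (T : ShSYT lam) {h : ℕ} :
    h + 1 ∈ T.peak ↔ 0 < h ∧ h + 1 < n ∧ T.key h < T.key (h + 1) ∧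
      T.key (h + 2) < T.key (h + 1) := by
  rw [mem_peak_iff]
  simp only [Nat.add_sub_cancel, Nat.add_assoc, Nat.reduceAdd]
  omega

/-! ### The elementary involutions and their effect on peaks. -/

theorem IsMove.range {T : ShSYT lam} {i a : ℕ} (h : T.IsMove i a) : 1 < i ∧ i + 1 < n := by
  obtain ⟨h1, c, d, hs, hc, hb, hd⟩ := h
  have hr : ∀ x, x = a ∨ x = a + 1 ∨ x = c ∨ x = d → 1 ≤ x ∧ x ≤ n := by
    have := hd.range
    rcases hb with ⟨u, v⟩ | ⟨u, v⟩ <;> have := u.range <;> have := v.range <;> omega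
  have f1 := Finset.ext_iff.mp hs (i - 1)
  have f2 := Finset.ext_iff.mp hs (i + 2)
  simp only [Finset.mem_insert, Finset.mem_singleton, or_true, true_or, iff_true] at f1 f2
  have := hr _ f1
  have := hr _ f2
  omega

/-- Writing the index as `j + 1` avoids truncated subtraction. For an outer pair the separating
letter is forced; for the middle pair it is either end, and the other end is then the letter to its
left. -/
theorem isMove_iff (T : ShSYT lam) {j a : ℕ} (hi : 0 < j) (hi' : j + 3 ≤ n) :
    T.IsMove (j + 1) a ↔
      (a = j ∧ T.key (j + 3) < T.key (j + 2) ∧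
        ((T.key j < T.key (j + 2) ∧ T.key (j + 2) < T.key (j + 1)) ∨
          (T.key (j + 1) < T.key (j + 2) ∧ T.key (j + 2) < T.key j))) ∨
      (a = j + 1 ∧ ((T.key (j + 3) < T.key j ∧
        ((T.key (j + 1) < T.key j ∧ T.key j < T.key (j + 2)) ∨
          (T.key (j + 2) < T.key j ∧ T.key j < T.key (j + 1)))) ∨
        (T.key j < T.key (j + 3) ∧
        ((T.key (j + 1) < T.key (j + 3) ∧ T.key (j + 3) < T.key (j + 2)) ∨
          (T.key (j + 2) < T.key (j + 3) ∧ T.key (j + 3) < T.key (j + 1)))))) ∨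
      (a = j + 2 ∧ T.key j < T.key (j + 1) ∧
        ((T.key (j + 2) < T.key (j + 1) ∧ T.key (j + 1) < T.key (j + 3)) ∨
          (T.key (j + 3) < T.key (j + 1) ∧ T.key (j + 1) < T.key (j + 2)))) := by
  have bf := fun x y (hx : j ≤ x ∧ x ≤ j + 3) (hy : j ≤ y ∧ y ≤ j + 3) =>
    T.before_iff (x := x) (y := y) (by omega) (by omega) (by omega) (by omega)
  have e01 := bf j (j + 1) (by omega) (by omega)
  have e02 := bf j (j + 2) (by omega) (by omega)
  have e03 := bf j (j + 3) (by omega) (by omega)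
  have e10 := bf (j + 1) j (by omega) (by omega)
  have e12 := bf (j + 1) (j + 2) (by omega) (by omega)
  have e13 := bf (j + 1) (j + 3) (by omega) (by omega)
  have e20 := bf (j + 2) j (by omega) (by omega)
  have e21 := bf (j + 2) (j + 1) (by omega) (by omega)
  have e23 := bf (j + 2) (j + 3) (by omega) (by omega)
  have e30 := bf (j + 3) j (by omega) (by omega)
  have e31 := bf (j + 3) (j + 1) (by omega) (by omega)
  have e32 := bf (j + 3) (j + 2) (by omega) (by omega)
  simp only [← e01, ← e02, ← e03, ← e10, ← e12, ← e13, ← e20, ← e21, ← e23, ← e30, ← e31, ← e32]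
  clear bf e01 e02 e03 e10 e12 e13 e20 e21 e23 e30 e31 e32
  constructor
  · rintro ⟨h1, c, d, hs, hc, hb, hd⟩
    have hcases : (a = j ∧ c = j + 2 ∧ d = j + 3) ∨ (a = j + 1 ∧ c = j ∧ d = j + 3) ∨
        (a = j + 1 ∧ c = j + 3 ∧ d = j) ∨ (a = j + 2 ∧ c = j + 1 ∧ d = j) := by
      have f1 := Finset.ext_iff.mp hs j
      have f2 := Finset.ext_iff.mp hs (j + 1)
      have f3 := Finset.ext_iff.mp hs (j + 2)
      have f4 := Finset.ext_iff.mp hs (j + 3)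
      have g1 := Finset.ext_iff.mp hs a
      have g2 := Finset.ext_iff.mp hs c
      simp only [Nat.add_sub_cancel, Nat.add_assoc, Nat.reduceAdd, Finset.mem_insert,
        Finset.mem_singleton, or_true, true_or, iff_true, true_iff] at f1 f2 f3 f4 g1 g2
      clear hs hb hd h1
      rcases g1 with rfl | rfl | rfl | rfl <;> rcases hc with hc | hc <;> omega
    unfold Between at hb
    rcases hcases with ⟨rfl, rfl, rfl⟩ | ⟨rfl, rfl, rfl⟩ | ⟨rfl, rfl, rfl⟩ | ⟨rfl, rfl, rfl⟩
    · exact Or.inl ⟨rfl, hd, by tauto⟩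
    · exact Or.inr (Or.inl ⟨rfl, Or.inl ⟨hd, by tauto⟩⟩)
    · exact Or.inr (Or.inl ⟨rfl, Or.inr ⟨hd, by tauto⟩⟩)
    · exact Or.inr (Or.inr ⟨rfl, hd, by tauto⟩)
  · rintro (⟨rfl, h2, h3⟩ | ⟨rfl, ⟨h2, h3⟩ | ⟨h2, h3⟩⟩ | ⟨rfl, h2, h3⟩)
    · refine ⟨by omega, a + 2, a + 3, ?_, by omega, h3, h2⟩
      ext x; simp only [Finset.mem_insert, Finset.mem_singleton]; omega
    · refine ⟨by omega, j, j + 3, ?_, by omega, h3, h2⟩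
      ext x; simp only [Finset.mem_insert, Finset.mem_singleton]; omega
    · refine ⟨by omega, j + 3, j, ?_, by omega, h3, h2⟩
      ext x; simp only [Finset.mem_insert, Finset.mem_singleton]; omega
    · refine ⟨by omega, j + 1, j, ?_, by omega, h3, h2⟩
      ext x; simp only [Finset.mem_insert, Finset.mem_singleton]; omega

/-- The moved letters form one of three pairs. -/
theorem IsMove.eq_or {T : ShSYT lam} {i a : ℕ} (h : T.IsMove i a) :
    a + 1 = i ∨ a = i ∨ a = i + 1 := by
  obtain ⟨j, rfl⟩ : ∃ j, i = j + 1 := ⟨i - 1, by have := h.range; omega⟩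
  have hr := h.range
  have := (T.isMove_iff (by omega) (by omega)).mp h
  omega

theorem IsMove.unique {T : ShSYT lam} {i a a' : ℕ} (h : T.IsMove i a) (h' : T.IsMove i a') :
    a = a' := by
  obtain ⟨j, rfl⟩ : ∃ j, i = j + 1 := ⟨i - 1, by have := h.range; omega⟩
  have hr := h.range
  rw [T.isMove_iff (by omega) (by omega)] at h h'
  omega

theorem b_eq_swap {T : ShSYT lam} {i a : ℕ} (h : T.IsMove i a) : T.b i = T.swap h := by
  unfold b
  split_ifs with h1 h2 h3
  · obtain rfl := h.unique h1; rfl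
  · obtain rfl := h.unique h2; rfl
  · obtain rfl := h.unique h3; rfl
  · have : a = i - 1 ∨ a = i ∨ a = i + 1 := by have := h.eq_or; omega
    rcases this with rfl | rfl | rfl <;> contradiction

theorem b_eq_self {T : ShSYT lam} {i : ℕ} (h : ∀ a, ¬ T.IsMove i a) : T.b i = T := by
  unfold b
  rw [dif_neg (h _), dif_neg (h _), dif_neg (h _)]

theorem entry_b {T : ShSYT lam} {i a : ℕ} (h : T.IsMove i a) (p : ℕ × ℕ) :
    (T.b i).entry p = Equiv.swap a (a + 1) (T.entry p) := by
  rw [b_eq_swap h]; rfl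

theorem pos_eq_of_swap {S T : ShSYT lam} {a : ℕ} (ha : 1 ≤ a)
    (h : ∀ p, S.entry p = Equiv.swap a (a + 1) (T.entry p)) {x : ℕ} (hx : 1 ≤ x) (hxn : x ≤ n)
    (han : a + 1 ≤ n) : S.pos x = T.pos (Equiv.swap a (a + 1) x) := by
  have : 1 ≤ Equiv.swap a (a + 1) x ∧ Equiv.swap a (a + 1) x ≤ n := by
    rw [Equiv.swap_apply_def]
    split_ifs <;> omega
  apply S.pos_eq hx
  rw [h, T.entry_pos this.1 this.2, Equiv.swap_apply_self]

theorem key_b {T : ShSYT lam} {i a : ℕ} (h : T.IsMove i a) :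
    (T.b i).key a = T.key (a + 1) ∧ (T.b i).key (a + 1) = T.key a ∧
      ∀ x, 1 ≤ x → x ≤ n → x ≠ a → x ≠ a + 1 → (T.b i).key x = T.key x := by
  have hm := h.mem
  refine ⟨?_, ?_, fun x h1 h2 h3 h4 => ?_⟩ <;> unfold key <;>
    rw [pos_eq_of_swap hm.1 (entry_b h) (by omega) (by omega) hm.2]
  · rw [Equiv.swap_apply_left]
  · rw [Equiv.swap_apply_right]
  · rw [Equiv.swap_apply_of_ne_of_ne h3 h4]

theorem entry_b_of_lt {T : ShSYT lam} {i : ℕ} {p : ℕ × ℕ}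
    (h : T.entry p + 1 < i ∨ i + 2 < T.entry p) : (T.b i).entry p = T.entry p := by
  by_cases hm : ∃ a, T.IsMove i a
  · obtain ⟨a, hm⟩ := hm
    have := hm.eq_or
    rw [entry_b hm, Equiv.swap_apply_of_ne_of_ne] <;> omega
  · push Not at hm
    rw [b_eq_self hm]

theorem entry_b_lt_iff {T : ShSYT lam} {i m : ℕ} (h : i + 2 ≤ m) (p : ℕ × ℕ) :
    m < (T.b i).entry p ↔ m < T.entry p := by
  by_cases hm : ∃ a, T.IsMove i a
  · obtain ⟨a, hm⟩ := hm
    have := hm.eq_or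
    rw [entry_b hm, Equiv.swap_apply_def]
    split_ifs <;> omega
  · push Not at hm
    rw [b_eq_self hm]

theorem pos_b_of_lt {T : ShSYT lam} {i x : ℕ} (hx : 1 ≤ x) (hxn : x ≤ n)
    (h : x + 1 < i ∨ i + 2 < x) : (T.b i).pos x = T.pos x := by
  apply (T.b i).pos_eq hx
  rw [entry_b_of_lt] <;> rw [T.entry_pos hx hxn]
  exact h

theorem b_ne_self {T : ShSYT lam} {i a : ℕ} (h : T.IsMove i a) : T.b i ≠ T := by
  intro he
  have := (key_b h).1
  rw [he] at this
  have hm := h.mem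
  exact T.key_ne (by omega) (by omega) (by omega) hm.2 (by omega) this

/-- After the interchange the same pair qualifies again: the other two letters stay in place, and
betweenness is symmetric in the two ends. -/
theorem b_involutive (i : ℕ) : Function.Involutive (fun T : ShSYT lam => T.b i) := by
  intro T
  simp only
  by_cases hm : ∃ a, T.IsMove i a
  · obtain ⟨a, hm⟩ := hm
    obtain ⟨j, rfl⟩ : ∃ j, i = j + 1 := ⟨i - 1, by have := hm.range; omega⟩
    have hr := hm.range
    have h1 := (T.isMove_iff (by omega) (by omega)).mp hm
    obtain ⟨k1, k2, k3⟩ := key_b hm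
    have hm' : (T.b (j + 1)).IsMove (j + 1) a := by
      rw [isMove_iff _ (by omega) (by omega)]
      rcases h1 with ⟨rfl, h1⟩ | ⟨rfl, h1⟩ | ⟨rfl, h1⟩
      · have e1 := k3 (a + 2) (by omega) (by omega) (by omega) (by omega)
        have e2 := k3 (a + 3) (by omega) (by omega) (by omega) (by omega)
        omega
      · have e1 := k3 j (by omega) (by omega) (by omega) (by omega)
        have e2 := k3 (j + 3) (by omega) (by omega) (by omega) (by omega)
        simp only [Nat.add_assoc, Nat.reduceAdd] at k1 k2
        omega
      · have e1 := k3 j (by omega) (by omega) (by omega) (by omega)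
        have e2 := k3 (j + 1) (by omega) (by omega) (by omega) (by omega)
        simp only [Nat.add_assoc, Nat.reduceAdd] at k1 k2
        omega
    ext p
    rw [entry_b hm', entry_b hm, Equiv.swap_apply_self]
  · push Not at hm
    rw [b_eq_self hm, b_eq_self hm]

theorem b_b (T : ShSYT lam) (i : ℕ) : (T.b i).b i = T := b_involutive i T

theorem exists_isMove {T : ShSYT lam} {i : ℕ} (h : T.b i ≠ T) : ∃ a, T.IsMove i a := by
  by_contra hc
  push Not at hc
  exact h (b_eq_self hc)

/-- Condition (i) for tableaux. Given a peak at one of the two inner letters, comparing it with the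
remaining letters exhibits the pair to be interchanged. -/
theorem b_eq_self_iff {T : ShSYT lam} {i : ℕ} (hi : 1 < i) (hi' : i + 1 < n) :
    T.b i = T ↔ i ∉ T.peak ∧ i + 1 ∉ T.peak := by
  have hnot : T.b i = T ↔ ¬ ∃ a, T.IsMove i a :=
    ⟨fun h ⟨a, ha⟩ => b_ne_self ha h, fun h => b_eq_self (not_exists.mp h)⟩
  obtain ⟨j, rfl⟩ : ∃ j, i = j + 1 := ⟨i - 1, by omega⟩
  have d1 := T.key_ne (x := j) (y := j + 1) (by omega) (by omega) (by omega) (by omega) (by omega)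
  have d2 := T.key_ne (x := j) (y := j + 2) (by omega) (by omega) (by omega) (by omega) (by omega)
  have d3 := T.key_ne (x := j) (y := j + 3) (by omega) (by omega) (by omega) (by omega) (by omega)
  have d4 := T.key_ne (x := j + 1) (y := j + 2) (by omega) (by omega) (by omega) (by omega)
    (by omega)
  have d5 := T.key_ne (x := j + 1) (y := j + 3) (by omega) (by omega) (by omega) (by omega)
    (by omega)
  have d6 := T.key_ne (x := j + 2) (y := j + 3) (by omega) (by omega) (by omega) (by omega)
    (by omega)
  rw [hnot, ← not_or, not_iff_not, succ_mem_peak_iff, succ_mem_peak_iff]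
  simp only [Nat.add_assoc, Nat.reduceAdd]
  constructor
  · rintro ⟨a, ha⟩
    have := (T.isMove_iff (by omega) (by omega)).mp ha
    omega
  · intro h
    have hm := fun a => (T.isMove_iff (j := j) (a := a) (by omega) (by omega)).mpr
    rcases h with ⟨-, -, h⟩ | ⟨-, -, h⟩ <;> clear hi hi' hnot d4
    · rcases d6.lt_or_gt with h1 | h1
      · rcases d5.lt_or_gt with h2 | h2
        · exact ⟨j + 2, hm _ (Or.inr (Or.inr ⟨rfl, h.1, Or.inl ⟨h.2, h2⟩⟩))⟩
        · rcases d3.lt_or_gt with h3 | h3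
          · exact ⟨j + 1, hm _ (Or.inr (Or.inl ⟨rfl, Or.inr ⟨h3, Or.inr ⟨h1, h2⟩⟩⟩))⟩
          · exact ⟨j + 1, hm _ (Or.inr (Or.inl ⟨rfl, Or.inl ⟨h3, Or.inr ⟨h1.trans h3, h.1⟩⟩⟩))⟩
      · rcases d2.lt_or_gt with h2 | h2
        · exact ⟨j, hm j (Or.inl ⟨rfl, h1, Or.inl ⟨h2, h.2⟩⟩)⟩
        · exact ⟨j + 1, hm _ (Or.inr (Or.inl ⟨rfl, Or.inl ⟨h1.trans h2, Or.inr ⟨h2, h.1⟩⟩⟩))⟩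
    · rcases d2.lt_or_gt with h1 | h1
      · rcases d5.lt_or_gt with h2 | h2
        · rcases d3.lt_or_gt with h3 | h3
          · exact ⟨j + 1, hm _ (Or.inr (Or.inl ⟨rfl, Or.inr ⟨h3, Or.inl ⟨h2, h.2⟩⟩⟩))⟩
          · exact ⟨j + 1, hm _ (Or.inr (Or.inl ⟨rfl, Or.inl ⟨h3, Or.inl ⟨h2.trans h3, h1⟩⟩⟩))⟩
        · rcases lt_or_ge (T.key j) (T.key (j + 1)) with h3 | h3
          · exact ⟨j + 2, hm _ (Or.inr (Or.inr ⟨rfl, h3, Or.inr ⟨h2, h.1⟩⟩))⟩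
          · exact ⟨j + 1, hm _ (Or.inr (Or.inl ⟨rfl, Or.inl ⟨h2.trans_le h3, Or.inl
              ⟨lt_of_le_of_ne h3 d1.symm, h1⟩⟩⟩))⟩
      · exact ⟨j, hm _ (Or.inl ⟨rfl, h.2, Or.inr ⟨h.1, h1⟩⟩)⟩

/-- Part of condition (ii) for tableaux. The image is not fixed either, so it has a peak at `i` or
`i + 1`; a peak at `i + 1` on both sides is refuted for each pair that can be moved. -/
theorem mem_peak_b {T : ShSYT lam} {i : ℕ} (hi : 1 < i) (hi' : i + 1 < n)
    (h : i + 1 ∈ T.peak) : i ∈ (T.b i).peak := by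
  have hne : T.b i ≠ T := fun he => ((b_eq_self_iff hi hi').mp he).2 h
  have hne' : (T.b i).b i ≠ T.b i := by rw [b_b]; exact hne.symm
  have := mt (b_eq_self_iff (T := T.b i) hi hi').mpr hne'
  by_contra hc
  have h2 : i + 1 ∈ (T.b i).peak := by tauto
  obtain ⟨a, hm⟩ := exists_isMove hne
  clear hne hne' this hc
  obtain ⟨j, rfl⟩ : ∃ j, i = j + 1 := ⟨i - 1, by omega⟩
  have h1 := (T.isMove_iff (by omega) (by omega)).mp hm
  obtain ⟨k1, k2, k3⟩ := key_b hm
  rw [succ_mem_peak_iff] at h h2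
  simp only [Nat.add_assoc, Nat.reduceAdd] at h h2
  rcases h1 with ⟨rfl, h1⟩ | ⟨rfl, h1⟩ | ⟨rfl, h1⟩
  · have e1 := k3 (a + 2) (by omega) (by omega) (by omega) (by omega)
    have e2 := k3 (a + 3) (by omega) (by omega) (by omega) (by omega)
    omega
  · have e2 := k3 (j + 3) (by omega) (by omega) (by omega) (by omega)
    simp only [Nat.add_assoc, Nat.reduceAdd] at k1 k2
    omega
  · have e2 := k3 (j + 1) (by omega) (by omega) (by omega) (by omega)
    simp only [Nat.add_assoc, Nat.reduceAdd] at k1 k2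
    omega

/-- A peak at `i + 3` that is destroyed by `b i` is replaced by a peak at `i + 2`. -/
theorem add_two_mem_peak_b {T : ShSYT lam} {i : ℕ} (h : i + 3 ∈ T.peak)
    (h' : i + 3 ∉ (T.b i).peak) : i + 2 ∈ (T.b i).peak := by
  obtain ⟨a, hm⟩ := exists_isMove (T := T) (i := i) fun he => h' (by rwa [he])
  obtain ⟨hi, hi'⟩ := hm.range
  obtain ⟨j, rfl⟩ : ∃ j, i = j + 1 := ⟨i - 1, by omega⟩
  have h1 := (T.isMove_iff (by omega) (by omega)).mp hm
  obtain ⟨k1, k2, k3⟩ := key_b hm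
  rw [show j + 1 + 3 = (j + 3) + 1 by omega, succ_mem_peak_iff] at h h'
  rw [show j + 1 + 2 = (j + 2) + 1 by omega, succ_mem_peak_iff]
  simp only [Nat.add_assoc, Nat.reduceAdd] at h h' ⊢
  have e3 := k3 (j + 4) (by omega) (by omega) (by omega) (by omega)
  have e4 := k3 (j + 5) (by omega) (by omega) (by omega) (by omega)
  have d := (T.b (j + 1)).key_ne (x := j + 3) (y := j + 4) (by omega) (by omega) (by omega)
    (by omega) (by omega)
  rcases h1 with ⟨rfl, h1⟩ | ⟨rfl, h1⟩ | ⟨rfl, h1⟩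
  · have e2 := k3 (a + 3) (by omega) (by omega) (by omega) (by omega)
    omega
  · have e2 := k3 (j + 3) (by omega) (by omega) (by omega) (by omega)
    omega
  · simp only [Nat.add_assoc, Nat.reduceAdd] at k1 k2
    omega

/-- A peak at `i - 2` persists under `b i` if there is a peak at `i + 1`. -/
theorem mem_peak_b_of_add_three_mem {T : ShSYT lam} {i : ℕ} (h : i ∈ T.peak)
    (h' : i + 3 ∈ T.peak) : i ∈ (T.b (i + 2)).peak := by
  by_cases hm : T.b (i + 2) = T
  · rwa [hm]
  obtain ⟨a, hm⟩ := exists_isMove hm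
  obtain ⟨hi, hi'⟩ := hm.range
  obtain ⟨j, rfl⟩ : ∃ j, i = j + 1 := ⟨i - 1, by have := h.1; omega⟩
  rw [show j + 1 + 2 = (j + 2) + 1 by omega] at *
  have h1 := (T.isMove_iff (by omega) (by omega)).mp hm
  obtain ⟨k1, k2, k3⟩ := key_b hm
  rw [show j + 1 + 3 = (j + 3) + 1 by omega] at h'
  rw [succ_mem_peak_iff] at h h' ⊢
  simp only [Nat.add_assoc, Nat.reduceAdd] at h h' h1 k1 k2 k3 ⊢
  have e0 := k3 j (by omega) (by omega) (by omega) (by omega)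
  have e1 := k3 (j + 1) (by omega) (by omega) (by omega) (by omega)
  rcases h1 with ⟨rfl, h1⟩ | ⟨rfl, h1⟩ | ⟨rfl, h1⟩
  · simp only [Nat.add_assoc, Nat.reduceAdd] at k1 k2
    omega
  · have e2 := k3 (j + 2) (by omega) (by omega) (by omega) (by omega)
    omega
  · have e2 := k3 (j + 2) (by omega) (by omega) (by omega) (by omega)
    omega

end ShSYT

/-! ### Transitivity of the involutions on fillings with fixed large letters. -/

namespace ShSYT

variable {n : ℕ} {lam : StrictPartition n}

/-- Two tableaux have the same letters above `m`, in the same cells. -/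
def AgreeAbove (m : ℕ) (S S' : ShSYT lam) : Prop :=
  ∀ p, m < S.entry p ∨ m < S'.entry p → S'.entry p = S.entry p

theorem AgreeAbove.refl (m : ℕ) (S : ShSYT lam) : AgreeAbove m S S := fun _ _ => rfl

theorem AgreeAbove.symm {m : ℕ} {S S' : ShSYT lam} (h : AgreeAbove m S S') : AgreeAbove m S' S :=
  fun p hp => (h p hp.symm).symm

theorem AgreeAbove.lt_iff {m k : ℕ} {S S' : ShSYT lam} (h : AgreeAbove m S S') (hk : m ≤ k)
    (p : ℕ × ℕ) : k < S'.entry p ↔ k < S.entry p := by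
  have := h p
  omega

theorem AgreeAbove.le_iff {m k : ℕ} {S S' : ShSYT lam} (h : AgreeAbove m S S') (hk : m ≤ k)
    (p : ℕ × ℕ) : S'.entry p ≤ k ↔ S.entry p ≤ k := by
  have := h.lt_iff hk p
  omega

theorem AgreeAbove.trans {m : ℕ} {S S' S'' : ShSYT lam} (h : AgreeAbove m S S')
    (h' : AgreeAbove m S' S'') : AgreeAbove m S S'' := by
  intro p hp
  have h1 := h p
  have h2 := h' p
  omega

theorem AgreeAbove.mono {m m' : ℕ} {S S' : ShSYT lam} (h : AgreeAbove m S S') (hm : m ≤ m') :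
    AgreeAbove m' S S' := fun p hp => h p (by omega)

theorem AgreeAbove.entry_eq {m x : ℕ} {S S' : ShSYT lam} (h : AgreeAbove m S S') {p : ℕ × ℕ}
    (hp : S.entry p = x) (hx : m < x) : S'.entry p = x := by
  rw [h p (by omega), hp]

theorem agreeAbove_b (T : ShSYT lam) {i m : ℕ} (h : i + 2 ≤ m) : AgreeAbove m T (T.b i) := by
  intro p hp
  rw [entry_b_lt_iff h, or_self] at hp
  exact entry_b_of_lt (by omega)

/-- Two consecutive letters in cells that are not in the same row or column may be interchanged. -/
theorem exists_swap (S : ShSYT lam) {a : ℕ} (ha : 1 ≤ a) (han : a + 1 ≤ n)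
    (h1 : ¬ Dominates (S.pos (a + 1)) (S.pos a)) :
    ∃ S' : ShSYT lam, ∀ p, S'.entry p = Equiv.swap a (a + 1) (S.entry p) := by
  have hno : ∀ p ∈ lam.cells, ∀ q ∈ lam.cells, S.entry p = a → S.entry q = a + 1 →
      ¬ Dominates q p := by
    intro p _ q _ e1 e2
    rwa [← S.pos_eq ha e1, ← S.pos_eq (by omega) e2]
  refine ⟨⟨fun p => Equiv.swap a (a + 1) (S.entry p), ?_, ?_, ?_, ?_⟩, fun p => rfl⟩
  · intro p hp
    rw [S.entry_eq_zero p hp]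
    exact Equiv.swap_apply_of_ne_of_ne (by omega) (by omega)
  · refine Set.BijOn.comp (g := Equiv.swap a (a + 1)) (t := Set.Icc 1 n) ?_ S.bijOn
    have hmap : Set.MapsTo (Equiv.swap a (a + 1)) (Set.Icc 1 n) (Set.Icc 1 n) := by
      intro x hx
      rw [Equiv.swap_apply_def]
      split_ifs <;> simp only [Set.mem_Icc] at * <;> omega
    exact ⟨hmap, (Equiv.injective _).injOn, fun x hx => ⟨_, hmap hx, Equiv.swap_apply_self _ _ _⟩⟩
  · intro r c c' hc m1 m2
    have hlt := S.row_lt r c c' hc m1 m2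
    have hn := fun e1 e2 => hno _ m1 _ m2 e1 e2 (Or.inl ⟨rfl, hc⟩)
    simp only [Equiv.swap_apply_def]
    split_ifs <;> first | omega | exact absurd ‹_› (fun e => hn ‹_› e)
  · intro r r' c hr m1 m2
    have hlt := S.col_lt r r' c hr m1 m2
    have hn := fun e1 e2 => hno _ m1 _ m2 e1 e2 (Or.inr ⟨rfl, hr⟩)
    simp only [Equiv.swap_apply_def]
    split_ifs <;> first | omega | exact absurd ‹_› (fun e => hn ‹_› e)

/-- A cell that is maximal among the cells with entries at most `m` can be given the entry `m`. -/
theorem exists_raise (S : ShSYT lam) {m : ℕ} {p : ℕ × ℕ} (hp : p ∈ lam.cells) (hm : m ≤ n)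
    (hle : S.entry p ≤ m) (hmax : ∀ q ∈ lam.cells, Dominates q p → m < S.entry q) :
    ∃ S' : ShSYT lam, S'.entry p = m ∧ AgreeAbove m S S' := by
  obtain ⟨d, hd⟩ : ∃ d, S.entry p + d = m := ⟨m - S.entry p, by omega⟩
  induction d generalizing S with
  | zero => exact ⟨S, by omega, AgreeAbove.refl _ _⟩
  | succ d ih =>
    have h1 := S.one_le_entry hp
    -- Interchange the letter in `p` with its successor: by `hmax` the successor, being at most `m`,
    -- does not dominate `p`.
    obtain ⟨S1, hS1⟩ := S.exists_swap (a := S.entry p) h1 (by omega) (by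
      intro hdom
      rw [S.pos_entry hp] at hdom
      have := hmax _ (S.pos_mem (by omega) (by omega)) hdom
      rw [S.entry_pos (by omega) (by omega)] at this
      omega)
    have hag : AgreeAbove m S S1 := by
      intro q hq
      rw [hS1, Equiv.swap_apply_def] at *
      split_ifs at * <;> omega
    have e1 : S1.entry p = S.entry p + 1 := by rw [hS1, Equiv.swap_apply_left]
    obtain ⟨S', h2, h3⟩ := ih S1 (by omega) (fun q hq hdom => by
      rw [hag.lt_iff le_rfl]
      exact hmax q hq hdom) (by omega)
    exact ⟨S', h2, hag.trans h3⟩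

/-- A nonempty set of letters contains a largest one. -/
theorem exists_max_entry (S : ShSYT lam) (P : ℕ × ℕ → Prop) {p : ℕ × ℕ} (hp : p ∈ lam.cells)
    (h : P p) : ∃ w ∈ lam.cells, P w ∧ ∀ q ∈ lam.cells, P q → S.entry q ≤ S.entry w := by
  classical
  have hb : ∀ k, (∃ w ∈ lam.cells, P w ∧ S.entry w = k) → k ≤ n := by
    rintro k ⟨w, -, -, rfl⟩
    exact S.entry_le_size w
  have hs := Nat.findGreatest_spec (P := fun k => ∃ w ∈ lam.cells, P w ∧ S.entry w = k)
    (S.entry_le_size p) ⟨p, hp, h, rfl⟩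
  obtain ⟨w, h1, h2, h3⟩ := hs
  exact ⟨w, h1, h2, fun q hq hq' => h3 ▸
    Nat.le_findGreatest (S.entry_le_size q) ⟨q, hq, hq', rfl⟩⟩

/-- Between two cells that are addable to the set of the cells with entries at most `k`, there is
a maximal one of these cells. -/
theorem exists_between (S : ShSYT lam) {k r1 x1 r2 x2 : ℕ} (hr : r2 < r1) (hx : x1 < x2)
    (h1 : (r1, x1) ∈ lam.cells) (h1k : k < S.entry (r1, x1))
    (hbelow : ∀ r, r < r1 → S.entry (r, x1) ≤ k)
    (h2 : ∀ x, (r2, x) ∈ lam.cells → S.entry (r2, x) ≤ k → x < x2) :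
    ∃ w ∈ lam.cells, S.entry w ≤ k ∧ ReadLT (r1, x1) w ∧ ReadLT w (r2, x2) ∧ w.1 < w.2 ∧
      ∀ q ∈ lam.cells, Dominates q w → k < S.entry q := by
  have hd := h1.1
  simp only at hd
  have hcol : ∀ r, r < r1 → (r, x1) ∈ lam.cells := fun r hr => lam.below_mem_of_le hr.le h1
  -- The largest entry among the candidates works; the cell `(r2, x1)` shows that there is a
  -- candidate.
  obtain ⟨⟨r, c⟩, hw, ⟨hwk, hw1, hw2⟩, hmax⟩ := S.exists_max_entry
    (fun w => S.entry w ≤ k ∧ ReadLT (r1, x1) w ∧ ReadLT w (r2, x2)) (hcol r2 hr)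
    ⟨hbelow _ hr, Or.inl hr, Or.inr ⟨rfl, hx⟩⟩
  simp only [ReadLT] at hw1 hw2 hmax
  have hrc := hw.1
  simp only at hrc
  have hrr : r < r1 := by
    by_contra hc
    have := S.entry_lt (r := r1) (c := x1) hw (by omega) (by omega) hd (by omega)
    omega
  have hcx : x1 ≤ c := by
    by_contra hc
    have h3 := hmax (r, x1) (hcol r hrr) ⟨hbelow r hrr, by simp only; omega, by simp only; omega⟩
    have h4 := S.row_lt r c x1 (by omega) hw (hcol r hrr)
    omega
  refine ⟨(r, c), hw, hwk, by simp only [ReadLT]; omega, by simp only [ReadLT]; omega,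
    by simp only; omega, ?_⟩
  rintro ⟨r', c'⟩ hq hdom
  by_contra hc
  push Not at hc
  have hlt := S.entry_lt_of_dominates hw hq hdom
  simp only [Dominates] at hdom
  -- A dominating cell with entry at most `k` has a larger entry than the maximum, so it is not a
  -- candidate. The places outside the interval are excluded by `h2` and by the entry of `(r1, x1)`.
  have hnot : ¬ ((r' < r1 ∨ r1 = r' ∧ x1 < c') ∧ (r2 < r' ∨ r' = r2 ∧ c' < x2)) := by
    intro h
    have := hmax (r', c') hq ⟨hc, h.1, h.2⟩
    omega
  have h5 : r' = r2 → c' < x2 := by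
    rintro rfl
    exact h2 c' hq hc
  have h6 : ¬ (r1 ≤ r' ∧ x1 ≤ c') := by
    rintro ⟨h6, h7⟩
    have := S.entry_le hq h6 h7 hd
    omega
  omega

/-- Before an off-diagonal cell with entry above `k` whose left neighbour has an entry at most `k`,
there is a cell that is maximal among the cells with entries at most `k`. -/
theorem exists_before (S : ShSYT lam) {k : ℕ} {p : ℕ × ℕ} (hp : p ∈ lam.cells)
    (hoff : p.1 < p.2) (hk : k < S.entry p) (hleft : S.entry (p.1, p.2 - 1) ≤ k) :
    ∃ w ∈ lam.cells, S.entry w ≤ k ∧ ReadLT w p ∧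
      ∀ q ∈ lam.cells, Dominates q w → k < S.entry q := by
  obtain ⟨r, c⟩ := p
  simp only at hoff hleft
  have hl : (r, c - 1) ∈ lam.cells := lam.mem_of_le hp le_rfl (by omega) (by omega)
  obtain ⟨w, hw, ⟨hwk, hwp⟩, hmax⟩ := S.exists_max_entry
    (fun w => S.entry w ≤ k ∧ ReadLT w (r, c)) hl
    ⟨hleft, Or.inr ⟨rfl, by simp only; omega⟩⟩
  refine ⟨w, hw, hwk, hwp, fun q hq hdom => ?_⟩
  by_contra hc
  push Not at hc
  have hlt := S.entry_lt_of_dominates hw hq hdom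
  have hnot : ¬ ReadLT q (r, c) := fun h => by
    have := hmax q hq ⟨hc, h⟩
    omega
  obtain ⟨w1, w2⟩ := w
  obtain ⟨q1, q2⟩ := q
  simp only [ReadLT, Dominates] at *
  -- A cell that dominates `w` without preceding `p` must lie in the row of `p`, at `p` or to its
  -- right, where the entries exceed `k`.
  obtain rfl : q1 = r := by omega
  have := S.row_le (show c ≤ q2 by omega) hp hq
  omega

/-- One step by an involution that moves letters up to `m` only. -/
def Step (m : ℕ) (S S' : ShSYT lam) : Prop := ∃ i, 1 < i ∧ i + 1 < m ∧ S' = S.b i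

/-- Connectedness by the involutions that move letters up to `m` only. -/
def Conn (m : ℕ) : ShSYT lam → ShSYT lam → Prop := Relation.ReflTransGen (Step m)

theorem Conn.mono {m m' : ℕ} (hm : m ≤ m') {S S' : ShSYT lam} (h : Conn m S S') : Conn m' S S' :=
  Relation.ReflTransGen.mono (fun _ _ ⟨i, h1, h2, h3⟩ => ⟨i, h1, by omega, h3⟩) _ _ h

/-- If two cells are both maximal among the cells with entries at most `m + 1`, then some tableau
with these letters in these cells is a neighbour of one with the two letters interchanged. -/
theorem exists_exchange (S : ShSYT lam) {m : ℕ} {c c' : ℕ × ℕ} (hm : m + 1 ≤ n)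
    (hc : c ∈ lam.cells) (hc' : c' ∈ lam.cells) (hne : c ≠ c')
    (hS : S.entry c = m + 1) (hle : S.entry c' ≤ m)
    (hmax : ∀ q ∈ lam.cells, Dominates q c → m + 1 < S.entry q)
    (hmax' : ∀ q ∈ lam.cells, Dominates q c' → m + 1 < S.entry q) :
    ∃ S' : ShSYT lam, AgreeAbove m S S' ∧ S'.entry c' = m ∧ 3 ≤ m ∧ S'.IsMove (m - 1) m := by
  -- The filling to be built has `m + 1` in `c`, `m` in `c'`, `m - 1` in a cell `w` read between
  -- them, and `m - 2` in a cell before `w`. Then `m - 1` separates the pair and `m - 2` lies to its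
  -- left.
  obtain ⟨S1, e1, g1⟩ := S.exists_raise hc' (by omega) hle
    (fun q hq hd => (Nat.lt_succ_self m).trans (hmax' q hq hd))
  have e1c : S1.entry c = m + 1 := g1.entry_eq hS (by omega)
  have max1 : ∀ q ∈ lam.cells, Dominates q c → m + 1 < S1.entry q := fun q hq hd =>
    (g1.lt_iff (by omega) q).mpr (hmax q hq hd)
  have max1' : ∀ q ∈ lam.cells, Dominates q c' → m + 1 < S1.entry q := fun q hq hd =>
    (g1.lt_iff (by omega) q).mpr (hmax' q hq hd)
  have hm1 : 1 ≤ m := e1 ▸ S1.one_le_entry hc'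
  -- the two cells in reading order
  have hw : ∃ w ∈ lam.cells, S1.entry w ≤ m - 1 ∧ w.1 < w.2 ∧
      ((ReadLT c w ∧ ReadLT w c') ∨ (ReadLT c' w ∧ ReadLT w c)) ∧
      ∀ q ∈ lam.cells, Dominates q w → m - 1 < S1.entry q := by
    -- The two cells play the same role up to reading order, so the search for `w` is done once,
    -- with `a` the earlier cell.
    have main : ∀ a ∈ lam.cells, ∀ a' ∈ lam.cells, m - 1 < S1.entry a → S1.entry a ≤ m + 1 →
        m - 1 < S1.entry a' → S1.entry a' ≤ m + 1 → (∀ p ∈ lam.cells, p ≠ a → p ≠ a' →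
          S1.entry p ≤ m + 1 → S1.entry p ≤ m - 1) →
        (∀ q ∈ lam.cells, Dominates q a → m + 1 < S1.entry q) →
        (∀ q ∈ lam.cells, Dominates q a' → m + 1 < S1.entry q) → ReadLT a a' →
        ∃ w ∈ lam.cells, S1.entry w ≤ m - 1 ∧ w.1 < w.2 ∧ (ReadLT a w ∧ ReadLT w a') ∧
        ∀ q ∈ lam.cells, Dominates q w → m - 1 < S1.entry q := by
      rintro ⟨r1, x1⟩ ha ⟨r2, x2⟩ ha' l1 u1 l2 u2 hother mx mx' hread
      have hd1 := ha.1
      have hd2 := ha'.1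
      simp only [ReadLT] at hread hd1 hd2
      have hr : r2 < r1 := by
        by_contra hcon
        obtain rfl : r1 = r2 := by omega
        have := mx _ ha' (Or.inl ⟨rfl, by simp only; omega⟩)
        omega
      have hx : x1 < x2 := by
        by_contra hcon
        have hmem : (r2, x1) ∈ lam.cells := lam.below_mem_of_le hr.le ha
        have h1 := S1.col_lt r2 r1 x1 hr hmem ha
        rcases (show x2 ≤ x1 by omega).eq_or_lt with rfl | hlt
        · have := mx' _ ha (Or.inr ⟨rfl, hr⟩)
          omega
        · have := mx' _ hmem (Or.inl ⟨rfl, hlt⟩)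
          omega
      obtain ⟨w, h1, h2, h3, h4, h5, h6⟩ := S1.exists_between (k := m - 1) hr hx ha l1
        (fun r hr' => by
          have hmem : (r, x1) ∈ lam.cells := lam.below_mem_of_le hr'.le ha
          have := S1.col_lt r r1 x1 hr' hmem ha
          refine hother _ hmem ?_ ?_ (by omega)
          · intro h; simp only [Prod.mk.injEq] at h; omega
          · intro h; simp only [Prod.mk.injEq] at h; omega)
        (fun x hx' hle' => by
          by_contra hcon
          have := S1.row_le (show x2 ≤ x by omega) ha' hx'
          omega)
      exact ⟨w, h1, h2, h5, ⟨h3, h4⟩, h6⟩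
    have hother : ∀ p ∈ lam.cells, p ≠ c → p ≠ c' → S1.entry p ≤ m + 1 → S1.entry p ≤ m - 1 := by
      intro p hp h1 h2 h3
      have h4 : S1.entry p ≠ S1.entry c := fun h => h1 (S1.cell_eq hp hc h)
      have h5 : S1.entry p ≠ S1.entry c' := fun h => h2 (S1.cell_eq hp hc' h)
      omega
    rcases ReadLT.trichotomy hne with h | h
    · obtain ⟨w, h1, h2, h3, h4, h5⟩ := main c hc c' hc' (by omega) (by omega) (by omega)
        (by omega) hother max1 max1' h
      exact ⟨w, h1, h2, h3, Or.inl h4, h5⟩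
    · obtain ⟨w, h1, h2, h3, h4, h5⟩ := main c' hc' c hc (by omega) (by omega) (by omega)
        (by omega) (fun p hp h1 h2 => hother p hp h2 h1) max1' max1 h
      exact ⟨w, h1, h2, h3, Or.inr h4, h5⟩
  obtain ⟨w, hw, hwle, hwoff, hbtw, hwmax⟩ := hw
  have hw1 := S1.one_le_entry hw
  obtain ⟨S2, e2, g2⟩ := S1.exists_raise hw (by omega) hwle hwmax
  obtain ⟨w1, w2⟩ := w
  simp only at hwoff
  have hleft : (w1, w2 - 1) ∈ lam.cells := lam.mem_of_le hw le_rfl (by omega) (by omega)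
  have hleft1 := S2.one_le_entry hleft
  have hleft2 := S2.row_lt w1 (w2 - 1) w2 (by omega) hleft hw
  obtain ⟨v, hv, hvle, hvw, hvmax⟩ := S2.exists_before (k := m - 2) hw hwoff (by omega)
    (by simp only; omega)
  obtain ⟨S3, e3, g3⟩ := S2.exists_raise hv (by omega) hvle hvmax
  have hg : AgreeAbove m S S3 :=
    (g1.trans (g2.mono (by omega))).trans (g3.mono (by omega))
  have ec : S3.entry c = m + 1 := hg.entry_eq hS (by omega)
  have ec' : S3.entry c' = m := (g2.mono (by omega)).trans (g3.mono (show m - 2 ≤ m - 1 by omega))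
    |>.entry_eq e1 (by omega)
  have ew : S3.entry (w1, w2) = m - 1 := g3.entry_eq e2 (by omega)
  refine ⟨S3, hg, ec', by omega, by omega, m - 1, m - 2, ?_, by omega, ?_, ?_⟩
  · ext x; simp only [Finset.mem_insert, Finset.mem_singleton]; omega
  · rcases hbtw with ⟨h1, h2⟩ | ⟨h1, h2⟩
    · exact Or.inr ⟨⟨_, hc, _, hw, ec, ew, h1⟩, ⟨_, hw, _, hc', ew, ec', h2⟩⟩
    · exact Or.inl ⟨⟨_, hc', _, hw, ec', ew, h1⟩, ⟨_, hw, _, hc, ew, ec, h2⟩⟩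
  · exact ⟨_, hv, _, hw, e3, ew, hvw⟩

theorem dominated_lt_of_entry_eq (S : ShSYT lam) {p q : ℕ × ℕ} {m : ℕ} (hp : p ∈ lam.cells)
    (hq : q ∈ lam.cells) (hd : Dominates q p) (h : m ≤ S.entry p) : m < S.entry q :=
  h.trans_lt (S.entry_lt_of_dominates hp hq hd)

/-- The involutions that move letters up to `m` act transitively on the fillings that have the same
letters above `m`. -/
theorem conn_of_agreeAbove {m : ℕ} {S S' : ShSYT lam} (h : AgreeAbove m S S') : Conn m S S' := by
  induction m generalizing S S' with
  | zero =>
    have : S' = S := ext_on_cells fun p hp => h p (Or.inl (S.one_le_entry hp))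
    rw [this]
    exact Relation.ReflTransGen.refl
  | succ m ih =>
    by_cases hmn : m + 1 ≤ n
    swap
    · refine (ih fun p hp => ?_).mono (Nat.le_succ m)
      have := S.entry_le_size p
      have := S'.entry_le_size p
      omega
    have hc := S.pos_mem (x := m + 1) (by omega) hmn
    have hc' := S'.pos_mem (x := m + 1) (by omega) hmn
    have ec := S.entry_pos (x := m + 1) (by omega) hmn
    have ec' := S'.entry_pos (x := m + 1) (by omega) hmn
    generalize S.pos (m + 1) = c at *
    generalize S'.pos (m + 1) = c' at *
    have hred : ∀ {S S' : ShSYT lam} {c : ℕ × ℕ}, c ∈ lam.cells → AgreeAbove (m + 1) S S' →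
        S.entry c = m + 1 → S'.entry c = m + 1 → AgreeAbove m S S' := by
      intro S S' c hc h e e' p hp
      by_cases hpc : p = c
      · rw [hpc, e, e']
      · refine h p ?_
        by_cases hpm : p ∈ lam.cells
        · have h1 : S.entry p ≠ S.entry c := fun h => hpc (S.cell_eq hpm hc h)
          have h2 : S'.entry p ≠ S'.entry c := fun h => hpc (S'.cell_eq hpm hc h)
          omega
        · have := S.entry_eq_zero p hpm
          have := S'.entry_eq_zero p hpm
          omega
    by_cases hcc : c = c'
    · subst hcc
      exact (ih (hred hc h ec ec')).mono (Nat.le_succ m)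
    have hle : S.entry c' ≤ m := by
      have h1 := (h.le_iff le_rfl c').mp ec'.le
      have h2 : S.entry c' ≠ S.entry c := fun h => hcc (S.cell_eq hc' hc h).symm
      omega
    -- The path is `S`, `S1`, `S1.b (m - 1)`, `S'`. The middle step brings `m + 1` into the cell
    -- prescribed by `S'`; the two outer parts move letters up to `m` only and come from the
    -- induction hypothesis.
    obtain ⟨S1, g1, e1, hm3, hmove⟩ := S.exists_exchange hmn hc hc' hcc ec hle
      (fun q hq hd => S.dominated_lt_of_entry_eq hc hq hd ec.ge)
      (fun q hq hd => (h.lt_iff le_rfl q).mp (S'.dominated_lt_of_entry_eq hc' hq hd ec'.ge))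
    have e2 : (S1.b (m - 1)).entry c' = m + 1 := by
      rw [entry_b hmove, e1, Equiv.swap_apply_left]
    have g2 : AgreeAbove (m + 1) S1 (S1.b (m - 1)) := agreeAbove_b S1 (by omega)
    have g3 : AgreeAbove m (S1.b (m - 1)) S' :=
      hred hc' (((g1.mono (Nat.le_succ m)).trans g2).symm.trans h) e2 ec'
    refine ((ih g1).mono (Nat.le_succ m)).trans (Relation.ReflTransGen.head ?_
      ((ih g3).mono (Nat.le_succ m)))
    exact ⟨m - 1, by omega, by omega, rfl⟩

theorem Conn.agreeAbove {m : ℕ} {S S' : ShSYT lam} (h : Conn m S S') : AgreeAbove m S S' := by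
  induction h with
  | refl => exact AgreeAbove.refl _ _
  | tail _ h ih =>
    obtain ⟨i, h1, h2, rfl⟩ := h
    exact ih.trans (agreeAbove_b _ (by omega))

end ShSYT

/-! ### Rigidity and uniqueness of the shape. -/

namespace ShSYT

section Bisimulation

variable {n₁ n₂ : ℕ} {lam₁ : StrictPartition n₁} {lam₂ : StrictPartition n₂}

/-- A path on one side is followed move by move on the other, so a filling reached on one side has a
related partner. -/
theorem Conn.lift {R : ShSYT lam₁ → ShSYT lam₂ → Prop} {m : ℕ}
    (hstep : ∀ X Y, R X Y → ∀ i, 1 < i → i + 1 < m → R (X.b i) (Y.b i)) {X X' : ShSYT lam₁}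
    {Y : ShSYT lam₂} (h : Conn m X X') (hR : R X Y) : ∃ Y', R X' Y' ∧ Conn m Y Y' := by
  induction h with
  | refl => exact ⟨Y, hR, Relation.ReflTransGen.refl⟩
  | tail _ h ih =>
    obtain ⟨Y', h1, h2⟩ := ih
    obtain ⟨i, hi, hi', rfl⟩ := h
    exact ⟨Y'.b i, hstep _ _ h1 i hi hi', h2.tail ⟨i, hi, hi', rfl⟩⟩

/-- The inductive step of rigidity, for one of the two reading orders. If `m + 1` stood earlier in
`X` than in `Y`, one could put `m` into a cell between the two positions and `m - 1` before it: `m`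
would be a peak on the side of `X`, but not on the side of `Y`, where `m + 1` follows. -/
theorem not_readLT_of_bisim (R : ShSYT lam₁ → ShSYT lam₂ → Prop) {m : ℕ} (h₁ : m + 1 ≤ n₁)
    (h₂ : m + 1 ≤ n₂) (hstep : ∀ X Y, R X Y → ∀ i, 1 < i → i + 1 < m → R (X.b i) (Y.b i))
    (hpeak : ∀ X Y, R X Y → ∀ h < m + 1, h ∈ X.peak ↔ h ∈ Y.peak)
    (hpos : ∀ X Y, R X Y → ∀ x, 1 ≤ x → x ≤ m → X.pos x = Y.pos x)
    {X : ShSYT lam₁} {Y : ShSYT lam₂} (hR : R X Y) :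
    ¬ ReadLT (X.pos (m + 1)) (Y.pos (m + 1)) := by
  intro hread
  have hc1 := X.pos_mem (x := m + 1) (by omega) h₁
  have hc2 := Y.pos_mem (x := m + 1) (by omega) h₂
  have ec1 := X.entry_pos (x := m + 1) (by omega) h₁
  have ec2 := Y.entry_pos (x := m + 1) (by omega) h₂
  obtain ⟨⟨r1, x1⟩, hx1⟩ : ∃ c, X.pos (m + 1) = c := ⟨_, rfl⟩
  obtain ⟨⟨r2, x2⟩, hx2⟩ : ∃ c, Y.pos (m + 1) = c := ⟨_, rfl⟩
  rw [hx1] at hc1 ec1 hread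
  rw [hx2] at hc2 ec2 hread
  have hXY : ∀ p ∈ lam₁.cells, X.entry p ≤ m → Y.entry p = X.entry p := by
    intro p hp hpm
    have h1 := X.one_le_entry hp
    have := hpos X Y hR _ h1 hpm
    rw [X.pos_entry hp] at this
    conv_lhs => rw [this]
    exact Y.entry_pos h1 (by omega)
  have hYX : ∀ p ∈ lam₂.cells, Y.entry p ≤ m → X.entry p = Y.entry p := by
    intro p hp hpm
    have h1 := Y.one_le_entry hp
    have := hpos X Y hR _ h1 hpm
    rw [Y.pos_entry hp] at this
    conv_lhs => rw [← this]
    exact X.entry_pos h1 (by omega)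
  have hd1 := hc1.1
  have hd2 := hc2.1
  simp only [ReadLT] at hread hd1 hd2
  -- Both cells are addable to the common set of cells with letters up to `m`; hence the earlier one
  -- lies in a higher row and further left.
  have hr : r2 < r1 := by
    by_contra hcon
    obtain rfl : r1 = r2 := by omega
    have hm : (r1, x1) ∈ lam₂.cells := lam₂.mem_of_le hc2 le_rfl (by omega) hd1
    have h3 := Y.row_lt r1 x1 x2 (by omega) hm hc2
    have := hYX _ hm (by omega)
    omega
  have hx : x1 < x2 := by
    by_contra hcon
    have hm : (r2, x2) ∈ lam₁.cells := lam₁.mem_of_le hc1 hr.le (by omega) hd2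
    have h3 := X.entry_lt hc1 hr.le (show x2 ≤ x1 by omega) hd2 (by omega)
    have := hXY _ hm (by omega)
    omega
  obtain ⟨⟨w1, w2⟩, hw, hwm, hw1, hw2, hoff, hwmax⟩ := X.exists_between (k := m) hr hx hc1
    (by omega)
    (fun r hr' => by
      have hm : (r, x1) ∈ lam₁.cells := lam₁.below_mem_of_le hr'.le hc1
      have := X.col_lt r r1 x1 hr' hm hc1
      omega)
    (fun x hx' hle => by
      by_contra hcon
      have h3 := hXY _ hx' hle
      have hm : (r2, x) ∈ lam₂.cells := Y.mem_iff_entry_pos.mpr (h3 ▸ X.one_le_entry hx')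
      have := Y.row_le (show x2 ≤ x by omega) hc2 hm
      omega)
  obtain ⟨X1, e1, g1⟩ := X.exists_raise hw (by omega) hwm hwmax
  simp only at hoff
  have hleft : (w1, w2 - 1) ∈ lam₁.cells := lam₁.mem_of_le hw le_rfl (by omega) (by omega)
  have hleft1 := X1.one_le_entry hleft
  have hleft2 := X1.row_lt w1 (w2 - 1) w2 (by omega) hleft hw
  obtain ⟨v, hv, hvle, hvw, hvmax⟩ := X1.exists_before (k := m - 1) hw hoff (by omega)
    (by simp only; omega)
  obtain ⟨X2, e2, g2⟩ := X1.exists_raise hv (by omega) hvle hvmax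
  have hg : AgreeAbove m X X2 := g1.trans (g2.mono (by omega))
  obtain ⟨Y2, hR2, hY⟩ := (conn_of_agreeAbove hg).lift hstep hR
  have p1 : X2.pos (m + 1) = (r1, x1) := X2.pos_eq (by omega) (hg.entry_eq ec1 (by omega))
  have p2 : X2.pos m = (w1, w2) := X2.pos_eq (by omega) (g2.entry_eq e1 (by omega))
  have p3 : X2.pos (m - 1) = v := X2.pos_eq (by omega) e2
  have q1 : Y2.pos (m + 1) = (r2, x2) :=
    Y2.pos_eq (by omega) (hY.agreeAbove.entry_eq ec2 (by omega))
  have q2 : Y2.pos m = (w1, w2) := by rw [← hpos _ _ hR2 m (by omega) le_rfl, p2]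
  have hpk : m ∈ X2.peak := by
    rw [mem_peak_iff, ← X2.readLT_iff_key (by omega) (by omega) (by omega) (by omega),
      ← X2.readLT_iff_key (by omega) (by omega) (by omega) (by omega), p1, p2, p3]
    exact ⟨by omega, by omega, hvw, hw1⟩
  rw [hpeak _ _ hR2 m (by omega), mem_peak_iff,
    ← Y2.readLT_iff_key (by omega) (by omega) (by omega) (by omega),
    ← Y2.readLT_iff_key (by omega) (by omega) (by omega) (by omega), q1, q2] at hpk
  exact hw2.asymm hpk.2.2.2

/-- Rigidity: the cells of the letters up to `m` are determined by the peaks of all tableaux that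
are reached by the involutions. -/
theorem pos_eq_of_bisim (R : ShSYT lam₁ → ShSYT lam₂ → Prop) {m : ℕ} (h₁ : m ≤ n₁)
    (h₂ : m ≤ n₂) (hstep : ∀ X Y, R X Y → ∀ i, 1 < i → i + 1 < m → R (X.b i) (Y.b i))
    (hpeak : ∀ X Y, R X Y → ∀ h < m, h ∈ X.peak ↔ h ∈ Y.peak) :
    ∀ X Y, R X Y → ∀ x, 1 ≤ x → x ≤ m → X.pos x = Y.pos x := by
  induction m with
  | zero => intro X Y _ x h h'; omega
  | succ m ih =>
    have hstep' : ∀ X Y, R X Y → ∀ i, 1 < i → i + 1 < m → R (X.b i) (Y.b i) :=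
      fun X Y h i hi hi' => hstep X Y h i hi (by omega)
    have ih' := ih (by omega) (by omega) hstep'
      (fun X Y h k hk => hpeak X Y h k (by omega))
    intro X Y hR x hx hxm
    rcases hxm.eq_or_lt with rfl | hlt
    · by_contra hne
      rcases ReadLT.trichotomy hne with h | h
      · exact not_readLT_of_bisim R h₁ h₂ hstep' hpeak ih' hR h
      · exact not_readLT_of_bisim (fun Y X => R X Y) h₂ h₁ (fun Y X => hstep' X Y)
          (fun Y X h k hk => (hpeak X Y h k hk).symm)
          (fun Y X h k hk hk' => (ih' X Y h k hk hk').symm) hR h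
    · exact ih' X Y hR x hx (by omega)

end Bisimulation

end ShSYT

namespace StrictPartition

theorem lt_length_iff {n : ℕ} (lam : StrictPartition n) (r : ℕ) :
    r < lam.parts.length ↔ 0 < lam.row r := by
  unfold row
  constructor
  · intro h
    rw [List.getD_eq_getElem _ _ h]
    exact lam.pos _ (List.getElem_mem h)
  · intro h
    by_contra hc
    rw [List.getD_eq_default _ _ (by omega)] at h
    omega

theorem eq_of_cells_subset {n : ℕ} {lam mu : StrictPartition n} (h : lam.cells = mu.cells) :
    lam = mu := by
  have hrow : ∀ r, lam.row r = mu.row r := by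
    intro r
    have h1 := Set.ext_iff.mp h (r, r + lam.row r)
    have h2 := Set.ext_iff.mp h (r, r + mu.row r)
    rw [mem_cells, mem_cells] at h1 h2
    omega
  have hlen : lam.parts.length = mu.parts.length := by
    have h1 := lam.lt_length_iff
    have h2 := mu.lt_length_iff
    simp only [hrow] at h1
    have h3 := fun r => (h1 r).trans (h2 r).symm
    have := h3 lam.parts.length
    have := h3 mu.parts.length
    omega
  ext1
  refine List.ext_getElem hlen fun r h1 h2 => ?_
  have := hrow r
  unfold row at this
  rwa [List.getD_eq_getElem _ _ h1, List.getD_eq_getElem _ _ h2] at this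

end StrictPartition

/-- Objects with a morphism to the tableaux of two shapes: the shapes agree. -/
theorem shape_unique {A : Type*} [Nonempty A] {N : ℕ} {Peak : A → Set ℕ} {φ : ℕ → A → A}
    {lam mu : StrictPartition N} {f : A → ShSYT lam} {g : A → ShSYT mu}
    (hf : IsMorphismOn Set.univ (indices N) Peak φ ShSYT.peak ShSYT.b f)
    (hg : IsMorphismOn Set.univ (indices N) Peak φ ShSYT.peak ShSYT.b g) : lam = mu := by
  -- Pairing the two images of one object gives a relation that is stable under the involutions and
  -- respects peaks.
  have key := ShSYT.pos_eq_of_bisim (fun X Y => ∃ T, X = f T ∧ Y = g T) (m := N) le_rfl le_rfl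
    (by
      rintro _ _ ⟨T, rfl, rfl⟩ i hi hi'
      exact ⟨φ i T, ((hf T trivial).2 i ⟨hi, hi'⟩).symm, ((hg T trivial).2 i ⟨hi, hi'⟩).symm⟩)
    (by
      rintro _ _ ⟨T, rfl, rfl⟩ h -
      rw [← (hf T trivial).1, ← (hg T trivial).1])
  obtain ⟨T⟩ := ‹Nonempty A›
  have hpos := key _ _ ⟨T, rfl, rfl⟩
  apply StrictPartition.eq_of_cells_subset
  apply Set.Subset.antisymm
  · intro p hp
    have h1 := (f T).one_le_entry hp
    have h2 := (f T).entry_le_size p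
    rw [← (f T).pos_entry hp, hpos _ h1 h2]
    exact (g T).pos_mem h1 h2
  · intro p hp
    have h1 := (g T).one_le_entry hp
    have h2 := (g T).entry_le_size p
    rw [← (g T).pos_entry hp, ← hpos _ h1 h2]
    exact (f T).pos_mem h1 h2

/-! ### Extension of a tableau by a new largest letter. -/

namespace ShSYT

variable {n : ℕ} {lam : StrictPartition n} {mu : StrictPartition (n + 1)} {c : ℕ × ℕ}

/-- The tableau obtained from `S` by writing the new largest letter into an additional cell. -/
def extend (S : ShSYT lam) (hc : c ∉ lam.cells) (hmu : mu.cells = insert c lam.cells) :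
    ShSYT mu where
  entry p := if p = c then n + 1 else S.entry p
  entry_eq_zero p hp := by
    rw [hmu, Set.mem_insert_iff, not_or] at hp
    rw [if_neg hp.1, S.entry_eq_zero p hp.2]
  bijOn := by
    have hne : ∀ p ∈ lam.cells, p ≠ c := fun p hp h => hc (h ▸ hp)
    refine ⟨?_, ?_, ?_⟩
    · intro p _
      have := S.entry_le_size p
      simp only
      split_ifs with h
      · exact ⟨by omega, le_rfl⟩
      · have hp : p ∈ mu.cells := ‹_›
        rw [hmu, Set.mem_insert_iff] at hp
        exact ⟨S.one_le_entry (hp.resolve_left h), by omega⟩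
    · intro p hp q hq h
      rw [hmu, Set.mem_insert_iff] at hp hq
      have := S.entry_le_size p
      have := S.entry_le_size q
      simp only at h
      split_ifs at h with h1 h2 h2
      · rw [h1, h2]
      · omega
      · omega
      · exact S.cell_eq (hp.resolve_left h1) (hq.resolve_left h2) h
    · rintro x ⟨h1, h2⟩
      rw [hmu]
      rcases h2.eq_or_lt with rfl | h2
      · exact ⟨c, Set.mem_insert _ _, if_pos rfl⟩
      · have h3 := S.pos_mem h1 (by omega)
        refine ⟨S.pos x, Set.mem_insert_of_mem _ h3, ?_⟩
        simp only
        rw [if_neg (hne _ h3), S.entry_pos h1 (by omega)]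
  row_lt r x y hxy hx hy := by
    have hxr := hx.1
    rw [hmu, Set.mem_insert_iff] at hx hy
    have := S.entry_le_size (r, x)
    split_ifs with h1 h2 h2
    · rw [← h2, Prod.mk.injEq] at h1
      omega
    · subst h1
      exact absurd (lam.left_mem hxr hxy.le (hy.resolve_left h2)) hc
    · omega
    · exact S.row_lt r x y hxy (hx.resolve_left h1) (hy.resolve_left h2)
  col_lt r r' x hr hx hy := by
    rw [hmu, Set.mem_insert_iff] at hx hy
    have := S.entry_le_size (r, x)
    split_ifs with h1 h2 h2
    · rw [← h2, Prod.mk.injEq] at h1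
      omega
    · subst h1
      exact absurd (lam.below_mem_of_le hr.le (hy.resolve_left h2)) hc
    · omega
    · exact S.col_lt r r' x hr (hx.resolve_left h1) (hy.resolve_left h2)

variable (S : ShSYT lam) (hc : c ∉ lam.cells) (hmu : mu.cells = insert c lam.cells)

theorem entry_extend (p : ℕ × ℕ) :
    (S.extend hc hmu).entry p = if p = c then n + 1 else S.entry p := rfl

theorem entry_extend_of_ne {p : ℕ × ℕ} (h : p ≠ c) : (S.extend hc hmu).entry p = S.entry p :=
  if_neg h

theorem pos_extend_self : (S.extend hc hmu).pos (n + 1) = c :=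
  (S.extend hc hmu).pos_eq (by omega) (if_pos rfl)

theorem pos_extend {x : ℕ} (h1 : 1 ≤ x) (h2 : x ≤ n) : (S.extend hc hmu).pos x = S.pos x := by
  apply (S.extend hc hmu).pos_eq h1
  rw [entry_extend_of_ne, S.entry_pos h1 h2]
  rintro h
  exact hc (h ▸ S.pos_mem h1 h2)

theorem before_extend {x y : ℕ} (hx : x ≤ n) (hy : y ≤ n) :
    (S.extend hc hmu).Before x y ↔ S.Before x y := by
  by_cases h : 1 ≤ x ∧ 1 ≤ y
  · rw [before_iff_readLT _ h.1 (by omega) h.2 (by omega), before_iff_readLT _ h.1 hx h.2 hy,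
      pos_extend S hc hmu h.1 hx, pos_extend S hc hmu h.2 hy]
  · constructor <;> intro hb <;> have := hb.range <;> omega

theorem isMove_extend {i a : ℕ} (hi : i + 2 ≤ n) :
    (S.extend hc hmu).IsMove i a ↔ S.IsMove i a := by
  unfold IsMove Between
  refine and_congr_right fun _ => exists_congr fun x => exists_congr fun d => ?_
  refine and_congr_right fun hs => ?_
  have hle : ∀ y ∈ ({a, a + 1, x, d} : Finset ℕ), y ≤ n := by
    intro y hy
    rw [hs] at hy
    simp only [Finset.mem_insert, Finset.mem_singleton] at hy
    omega
  have l1 := hle a (by simp)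
  have l2 := hle (a + 1) (by simp)
  have l3 := hle x (by simp)
  have l4 := hle d (by simp)
  rw [before_extend S hc hmu l1 l3, before_extend S hc hmu l3 l2, before_extend S hc hmu l2 l3,
    before_extend S hc hmu l3 l1, before_extend S hc hmu l4 l3]

theorem b_extend {i : ℕ} (hi : i + 2 ≤ n) :
    (S.extend hc hmu).b i = (S.b i).extend hc hmu := by
  by_cases hm : ∃ a, S.IsMove i a
  · obtain ⟨a, hm⟩ := hm
    have hm' := (isMove_extend S hc hmu hi).mpr hm
    have := hm.mem
    ext p
    rw [entry_b hm', entry_extend, entry_extend]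
    split_ifs
    · exact Equiv.swap_apply_of_ne_of_ne (by omega) (by omega)
    · rw [entry_b hm]
  · push Not at hm
    rw [b_eq_self hm, b_eq_self fun a => mt (isMove_extend S hc hmu hi).mp (hm a)]

theorem mem_peak_extend {h : ℕ} (hh : h < n) : h ∈ (S.extend hc hmu).peak ↔ h ∈ S.peak := by
  unfold peak des
  simp only [Set.mem_ofPred_eq]
  rw [before_extend S hc hmu (by omega) (by omega), before_extend S hc hmu (by omega) (by omega)]

theorem self_mem_peak_extend : n ∈ (S.extend hc hmu).peak ↔
    1 < n ∧ ReadLT (S.pos (n - 1)) (S.pos n) ∧ ReadLT c (S.pos n) := by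
  rw [mem_peak_iff]
  by_cases h : 1 < n
  · rw [← readLT_iff_key _ (by omega) (by omega) (by omega) (by omega),
      ← readLT_iff_key _ (by omega) (by omega) (by omega) (by omega), pos_extend_self,
      pos_extend S hc hmu (by omega) (by omega), pos_extend S hc hmu (by omega) (by omega)]
    simp only [h, Nat.lt_succ_self, true_and]
  · simp only [h, false_and]

end ShSYT

/-! ### Objects over a tableau: the last involution, fibres and peak counts. -/

/-- The hypotheses on objects of size `n + 1` together with a morphism `f` that controls the
involutions below `n - 1`. -/
structure IsAugmented {A : Type*} {n : ℕ} {lam : StrictPartition n} (Peak : A → Set ℕ)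
    (φ : ℕ → A → A) (f : A → ShSYT lam) : Prop where
  three_le : 3 ≤ n
  isPeakMap : IsPeakMap (n + 1) Peak
  involutive : ∀ i ∈ indices (n + 1), Function.Involutive (φ i)
  conditionI : ConditionI (n + 1) Peak φ
  conditionII : ConditionII (n + 1) Peak φ
  conditionIII : ConditionIII (n + 1) φ
  conditionV : ConditionV (n + 1) Peak φ
  isMorphismOn : IsMorphismOn Set.univ (indices n) (truncPeak n Peak) φ ShSYT.peak ShSYT.b f

/-- The number of objects over `S`. -/
noncomputable def fiberCard {A : Type*} {n : ℕ} {lam : StrictPartition n} (f : A → ShSYT lam)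
    (S : ShSYT lam) : ℕ := {T | f T = S}.ncard

/-- The number of objects over `S` with a peak at `n`. -/
noncomputable def peakCard {A : Type*} {n : ℕ} {lam : StrictPartition n} (Peak : A → Set ℕ)
    (f : A → ShSYT lam) (S : ShSYT lam) : ℕ := {T | f T = S ∧ n ∈ Peak T}.ncard

theorem Function.Involutive.ncard_eq {A : Type*} [Finite A] {g : A → A}
    (hg : Function.Involutive g) {s t : Set A} (h1 : ∀ T ∈ s, g T ∈ t) (h2 : ∀ T ∈ t, g T ∈ s) :
    s.ncard = t.ncard :=
  Set.ncard_congr (fun T _ => g T) h1 (fun _ _ _ _ h => hg.injective h)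
    (fun T hT => ⟨g T, h2 T hT, hg T⟩)

namespace IsAugmented

variable {A : Type*} {n : ℕ} {lam : StrictPartition n} {Peak : A → Set ℕ} {φ : ℕ → A → A}
  {f : A → ShSYT lam}

open ShSYT

section

variable (E : IsAugmented Peak φ f)
include E

theorem mem_peak_iff {T : A} {h : ℕ} (hn : h < n) : h ∈ Peak T ↔ h ∈ (f T).peak := by
  rw [← (E.isMorphismOn T trivial).1]
  exact ⟨fun hp => ⟨hp, ((E.isPeakMap T).1 h hp).1, hn⟩, fun hp => hp.1⟩

theorem map_eq {T : A} {i : ℕ} (h1 : 1 < i) (h2 : i + 1 < n) : f (φ i T) = (f T).b i :=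
  (E.isMorphismOn T trivial).2 i ⟨h1, h2⟩

theorem mem_peak_map_iff {T : A} {i h : ℕ} (h1 : 1 < i) (h2 : i < n)
    (hh : h + 3 ≤ i ∨ i + 4 ≤ h) : h ∈ Peak T ↔ h ∈ Peak (φ i T) := by
  by_cases hT : φ i T = T
  · rw [hT]
  · exact (E.conditionII i ⟨h1, by omega⟩ T hT).2 h hh

theorem last_index : n - 1 ∈ indices (n + 1) := by
  have := E.three_le
  constructor <;> omega

/-- For an object that is moved this is condition (ii); for a fixed one both sides fail by condition
(i). -/
theorem mem_peak_last_iff {T : A} : n - 1 ∈ Peak T ↔ n ∈ Peak (φ (n - 1) T) := by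
  have h3 := E.three_le
  by_cases hT : φ (n - 1) T = T
  · have := (E.conditionI _ E.last_index T).mp hT
    rw [Nat.sub_add_cancel (by omega)] at this
    rw [hT]
    tauto
  · have := (E.conditionII _ E.last_index T hT).1
    rwa [Nat.sub_add_cancel (by omega)] at this

theorem last_last (T : A) : φ (n - 1) (φ (n - 1) T) = T := E.involutive _ E.last_index T

theorem mem_peak_last_iff' {T : A} : n - 1 ∈ Peak (φ (n - 1) T) ↔ n ∈ Peak T := by
  rw [E.mem_peak_last_iff, E.last_last]

/-- The last involution does not affect the letters up to `n - 3`. -/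
theorem pos_last (T : A) {x : ℕ} (hx : 1 ≤ x) (hxn : x + 3 ≤ n) :
    (f T).pos x = (f (φ (n - 1) T)).pos x := by
  have h3 := E.three_le
  -- Rigidity for the pairs `f T`, `f (φ (n - 1) T)`. The indices used are at most `n - 5`, so
  -- condition (iii) gives commutation; the peaks used are at most `n - 4`, so condition (ii)
  -- preserves them.
  refine pos_eq_of_bisim (fun X Y => ∃ T, X = f T ∧ Y = f (φ (n - 1) T)) (m := n - 3)
    (by omega) (by omega) ?_ ?_ _ _ ⟨T, rfl, rfl⟩ x hx (by omega)
  · rintro _ _ ⟨T, rfl, rfl⟩ i hi hi'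
    refine ⟨φ i T, (E.map_eq hi (by omega)).symm, ?_⟩
    rw [← E.map_eq hi (by omega)]
    congr 1
    exact E.conditionIII _ E.last_index i ⟨hi, by omega⟩ (Or.inr (by omega)) T
  · rintro _ _ ⟨T, rfl, rfl⟩ h hh
    rw [← E.mem_peak_iff (by omega), ← E.mem_peak_iff (by omega)]
    exact E.mem_peak_map_iff (by omega) (by omega) (Or.inl (by omega))

/-- Condition (v) for `φ (n - 3)`, `φ (n - 2)`, `φ (n - 1)`, which become `b 2`, `b 3`, `b 4` on
tableaux of size 6; the peaks `n - 3, ..., n` become `2, ..., 5`. It controls peaks that are too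
close to the index for condition (ii). -/
theorem exists_window (h5 : 5 ≤ n) (T : A) :
    ∃ (nu : StrictPartition 6) (X : ShSYT nu) (g : A → ShSYT nu), g T = X ∧
      (∀ k, 2 ≤ k → k ≤ 4 → g (φ (n + k - 5) T) = X.b k) ∧
      (∀ U, (U = T ∨ ∃ k, 2 ≤ k ∧ k ≤ 4 ∧ U = φ (n + k - 5) T) → ∀ h, 2 ≤ h → h ≤ 5 →
        (h ∈ (g U).peak ↔ n + h - 5 ∈ Peak U)) := by
  obtain ⟨m, rfl⟩ : ∃ m, n = m + 5 := ⟨n - 5, by omega⟩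
  obtain ⟨nu, g, -, hg⟩ := E.conditionV (m + 2) ⟨by omega, by omega⟩ (m + 4)
    ⟨by omega, by omega⟩ (by omega) (by omega) T
  -- The size equals 6 only propositionally, so it is generalized before it is substituted in the
  -- types.
  have h6 : m + 4 - (m + 2) + 4 = 6 := by omega
  revert nu g
  generalize m + 4 - (m + 2) + 4 = N at *
  subst h6
  intro nu g hg
  have hmem : ∀ U, (U = T ∨ ∃ k, 2 ≤ k ∧ k ≤ 4 ∧ U = φ (m + 5 + k - 5) T) →
      U ∈ restrictedClass φ (m + 2) (m + 4) T := by
    rintro U (rfl | ⟨k, h1, h2, rfl⟩)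
    · exact Relation.ReflTransGen.refl
    · exact Relation.ReflTransGen.single ⟨_, by omega, by omega, rfl⟩
  refine ⟨nu, g T, g, rfl, fun k h1 h2 => ?_, fun U hU h h1 h2 => ?_⟩
  · have := (hg T (hmem T (Or.inl rfl))).2 k ⟨by omega, by omega⟩
    rw [← this]
    congr 2
    omega
  · rw [← (hg U (hmem U hU)).1]
    constructor
    · rintro ⟨x, hx, -, -, h3⟩
      rwa [show m + 5 + h - 5 = x by omega]
    · intro hx
      exact ⟨_, hx, by omega, by omega, by omega⟩

/-- `add_two_mem_peak_b` seen through the window: `n` is at distance three from `n - 3`, just inside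
the range that condition (ii) leaves open. -/
theorem mem_peak_of_not_mem {T : A} (h5 : 5 ≤ n) (h : n ∈ Peak T) (h' : n ∉ Peak (φ (n - 3) T)) :
    n - 1 ∈ Peak (φ (n - 3) T) := by
  obtain ⟨nu, X, g, rfl, hb, hp⟩ := E.exists_window h5 T
  have hU := hp (φ (n - 3) T) (Or.inr ⟨2, le_rfl, by omega, by
    rw [show n + 2 - 5 = n - 3 by omega]⟩)
  have hb2 := hb 2 le_rfl (by omega)
  rw [show n + 2 - 5 = n - 3 by omega] at hb2
  rw [hb2] at hU
  have h1 := (hp T (Or.inl rfl) 5 (by omega) le_rfl).mpr (by rwa [Nat.add_sub_cancel])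
  have h2 := mt (hU 5 (by omega) le_rfl).mp (by rwa [Nat.add_sub_cancel])
  have h3 := (hU 4 (by omega) (by omega)).mp (add_two_mem_peak_b h1 h2)
  rwa [show n + 4 - 5 = n - 1 by omega] at h3

/-- `mem_peak_b_of_add_three_mem` seen through the window, with `b 4` in the role of `φ (n - 1)`. -/
theorem mem_peak_last_of_mem {T : A} (h5 : 5 ≤ n) (h : n ∈ Peak T) (h' : n - 3 ∈ Peak T) :
    n - 3 ∈ Peak (φ (n - 1) T) := by
  obtain ⟨nu, X, g, rfl, hb, hp⟩ := E.exists_window h5 T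
  have hU := hp (φ (n - 1) T) (Or.inr ⟨4, by omega, le_rfl, by
    rw [show n + 4 - 5 = n - 1 by omega]⟩)
  have hb4 := hb 4 (by omega) le_rfl
  rw [show n + 4 - 5 = n - 1 by omega] at hb4
  rw [hb4] at hU
  have h1 := (hp T (Or.inl rfl) 5 (by omega) le_rfl).mpr (by rwa [Nat.add_sub_cancel])
  have h2 := (hp T (Or.inl rfl) 2 le_rfl (by omega)).mpr
    (by rwa [show n + 2 - 5 = n - 3 by omega])
  have h3 := (hU 2 le_rfl (by omega)).mp (mem_peak_b_of_add_three_mem (i := 2) h2 h1)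
  rwa [show n + 2 - 5 = n - 3 by omega] at h3

/-- The moves have index at most `n - 4`, so by condition (ii) they do not affect a peak at `n`; the
letters up to `n - 2` can thus be rearranged without losing it. -/
theorem exists_lift {T : A} {S' : ShSYT lam} (h : Conn (n - 2) (f T) S') :
    ∃ T', f T' = S' ∧ (n ∈ Peak T' ↔ n ∈ Peak T) := by
  have h3 := E.three_le
  induction h with
  | refl => exact ⟨T, rfl, Iff.rfl⟩
  | tail _ h ih =>
    obtain ⟨T', rfl, h2⟩ := ih
    obtain ⟨i, hi, hi', rfl⟩ := h
    exact ⟨φ i T', E.map_eq hi (by omega),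
      (E.mem_peak_map_iff hi (by omega) (Or.inr (by omega))).symm.trans h2⟩

/-- If `n` is a peak of `T`, then `n - 1` precedes `n` in the tableau `f T`. -/
theorem readLT_of_mem_peak {T : A} (hT : n ∈ Peak T) :
    ReadLT ((f T).pos (n - 1)) ((f T).pos n) := by
  have h3 := E.three_le
  by_contra hcon
  have hp := (f T).pos_mem (x := n) (by omega) le_rfl
  have hq := (f T).pos_mem (x := n - 1) (by omega) (by omega)
  have ep := (f T).entry_pos (x := n) (by omega) le_rfl
  have eq := (f T).entry_pos (x := n - 1) (by omega) (by omega)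
  obtain ⟨p, hpp⟩ : ∃ p, (f T).pos n = p := ⟨_, rfl⟩
  obtain ⟨q, hqq⟩ : ∃ q, (f T).pos (n - 1) = q := ⟨_, rfl⟩
  rw [hpp] at hp ep hcon
  rw [hqq] at hq eq hcon
  have hread : ReadLT p q := by
    refine (ReadLT.trichotomy ?_).resolve_right hcon
    rintro rfl
    omega
  obtain ⟨r', c'⟩ := p
  obtain ⟨r, c⟩ := q
  have hd1 := hp.1
  have hd2 := hq.1
  simp only at hd1 hd2
  -- If `n - 1` were on the diagonal, `n` would stand in a higher row, and `(r, r + 1)` would need a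
  -- letter strictly between `n - 1` and `n`.
  have hoff : r < c := by
    by_contra hc
    obtain rfl : r = c := by omega
    simp only [ReadLT] at hread
    have m1 : (r, r + 1) ∈ lam.cells := lam.mem_of_le hp (by omega) (by omega) (by omega)
    have l1 := (f T).row_lt r r (r + 1) (by omega) hq m1
    have l2 := (f T).entry_lt (r := r) (c := r + 1) hp (by omega) (by omega) (by omega) (by omega)
    omega
  have hleft : (r, c - 1) ∈ lam.cells := lam.mem_of_le hq le_rfl (by omega) (by omega)
  have hleft2 := (f T).row_lt r (c - 1) c (by omega) hleft hq
  -- Putting `n - 2` before `n - 1` makes `n - 1` a peak, next to the peak at `n`.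
  obtain ⟨v, hv, hvle, hvq, hvmax⟩ := (f T).exists_before (k := n - 2) hq hoff (by omega)
    (by simp only; omega)
  obtain ⟨S', e', g'⟩ := (f T).exists_raise hv (by omega) hvle hvmax
  have hv1 := (f T).one_le_entry hv
  obtain ⟨T', rfl, hT'⟩ := E.exists_lift (conn_of_agreeAbove g')
  have hpk : n - 1 ∈ (f T').peak := by
    rw [ShSYT.mem_peak_iff, ← readLT_iff_key _ (by omega) (by omega) (by omega) (by omega),
      ← readLT_iff_key _ (by omega) (by omega) (by omega) (by omega),
      (f T').pos_eq (x := n - 1 - 1) (by omega) e',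
      (f T').pos_eq (x := n - 1) (by omega) (g'.entry_eq eq (by omega)),
      (f T').pos_eq (x := n - 1 + 1) (by omega) ((g'.entry_eq ep (by omega)).trans
        (by omega))]
    exact ⟨by omega, by omega, hvq, hread⟩
  have := (E.isPeakMap T').2 (n - 1) ((E.mem_peak_iff (by omega)).mpr hpk)
  rw [Nat.sub_add_cancel (by omega)] at this
  exact this (hT'.mpr hT)

variable [Finite A]

/-- All tableaux of one shape are connected, and `φ i` maps the fibre over a tableau bijectively
onto the fibre over its image under `b i`. -/
theorem fiberCard_eq (S S' : ShSYT lam) : fiberCard f S = fiberCard f S' := by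
  have h : Conn n S S' := conn_of_agreeAbove fun p hp => by
    have := S.entry_le_size p
    have := S'.entry_le_size p
    omega
  induction h with
  | refl => rfl
  | @tail S' _ _ h ih =>
    obtain ⟨i, hi, hi', rfl⟩ := h
    rw [ih]
    refine (E.involutive i ⟨hi, by omega⟩).ncard_eq ?_ ?_
    · rintro T rfl
      exact E.map_eq hi hi'
    · rintro T (hT : f T = _)
      change f (φ i T) = _
      rw [E.map_eq hi hi', hT, b_b]

theorem fiberCard_pos [Nonempty A] (S : ShSYT lam) : 0 < fiberCard f S := by
  obtain ⟨T⟩ := ‹Nonempty A›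
  rw [E.fiberCard_eq S (f T)]
  exact (Set.ncard_pos (Set.toFinite _)).mpr ⟨T, rfl⟩

theorem peakCard_eq_of_conn {S S' : ShSYT lam} (h : Conn (n - 2) S S') :
    peakCard Peak f S = peakCard Peak f S' := by
  induction h with
  | refl => rfl
  | @tail S' _ _ h ih =>
    obtain ⟨i, hi, hi', rfl⟩ := h
    rw [ih]
    refine (E.involutive i ⟨hi, by omega⟩).ncard_eq ?_ ?_
    · rintro T ⟨rfl, hT⟩
      exact ⟨E.map_eq hi (by omega),
        (E.mem_peak_map_iff hi (by omega) (Or.inr (by omega))).mp hT⟩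
    · rintro T ⟨hT, hT'⟩
      refine ⟨?_, (E.mem_peak_map_iff hi (by omega) (Or.inr (by omega))).mp hT'⟩
      rw [E.map_eq hi (by omega), hT, b_b]

theorem peakCard_eq_of_cell_eq {S S' : ShSYT lam} {p q : ℕ × ℕ} (hp : S.entry p = n)
    (hp' : S'.entry p = n) (hq : S.entry q = n - 1) (hq' : S'.entry q = n - 1) :
    peakCard Peak f S = peakCard Peak f S' := by
  have h3 := E.three_le
  refine E.peakCard_eq_of_conn (conn_of_agreeAbove fun x hx => ?_)
  have u1 := S.entry_le_size x
  have u2 := S'.entry_le_size x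
  have e1 : S.entry x = n → x = p := fun h =>
    (S.pos_eq (by omega) h).symm.trans (S.pos_eq (by omega) hp)
  have e2 : S'.entry x = n → x = p := fun h =>
    (S'.pos_eq (by omega) h).symm.trans (S'.pos_eq (by omega) hp')
  have e3 : S.entry x = n - 1 → x = q := fun h =>
    (S.pos_eq (by omega) h).symm.trans (S.pos_eq (by omega) hq)
  have e4 : S'.entry x = n - 1 → x = q := fun h =>
    (S'.pos_eq (by omega) h).symm.trans (S'.pos_eq (by omega) hq')
  have hc : x = p ∨ x = q := by
    rcases hx with hx | hx
    · rcases (show S.entry x = n ∨ S.entry x = n - 1 by omega) with h | h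
      · exact Or.inl (e1 h)
      · exact Or.inr (e3 h)
    · rcases (show S'.entry x = n ∨ S'.entry x = n - 1 by omega) with h | h
      · exact Or.inl (e2 h)
      · exact Or.inr (e4 h)
  rcases hc with rfl | rfl <;> omega

/-- The number of objects over `S` with a peak at `n` depends on the cell of `n` only, provided
that `n - 1` precedes `n`. -/
theorem peakCard_eq {S S' : ShSYT lam} {p q q' : ℕ × ℕ} (hp : S.entry p = n)
    (hp' : S'.entry p = n) (hq : S.entry q = n - 1) (hq' : S'.entry q' = n - 1)
    (h : ReadLT q p) (h' : ReadLT q' p) : peakCard Peak f S = peakCard Peak f S' := by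
  have h3 := E.three_le
  by_cases hqq : q = q'
  · subst hqq
    exact E.peakCard_eq_of_cell_eq hp hp' hq hq'
  have hqm : q ∈ lam.cells := S.mem_iff_entry_pos.mpr (by omega)
  have hqm' : q' ∈ lam.cells := S'.mem_iff_entry_pos.mpr (by omega)
  have hpm : p ∈ lam.cells := S.mem_iff_entry_pos.mpr (by omega)
  -- Choose a tableau in which `b (n - 3)` moves `n - 1` from `q` to `q'` while `n` stays in `p`.
  obtain ⟨S1, g1, e1, h5, hm⟩ := S.exists_exchange (m := n - 2) (c := q) (c' := q') (by omega)
    hqm hqm' hqq (by omega)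
    (by
      have n1 : S.entry q' ≠ S.entry q := fun h => hqq (S.cell_eq hqm' hqm h).symm
      have n2 : S.entry q' ≠ S.entry p := fun h => h'.ne (S.cell_eq hqm' hpm h)
      have := S.entry_le_size q'
      omega)
    (fun x hx hd => by
      have := S.entry_lt_of_dominates hqm hx hd
      omega)
    (fun x hx hd => by
      have h1 := S'.entry_lt_of_dominates hqm' hx hd
      have h2 := S'.entry_le_size x
      obtain rfl : x = p := S'.cell_eq hx hpm (by omega)
      omega)
  rw [show n - 2 - 1 = n - 3 by omega] at hm
  have ep : S1.entry p = n := g1.entry_eq hp (by omega)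
  have eq : S1.entry q = n - 1 := g1.entry_eq hq (by omega)
  have ep2 : (S1.b (n - 3)).entry p = n := by
    rw [entry_b hm, ep, Equiv.swap_apply_of_ne_of_ne] <;> omega
  have eq2 : (S1.b (n - 3)).entry q' = n - 1 := by
    rw [entry_b hm, e1, Equiv.swap_apply_left]
    omega
  rw [E.peakCard_eq_of_conn (conn_of_agreeAbove g1), ← E.peakCard_eq_of_cell_eq ep2 hp' eq2 hq']
  have key : ∀ (S0 : ShSYT lam) (y : ℕ × ℕ), S0.entry p = n → S0.entry y = n - 1 → ReadLT y p →
      n - 1 ∉ S0.peak := by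
    intro S0 y h1 h2 h3 h4
    rw [ShSYT.mem_peak_iff, ← readLT_iff_key _ (by omega) (by omega) (by omega) (by omega),
      ← readLT_iff_key _ (by omega) (by omega) (by omega) (by omega),
      S0.pos_eq (x := n - 1) (by omega) h2,
      S0.pos_eq (x := n - 1 + 1) (by omega) (h1.trans (by omega))] at h4
    exact h3.asymm h4.2.2.2
  -- A peak at `n` lost under `φ (n - 3)` would leave a peak at `n - 1`, which `key` excludes since
  -- `n - 1` precedes `n` on both sides.
  refine (E.involutive (n - 3) ⟨by omega, by omega⟩).ncard_eq ?_ ?_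
  · rintro T ⟨rfl, hT⟩
    have hfT := E.map_eq (T := T) (i := n - 3) (by omega) (by omega)
    refine ⟨hfT, ?_⟩
    by_contra hcon
    have := E.mem_peak_of_not_mem (by omega) hT hcon
    rw [E.mem_peak_iff (by omega), hfT] at this
    exact key _ _ ep2 eq2 h' this
  · rintro T ⟨hfT, hT⟩
    have hfT' : f (φ (n - 3) T) = S1 := by
      rw [E.map_eq (by omega) (by omega), hfT, b_b]
    refine ⟨hfT', ?_⟩
    by_contra hcon
    have := E.mem_peak_of_not_mem (by omega) hT hcon
    rw [E.mem_peak_iff (by omega), hfT'] at this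
    exact key _ _ ep eq h this

end

end IsAugmented

/-! ### Three cells with the three largest letters, and the counting relation. -/

/-- A corner of a shifted diagram: no cell lies to its right or above it. -/
def StrictPartition.IsCorner {n : ℕ} (lam : StrictPartition n) (p : ℕ × ℕ) : Prop :=
  p ∈ lam.cells ∧ ∀ q ∈ lam.cells, ¬ Dominates q p

namespace ShSYT

variable {n : ℕ} {lam : StrictPartition n}

theorem exists_swap_cells (S : ShSYT lam) {k l : ℕ} {p q : ℕ × ℕ} (hk : 1 ≤ k) (hl : l = k + 1)
    (hp : S.entry p = k) (hq : S.entry q = l) (hd : ¬ Dominates q p) :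
    ∃ S' : ShSYT lam, S'.entry p = l ∧ S'.entry q = k ∧
      ∀ x, x ≠ p → x ≠ q → S'.entry x = S.entry x := by
  subst hl
  have hqn := S.entry_le_size q
  obtain ⟨S', h⟩ := S.exists_swap hk (hq ▸ hqn)
    (by rwa [S.pos_eq hk hp, S.pos_eq (by omega) hq])
  have hpm : p ∈ lam.cells := S.mem_iff_entry_pos.mpr (by omega)
  have hqm : q ∈ lam.cells := S.mem_iff_entry_pos.mpr (by omega)
  refine ⟨S', by rw [h, hp, Equiv.swap_apply_left], by rw [h, hq, Equiv.swap_apply_right],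
    fun x h1 h2 => ?_⟩
  rw [h]
  by_cases hx : x ∈ lam.cells
  · refine Equiv.swap_apply_of_ne_of_ne (fun e => h1 (S.cell_eq hx hpm (e.trans hp.symm)))
      (fun e => h2 (S.cell_eq hx hqm (e.trans hq.symm)))
  · rw [S.entry_eq_zero x hx]
    exact Equiv.swap_apply_of_ne_of_ne (by omega) (by omega)

/-- The three largest letters can be placed into any three cells that form an upper set. -/
theorem exists_place (S : ShSYT lam) {c₁ c₂ c₃ : ℕ × ℕ} (hn : 3 ≤ n)
    (h₁ : lam.IsCorner c₁) (h₂ : c₂ ∈ lam.cells) (h₃ : c₃ ∈ lam.cells) (h12 : c₁ ≠ c₂)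
    (h13 : c₁ ≠ c₃) (h23 : c₂ ≠ c₃) (hd₂ : ∀ q ∈ lam.cells, Dominates q c₂ → q = c₁)
    (hd₃ : ∀ q ∈ lam.cells, Dominates q c₃ → q = c₁ ∨ q = c₂) :
    ∃ S' : ShSYT lam, S'.entry c₁ = n ∧ S'.entry c₂ = n - 1 ∧ S'.entry c₃ = n - 2 := by
  obtain ⟨S1, e1, -⟩ := S.exists_raise h₁.1 le_rfl (S.entry_le_size _)
    (fun q hq hd => absurd hd (h₁.2 q hq))
  have hother : ∀ q ∈ lam.cells, q ≠ c₁ → S1.entry q ≤ n - 1 := by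
    intro q hq hne
    have := S1.entry_le_size q
    have : S1.entry q ≠ S1.entry c₁ := fun h => hne (S1.cell_eq hq h₁.1 h)
    omega
  obtain ⟨S2, e2, g2⟩ := S1.exists_raise (m := n - 1) h₂ (by omega) (hother _ h₂ h12.symm)
    (fun q hq hd => by rw [hd₂ q hq hd]; omega)
  have f1 : S2.entry c₁ = n := g2.entry_eq e1 (by omega)
  have hother2 : ∀ q ∈ lam.cells, q ≠ c₁ → q ≠ c₂ → S2.entry q ≤ n - 2 := by
    intro q hq hne hne'
    have := S2.entry_le_size q
    have : S2.entry q ≠ S2.entry c₁ := fun h => hne (S2.cell_eq hq h₁.1 h)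
    have : S2.entry q ≠ S2.entry c₂ := fun h => hne' (S2.cell_eq hq h₂ h)
    omega
  obtain ⟨S3, e3, g3⟩ := S2.exists_raise (m := n - 2) h₃ (by omega)
    (hother2 _ h₃ h13.symm h23.symm)
    (fun q hq hd => by rcases hd₃ q hq hd with rfl | rfl <;> omega)
  exact ⟨S3, g3.entry_eq f1 (by omega), g3.entry_eq e2 (by omega), e3⟩

/-- The cells `a₁, a₂, a₃`, in reading order, contain the three largest letters of `S`. -/
structure IsTriple (S : ShSYT lam) (a₁ a₂ a₃ : ℕ × ℕ) : Prop where
  three_le : 3 ≤ n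
  readLT₁ : ReadLT a₁ a₂
  readLT₂ : ReadLT a₂ a₃
  le₁ : n ≤ S.entry a₁ + 2
  le₂ : n ≤ S.entry a₂ + 2
  le₃ : n ≤ S.entry a₃ + 2

/-- The fillings that agree with `S` outside three given cells. -/
def AgreeOff (S : ShSYT lam) (a₁ a₂ a₃ : ℕ × ℕ) (S' : ShSYT lam) : Prop :=
  ∀ p, p ≠ a₁ → p ≠ a₂ → p ≠ a₃ → S'.entry p = S.entry p

theorem AgreeOff.refl (S : ShSYT lam) (a₁ a₂ a₃ : ℕ × ℕ) : AgreeOff S a₁ a₂ a₃ S :=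
  fun _ _ _ _ => rfl

namespace IsTriple

variable {S : ShSYT lam} {a₁ a₂ a₃ : ℕ × ℕ} (h : IsTriple S a₁ a₂ a₃) {S' : ShSYT lam}
include h

theorem mem : a₁ ∈ lam.cells ∧ a₂ ∈ lam.cells ∧ a₃ ∈ lam.cells := by
  have h3 := h.three_le
  have h4 := h.le₁
  have h5 := h.le₂
  have h6 := h.le₃
  exact ⟨S.mem_iff_entry_pos.mpr (by omega), S.mem_iff_entry_pos.mpr (by omega),
    S.mem_iff_entry_pos.mpr (by omega)⟩

/-- Every letter below `n - 2` is already placed outside the three cells, where the two fillings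
agree. -/
theorem le_of_agreeOff (hS : AgreeOff S a₁ a₂ a₃ S') {a : ℕ × ℕ}
    (ha : a = a₁ ∨ a = a₂ ∨ a = a₃) : n ≤ S'.entry a + 2 := by
  have h4 := h.le₁
  have h5 := h.le₂
  have h6 := h.le₃
  have ham : a ∈ lam.cells := by
    have := h.mem
    rcases ha with rfl | rfl | rfl <;> tauto
  by_contra hcon
  have h1 := S'.one_le_entry ham
  have h7 := S.entry_pos (x := S'.entry a) h1 (by omega)
  have h8 := S.pos_mem (x := S'.entry a) h1 (by omega)
  have hne : ∀ b, n ≤ S.entry b + 2 → S.pos (S'.entry a) ≠ b := by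
    rintro b hb rfl
    omega
  have h9 := hS _ (hne _ h4) (hne _ h5) (hne _ h6)
  have h10 := S'.cell_eq h8 ham (h9.trans h7)
  rcases ha with rfl | rfl | rfl
  · exact hne _ h4 h10
  · exact hne _ h5 h10
  · exact hne _ h6 h10

/-- The six fillings of the three cells. -/
theorem cases_of_agreeOff (hS : AgreeOff S a₁ a₂ a₃ S') :
    (n ≤ S'.entry a₁ + 2 ∧ n ≤ S'.entry a₂ + 2 ∧ n ≤ S'.entry a₃ + 2) ∧
    (S'.entry a₁ ≤ n ∧ S'.entry a₂ ≤ n ∧ S'.entry a₃ ≤ n) ∧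
    S'.entry a₁ ≠ S'.entry a₂ ∧ S'.entry a₁ ≠ S'.entry a₃ ∧ S'.entry a₂ ≠ S'.entry a₃ := by
  obtain ⟨m1, m2, m3⟩ := h.mem
  refine ⟨⟨h.le_of_agreeOff hS (by tauto), h.le_of_agreeOff hS (by tauto),
    h.le_of_agreeOff hS (by tauto)⟩, ⟨S'.entry_le_size _, S'.entry_le_size _,
    S'.entry_le_size _⟩, fun e => h.readLT₁.ne (S'.cell_eq m1 m2 e),
    fun e => (h.readLT₁.trans h.readLT₂).ne (S'.cell_eq m1 m3 e),
    fun e => h.readLT₂.ne (S'.cell_eq m2 m3 e)⟩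

/-- A peak at `n - 1` says that `n - 1` is read after both `n - 2` and `n`, so it is in the last of
the three cells. -/
theorem mem_peak_iff_of_agreeOff (hS : AgreeOff S a₁ a₂ a₃ S') :
    n - 1 ∈ S'.peak ↔ S'.entry a₃ = n - 1 := by
  have h3 := h.three_le
  obtain ⟨⟨l1, l2, l3⟩, ⟨u1, u2, u3⟩, n1, n2, n3⟩ := h.cases_of_agreeOff hS
  have r1 := h.readLT₁
  have r2 := h.readLT₂
  have r3 := r1.trans r2
  rw [ShSYT.mem_peak_iff, ← readLT_iff_key _ (by omega) (by omega) (by omega) (by omega),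
    ← readLT_iff_key _ (by omega) (by omega) (by omega) (by omega),
    show n - 1 - 1 = n - 2 by omega, Nat.sub_add_cancel (by omega)]
  have key : ∀ {a b c}, S'.entry a = n - 2 → S'.entry b = n - 1 → S'.entry c = n →
      (1 < n - 1 ∧ n - 1 < n ∧ ReadLT (S'.pos (n - 2)) (S'.pos (n - 1)) ∧
        ReadLT (S'.pos n) (S'.pos (n - 1)) ↔ ReadLT a b ∧ ReadLT c b) := by
    intro a b c ha hb hc
    rw [S'.pos_eq (by omega) ha, S'.pos_eq (by omega) hb, S'.pos_eq (by omega) hc]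
    exact ⟨fun h => h.2.2, fun h => ⟨by omega, by omega, h⟩⟩
  have hc : (S'.entry a₁ = n - 2 ∧ S'.entry a₂ = n - 1 ∧ S'.entry a₃ = n) ∨
      (S'.entry a₁ = n - 2 ∧ S'.entry a₂ = n ∧ S'.entry a₃ = n - 1) ∨
      (S'.entry a₁ = n - 1 ∧ S'.entry a₂ = n - 2 ∧ S'.entry a₃ = n) ∨
      (S'.entry a₁ = n - 1 ∧ S'.entry a₂ = n ∧ S'.entry a₃ = n - 2) ∨
      (S'.entry a₁ = n ∧ S'.entry a₂ = n - 2 ∧ S'.entry a₃ = n - 1) ∨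
      (S'.entry a₁ = n ∧ S'.entry a₂ = n - 1 ∧ S'.entry a₃ = n - 2) := by omega
  rcases hc with ⟨e1, e2, e3⟩ | ⟨e1, e2, e3⟩ | ⟨e1, e2, e3⟩ | ⟨e1, e2, e3⟩ | ⟨e1, e2, e3⟩ |
    ⟨e1, e2, e3⟩
  · rw [key e1 e2 e3, e3]
    exact ⟨fun h => absurd h.2 r2.asymm, fun h => by omega⟩
  · rw [key e1 e3 e2]
    exact ⟨fun _ => e3, fun _ => ⟨r3, r2⟩⟩
  · rw [key e2 e1 e3, e3]
    exact ⟨fun h => absurd h.1 r1.asymm, fun h => by omega⟩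
  · rw [key e3 e1 e2, e3]
    exact ⟨fun h => absurd h.1 r3.asymm, fun h => by omega⟩
  · rw [key e2 e3 e1]
    exact ⟨fun _ => e3, fun _ => ⟨r2, r3⟩⟩
  · rw [key e3 e2 e1, e3]
    exact ⟨fun h => absurd h.1 r2.asymm, fun h => by omega⟩

end IsTriple

end ShSYT

open ShSYT

section Patterns

variable {A : Type*} {n : ℕ} {lam : StrictPartition n}

/-- The objects whose tableaux have prescribed letters in three cells and agree with `S`
elsewhere. -/
def pattern (f : A → ShSYT lam) (S : ShSYT lam) (a₁ a₂ a₃ : ℕ × ℕ) (x₁ x₂ x₃ : ℕ) : Set A :=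
  {T | AgreeOff S a₁ a₂ a₃ (f T) ∧ (f T).entry a₁ = x₁ ∧ (f T).entry a₂ = x₂ ∧
    (f T).entry a₃ = x₃}

/-- The objects in a pattern that have a peak at `n`. -/
def peakPattern (Peak : A → Set ℕ) (f : A → ShSYT lam) (S : ShSYT lam) (a₁ a₂ a₃ : ℕ × ℕ)
    (x₁ x₂ x₃ : ℕ) : Set A :=
  {T | T ∈ pattern f S a₁ a₂ a₃ x₁ x₂ x₃ ∧ n ∈ Peak T}

theorem mem_pattern_iff {f : A → ShSYT lam} {S S' : ShSYT lam} {a₁ a₂ a₃ : ℕ × ℕ} {x₁ x₂ x₃ : ℕ}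
    (hoff : AgreeOff S a₁ a₂ a₃ S') (h₁ : S'.entry a₁ = x₁) (h₂ : S'.entry a₂ = x₂)
    (h₃ : S'.entry a₃ = x₃) (T : A) : T ∈ pattern f S a₁ a₂ a₃ x₁ x₂ x₃ ↔ f T = S' := by
  constructor
  · rintro ⟨h0, e1, e2, e3⟩
    ext p
    by_cases p1 : p = a₁
    · rw [p1, e1, h₁]
    by_cases p2 : p = a₂
    · rw [p2, e2, h₂]
    by_cases p3 : p = a₃
    · rw [p3, e3, h₃]
    rw [h0 p p1 p2 p3, hoff p p1 p2 p3]
  · intro h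
    unfold pattern
    rw [Set.mem_ofPred_eq, h]
    exact ⟨hoff, h₁, h₂, h₃⟩

theorem ncard_pattern {f : A → ShSYT lam} {S S' : ShSYT lam} {a₁ a₂ a₃ : ℕ × ℕ} {x₁ x₂ x₃ : ℕ}
    (hoff : AgreeOff S a₁ a₂ a₃ S') (h₁ : S'.entry a₁ = x₁) (h₂ : S'.entry a₂ = x₂)
    (h₃ : S'.entry a₃ = x₃) : (pattern f S a₁ a₂ a₃ x₁ x₂ x₃).ncard = fiberCard f S' := by
  unfold fiberCard
  congr 1
  ext T
  exact mem_pattern_iff hoff h₁ h₂ h₃ T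

theorem ncard_peakPattern {Peak : A → Set ℕ} {f : A → ShSYT lam} {S S' : ShSYT lam}
    {a₁ a₂ a₃ : ℕ × ℕ} {x₁ x₂ x₃ : ℕ}
    (hoff : AgreeOff S a₁ a₂ a₃ S') (h₁ : S'.entry a₁ = x₁) (h₂ : S'.entry a₂ = x₂)
    (h₃ : S'.entry a₃ = x₃) :
    (peakPattern Peak f S a₁ a₂ a₃ x₁ x₂ x₃).ncard = peakCard Peak f S' := by
  unfold peakCard
  congr 1
  ext T
  exact and_congr_left fun _ => mem_pattern_iff hoff h₁ h₂ h₃ T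

/-- A pattern is empty if it violates the order along a row or a column. -/
theorem pattern_eq_empty {f : A → ShSYT lam} {S : ShSYT lam} {a₁ a₂ a₃ : ℕ × ℕ} {x₁ x₂ x₃ : ℕ}
    (m₁ : a₁ ∈ lam.cells) (m₂ : a₂ ∈ lam.cells) (m₃ : a₃ ∈ lam.cells)
    (h : (Dominates a₂ a₁ ∧ x₂ < x₁) ∨ (Dominates a₁ a₂ ∧ x₁ < x₂) ∨
      (Dominates a₃ a₂ ∧ x₃ < x₂) ∨ (Dominates a₂ a₃ ∧ x₂ < x₃)) :
    pattern f S a₁ a₂ a₃ x₁ x₂ x₃ = ∅ := by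
  ext T
  simp only [Set.mem_empty_iff_false, iff_false]
  rintro ⟨-, rfl, rfl, rfl⟩
  rcases h with ⟨h, hx⟩ | ⟨h, hx⟩ | ⟨h, hx⟩ | ⟨h, hx⟩
  · exact ((f T).entry_lt_of_dominates m₁ m₂ h).asymm hx
  · exact ((f T).entry_lt_of_dominates m₂ m₁ h).asymm hx
  · exact ((f T).entry_lt_of_dominates m₂ m₃ h).asymm hx
  · exact ((f T).entry_lt_of_dominates m₃ m₂ h).asymm hx

theorem ncard_pattern_eq_zero {f : A → ShSYT lam} {S : ShSYT lam} {a₁ a₂ a₃ : ℕ × ℕ}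
    {x₁ x₂ x₃ : ℕ} (ht : IsTriple S a₁ a₂ a₃)
    (h : (Dominates a₂ a₁ ∧ x₂ < x₁) ∨ (Dominates a₁ a₂ ∧ x₁ < x₂) ∨
      (Dominates a₃ a₂ ∧ x₃ < x₂) ∨ (Dominates a₂ a₃ ∧ x₂ < x₃)) :
    (pattern f S a₁ a₂ a₃ x₁ x₂ x₃).ncard = 0 := by
  rw [pattern_eq_empty ht.mem.1 ht.mem.2.1 ht.mem.2.2 h, Set.ncard_empty]

theorem ncard_peakPattern_eq_zero {Peak : A → Set ℕ} {f : A → ShSYT lam} {S : ShSYT lam}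
    {a₁ a₂ a₃ : ℕ × ℕ} {x₁ x₂ x₃ : ℕ} (ht : IsTriple S a₁ a₂ a₃)
    (h : (Dominates a₂ a₁ ∧ x₂ < x₁) ∨ (Dominates a₁ a₂ ∧ x₁ < x₂) ∨
      (Dominates a₃ a₂ ∧ x₃ < x₂) ∨ (Dominates a₂ a₃ ∧ x₂ < x₃)) :
    (peakPattern Peak f S a₁ a₂ a₃ x₁ x₂ x₃).ncard = 0 := by
  unfold peakPattern
  rw [pattern_eq_empty ht.mem.1 ht.mem.2.1 ht.mem.2.2 h]
  simp

end Patterns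

namespace IsAugmented

variable {A : Type*} {n : ℕ} {lam : StrictPartition n} {Peak : A → Set ℕ} {φ : ℕ → A → A}
  {f : A → ShSYT lam} (E : IsAugmented Peak φ f)
include E

theorem agreeOff_last {S : ShSYT lam} {a₁ a₂ a₃ : ℕ × ℕ} (h : IsTriple S a₁ a₂ a₃) {T : A}
    (hT : AgreeOff S a₁ a₂ a₃ (f T)) : AgreeOff S a₁ a₂ a₃ (f (φ (n - 1) T)) := by
  intro p h1 h2 h3
  by_cases hp : p ∈ lam.cells
  swap
  · rw [ShSYT.entry_eq_zero _ p hp, ShSYT.entry_eq_zero _ p hp]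
  have hn := h.three_le
  obtain ⟨m1, m2, m3⟩ := h.mem
  obtain ⟨⟨l1, l2, l3⟩, ⟨u1, u2, u3⟩, n1, n2, n3⟩ := h.cases_of_agreeOff hT
  have hk1 := (f T).one_le_entry hp
  have hk2 : (f T).entry p + 3 ≤ n := by
    have d1 : (f T).entry p ≠ (f T).entry a₁ := fun e => h1 ((f T).cell_eq hp m1 e)
    have d2 : (f T).entry p ≠ (f T).entry a₂ := fun e => h2 ((f T).cell_eq hp m2 e)
    have d3 : (f T).entry p ≠ (f T).entry a₃ := fun e => h3 ((f T).cell_eq hp m3 e)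
    have := (f T).entry_le_size p
    omega
  have := E.pos_last T hk1 hk2
  rw [(f T).pos_entry hp] at this
  rw [← hT p h1 h2 h3]
  conv_lhs => rw [this]
  exact ShSYT.entry_pos _ hk1 (by omega)

/-- The last involution exchanges the objects with a peak at `n - 1` and those with a peak at
`n`. -/
theorem pattern_equation [Finite A] {S : ShSYT lam} {a₁ a₂ a₃ : ℕ × ℕ}
    (h : IsTriple S a₁ a₂ a₃) :
    (pattern f S a₁ a₂ a₃ (n - 2) n (n - 1)).ncard +
      (pattern f S a₁ a₂ a₃ n (n - 2) (n - 1)).ncard =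
    (peakPattern Peak f S a₁ a₂ a₃ (n - 2) (n - 1) n).ncard +
      (peakPattern Peak f S a₁ a₂ a₃ (n - 1) (n - 2) n).ncard +
      (peakPattern Peak f S a₁ a₂ a₃ (n - 1) n (n - 2)).ncard := by
  have h3 := E.three_le
  have hfin : ∀ s : Set A, s.Finite := fun s => s.toFinite
  rw [← Set.ncard_union_eq _ (hfin _) (hfin _), ← Set.ncard_union_eq _ (hfin _) (hfin _),
    ← Set.ncard_union_eq _ (hfin _) (hfin _)]
  -- On the left `n - 1` is in the last cell, so these are the objects with a peak at `n - 1`. On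
  -- the right are those with a peak at `n`: there `n - 1` precedes `n` by `readLT_of_mem_peak`,
  -- which leaves three of the six fillings.
  · refine (E.involutive _ E.last_index).ncard_eq ?_ ?_
    · intro T hT
      have hoff : AgreeOff S a₁ a₂ a₃ (f T) := hT.elim And.left And.left
      have hT3 : (f T).entry a₃ = n - 1 := hT.elim (fun h => h.2.2.2) (fun h => h.2.2.2)
      rw [← h.mem_peak_iff_of_agreeOff hoff, ← E.mem_peak_iff (by omega),
        E.mem_peak_last_iff] at hT3
      have hoff' := E.agreeOff_last h hoff
      obtain ⟨⟨l1, l2, l3⟩, ⟨u1, u2, u3⟩, n1, n2, n3⟩ := h.cases_of_agreeOff hoff'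
      have hread := E.readLT_of_mem_peak hT3
      have r1 := h.readLT₁
      have r2 := h.readLT₂
      have key : ∀ {a b}, (f (φ (n - 1) T)).entry a = n - 1 → (f (φ (n - 1) T)).entry b = n →
          ¬ ReadLT b a := by
        intro a b ha hb
        rw [ShSYT.pos_eq _ (by omega) ha, ShSYT.pos_eq _ (by omega) hb] at hread
        exact hread.asymm
      by_cases e1 : (f (φ (n - 1) T)).entry a₁ = n - 1
      · by_cases e2 : (f (φ (n - 1) T)).entry a₂ = n
        · exact Or.inr ⟨⟨hoff', e1, e2, by omega⟩, hT3⟩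
        · exact Or.inl (Or.inr ⟨⟨hoff', e1, by omega, by omega⟩, hT3⟩)
      · by_cases e2 : (f (φ (n - 1) T)).entry a₂ = n - 1
        · have : (f (φ (n - 1) T)).entry a₁ ≠ n := fun e => key e2 e r1
          exact Or.inl (Or.inl ⟨⟨hoff', by omega, e2, by omega⟩, hT3⟩)
        · have e3 : (f (φ (n - 1) T)).entry a₃ = n - 1 := by omega
          rcases (show (f (φ (n - 1) T)).entry a₁ = n ∨ (f (φ (n - 1) T)).entry a₂ = n by omega)
            with e | e
          · exact absurd (r1.trans r2) (key e3 e)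
          · exact absurd r2 (key e3 e)
    · intro T hT
      have hoff : AgreeOff S a₁ a₂ a₃ (f T) := by
        rcases hT with (hT | hT) | hT <;> exact hT.1.1
      have hpk : n ∈ Peak T := by
        rcases hT with (hT | hT) | hT <;> exact hT.2
      have hoff' := E.agreeOff_last h hoff
      rw [← E.mem_peak_last_iff', E.mem_peak_iff (by omega),
        h.mem_peak_iff_of_agreeOff hoff'] at hpk
      obtain ⟨⟨l1, l2, l3⟩, ⟨u1, u2, u3⟩, n1, n2, n3⟩ := h.cases_of_agreeOff hoff'
      by_cases e1 : (f (φ (n - 1) T)).entry a₁ = n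
      · exact Or.inr ⟨hoff', e1, by omega, hpk⟩
      · exact Or.inl ⟨hoff', by omega, by omega, hpk⟩
  all_goals
    rw [Set.disjoint_left]
    intro T h1 h2
    first
    | (have e1 := h1.2.1; have e2 := h2.2.1; omega)
    | (have e1 := h1.1.2.2.1; have e2 := h2.1.2.2.1; omega)
    | (have e2 := h2.1.2.2.1
       rcases h1 with h1 | h1
       · have e1 := h1.1.2.2.1; omega
       · have e1 := h1.1.2.2.1; omega)

end IsAugmented

/-! ### Corners, row ends and column tops. -/

namespace StrictPartition

variable {n : ℕ} {lam : StrictPartition n}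

theorem le_of_mem_row {r e y : ℕ} (h : (r, e + 1) ∉ lam.cells) (hre : r ≤ e + 1)
    (hy : (r, y) ∈ lam.cells) : y ≤ e := by
  by_contra hc
  exact h (lam.left_mem hre (by omega) hy)

theorem le_of_mem_col {R y z : ℕ} (h : (R + 1, z) ∉ lam.cells) (hy : (y, z) ∈ lam.cells) :
    y ≤ R := by
  by_contra hc
  exact h (lam.below_mem_of_le (by omega) hy)

theorem isCorner_iff {r x : ℕ} : lam.IsCorner (r, x) ↔
    (r, x) ∈ lam.cells ∧ (r, x + 1) ∉ lam.cells ∧ (r + 1, x) ∉ lam.cells := by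
  constructor
  · rintro ⟨h1, h2⟩
    exact ⟨h1, fun h => h2 _ h (Or.inl ⟨rfl, by simp only; omega⟩),
      fun h => h2 _ h (Or.inr ⟨rfl, by simp only; omega⟩)⟩
  · rintro ⟨h1, h2, h3⟩
    have hd := h1.1
    simp only at hd
    refine ⟨h1, ?_⟩
    rintro ⟨r', x'⟩ hq (⟨h4, h5⟩ | ⟨h4, h5⟩)
    · simp only at h4 h5
      subst h4
      have := le_of_mem_row h2 (by omega) hq
      omega
    · simp only at h4 h5
      subst h4
      have := le_of_mem_col h3 hq
      omega

theorem IsCorner.lt_of_readLT {r x r' x' : ℕ} (h : lam.IsCorner (r, x))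
    (h' : lam.IsCorner (r', x')) (hread : ReadLT (r', x') (r, x)) : r < r' ∧ x' < x := by
  have hd := h'.1.1
  simp only [ReadLT] at hread hd
  have hr : r < r' := by
    by_contra hcon
    obtain rfl : r' = r := by omega
    exact h'.2 _ h.1 (Or.inl ⟨rfl, by simp only; omega⟩)
  refine ⟨hr, ?_⟩
  by_contra hcon
  have hm : (r, x') ∈ lam.cells := lam.below_mem_of_le hr.le h'.1
  rcases (show x ≤ x' by omega).eq_or_lt with rfl | hlt
  · exact h.2 _ h'.1 (Or.inr ⟨rfl, hr⟩)
  · exact h.2 _ hm (Or.inl ⟨rfl, hlt⟩)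

/-- Every column has a topmost cell. -/
theorem exists_top (S : ShSYT lam) {r x : ℕ} (h : (r, x) ∈ lam.cells) :
    ∃ r', r ≤ r' ∧ (r', x) ∈ lam.cells ∧ (r' + 1, x) ∉ lam.cells := by
  obtain ⟨w, hw, ⟨h1, h2⟩, hmax⟩ := S.exists_max_entry (fun w => r ≤ w.1 ∧ w.2 = x) h
    ⟨le_rfl, rfl⟩
  obtain ⟨r', x'⟩ := w
  simp only at h1 h2
  subst h2
  refine ⟨r', h1, hw, fun hc => ?_⟩
  have h3 := hmax _ hc ⟨by simp only; omega, rfl⟩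
  have h4 := S.col_lt r' (r' + 1) x' (by omega) hw hc
  omega

/-- Every row has a last cell. -/
theorem exists_end (S : ShSYT lam) {r x : ℕ} (h : (r, x) ∈ lam.cells) :
    ∃ x', x ≤ x' ∧ (r, x') ∈ lam.cells ∧ (r, x' + 1) ∉ lam.cells := by
  obtain ⟨w, hw, ⟨h1, h2⟩, hmax⟩ := S.exists_max_entry (fun w => x ≤ w.2 ∧ w.1 = r) h
    ⟨le_rfl, rfl⟩
  obtain ⟨r', x'⟩ := w
  simp only at h1 h2
  subst h2
  refine ⟨x', h1, hw, fun hc => ?_⟩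
  have h3 := hmax _ hc ⟨by simp only; omega, rfl⟩
  have h4 := S.row_lt r' x' (x' + 1) (by omega) hw hc
  omega

end StrictPartition

open StrictPartition ShSYT

/-! ### Consequences of the counting relation near the corners. -/

namespace IsAugmented

variable {A : Type*} [Finite A] {n : ℕ} {lam : StrictPartition n}
  {Peak : A → Set ℕ} {φ : ℕ → A → A} {f : A → ShSYT lam} (E : IsAugmented Peak φ f)
include E

/-- The left neighbour of a corner that is not the first one is covered from above. -/
theorem mem_of_isCorner [Nonempty A] {r x r' x' : ℕ} (hc : lam.IsCorner (r, x))
    (hc' : lam.IsCorner (r', x')) (hread : ReadLT (r', x') (r, x)) : (r + 1, x - 1) ∈ lam.cells := by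
  have h3 := E.three_le
  obtain ⟨hr, hx⟩ := hc.lt_of_readLT hc' hread
  have hd' := hc'.1.1
  simp only at hd'
  by_contra hcon
  obtain ⟨y, rfl⟩ : ∃ y, x = y + 1 := ⟨x - 1, by omega⟩
  rw [Nat.add_sub_cancel] at hcon
  have hxy : x' < y := by
    by_contra h
    obtain rfl : x' = y := by omega
    exact hcon (lam.below_mem_of_le (by omega) hc'.1)
  have hy : (r, y) ∈ lam.cells := lam.left_mem (by omega) (by omega) hc.1
  have hend := (isCorner_iff.mp hc).2.1
  have hdy : ∀ q ∈ lam.cells, Dominates q (r, y) → q = (r, y + 1) := by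
    rintro ⟨q1, q2⟩ hq (⟨h1, h2⟩ | ⟨h1, h2⟩)
    · simp only at h1 h2
      subst h1
      have := le_of_mem_row hend (by omega) hq
      rw [show q2 = y + 1 by omega]
    · simp only at h1 h2
      subst h1
      have := le_of_mem_col hcon hq
      omega
  obtain ⟨T₀⟩ := ‹Nonempty A›
  -- If `(r, y)` is uncovered, `n - 1, n` fit into the last two cells of row `r` and `n - 2` into
  -- the earlier corner. Next `n - 3` goes into a cell `w` read between this corner and `(r, y)`,
  -- and `n - 4` before `w`, which makes `n - 3` a peak.
  obtain ⟨S0, e1, e2, e3⟩ := (f T₀).exists_place h3 hc hy hc'.1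
    (by simp) (by simp only [ne_eq, Prod.mk.injEq]; omega)
    (by simp only [ne_eq, Prod.mk.injEq]; omega) hdy
    (fun q hq hd => absurd hd (hc'.2 q hq))
  -- choose the cells of the next two letters
  obtain ⟨⟨w1, w2⟩, hw, hwk, hw1, hw2, hwoff, hwmax⟩ := S0.exists_between (k := n - 3) hr hxy
    hc'.1 (by omega)
    (fun s hs => by
      have := S0.col_lt s r' x' hs (lam.below_mem_of_le hs.le hc'.1) hc'.1
      omega)
    (fun z hz hzk => by
      by_contra h
      have := S0.row_le (show y ≤ z by omega) hy hz
      omega)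
  have hw0 := S0.one_le_entry hw
  obtain ⟨S1, f1, g1⟩ := S0.exists_raise hw (by omega) hwk hwmax
  simp only at hwoff
  have hleft : (w1, w2 - 1) ∈ lam.cells := lam.mem_of_le hw le_rfl (by omega) (by omega)
  have hleft1 := S1.one_le_entry hleft
  have hleft2 := S1.row_lt w1 (w2 - 1) w2 (by omega) hleft hw
  obtain ⟨v, hv, hvk, hvw, hvmax⟩ := S1.exists_before (k := n - 4) hw hwoff (by omega)
    (by simp only; omega)
  have hv0 := S1.one_le_entry hv
  obtain ⟨S, f2, g2⟩ := S1.exists_raise hv (by omega) hvk hvmax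
  have ew : S.entry (w1, w2) = n - 3 := g2.entry_eq f1 (by omega)
  have hg := g1.trans (g2.mono (show n - 4 ≤ n - 3 by omega))
  have ec : S.entry (r, y + 1) = n := hg.entry_eq e1 (by omega)
  have ey : S.entry (r, y) = n - 1 := hg.entry_eq e2 (by omega)
  have ec' : S.entry (r', x') = n - 2 := hg.entry_eq e3 (by omega)
  have rcy : ReadLT (r', x') (r, y) := Or.inl hr
  have ryc : ReadLT (r, y) (r, y + 1) := Or.inr ⟨rfl, by simp only; omega⟩
  have ht : IsTriple S (r', x') (r, y) (r, y + 1) :=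
    ⟨h3, rcy, ryc, by omega, by omega, by omega⟩
  have hdom : Dominates (r, y + 1) (r, y) := Or.inl ⟨rfl, by simp only; omega⟩
  -- there is no peak at `n` over `S`
  have hzero : peakCard Peak f S = 0 := by
    unfold peakCard
    rw [Set.ncard_eq_zero (Set.toFinite _)]
    ext T
    simp only [Set.mem_empty_iff_false, iff_false]
    rintro ⟨hfT, hT⟩
    have hpk : n - 3 ∈ Peak T := by
      rw [E.mem_peak_iff (by omega), hfT, ShSYT.mem_peak_iff,
        ← readLT_iff_key _ (by omega) (by omega) (by omega) (by omega),
        ← readLT_iff_key _ (by omega) (by omega) (by omega) (by omega),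
        S.pos_eq (x := n - 3) (by omega) ew,
        S.pos_eq (x := n - 3 - 1) (by omega) (f2.trans (by omega)),
        S.pos_eq (x := n - 3 + 1) (by omega) (ec'.trans (by omega))]
      exact ⟨by omega, by omega, hvw, hw1⟩
    -- The peak at `n - 3` would survive `φ (n - 1)`. But afterwards `n - 1` is in the last cell, so
    -- `n - 2` is in `(r, y)`, which is read after `w`.
    have hpk' := E.mem_peak_last_of_mem (by omega) hT hpk
    have hoff := E.agreeOff_last ht (T := T) (by rw [hfT]; exact AgreeOff.refl _ _ _ _)
    rw [← E.mem_peak_last_iff', E.mem_peak_iff (by omega), ht.mem_peak_iff_of_agreeOff hoff] at hT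
    have hlt := (f (φ (n - 1) T)).entry_lt_of_dominates hy hc.1 hdom
    obtain ⟨⟨-, l2, -⟩, -⟩ := ht.cases_of_agreeOff hoff
    have ew' := hoff (w1, w2)
      (by rintro h; rw [h] at ew; omega) (by rintro h; rw [h] at ew; omega)
      (by rintro h; rw [h] at ew; omega)
    rw [E.mem_peak_iff (by omega), ShSYT.mem_peak_iff,
      ← readLT_iff_key _ (by omega) (by omega) (by omega) (by omega),
      ← readLT_iff_key _ (by omega) (by omega) (by omega) (by omega),
      ShSYT.pos_eq (x := n - 3) _ (by omega) (ew'.trans ew),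
      ShSYT.pos_eq (x := n - 3 + 1) (p := (r, y)) _ (by omega) (by omega)] at hpk'
    exact hw2.asymm hpk'.2.2.2
  obtain ⟨S', s1, s2, s3⟩ := S.exists_swap_cells (l := n - 1) (by omega) (by omega) ec' ey
    (hc'.2 _ hy)
  have s4 : S'.entry (r, y + 1) = n := by
    rw [s3 _ (hread.ne.symm) ryc.ne.symm, ec]
  obtain ⟨S'', t1, t2, t3⟩ := S'.exists_swap_cells (by omega) (by omega) s1 s4
    (hc'.2 _ hc.1)
  have t4 : S''.entry (r, y) = n - 2 := by rw [t3 _ rcy.ne.symm ryc.ne, s2]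
  have hoff' : AgreeOff S (r', x') (r, y) (r, y + 1) S' := fun p p1 p2 _ => s3 p p1 p2
  have hoff'' : AgreeOff S (r', x') (r, y) (r, y + 1) S'' := fun p p1 p2 p3 =>
    (t3 p p1 p3).trans (s3 p p1 p2)
  -- The left side contains the whole fibre over `S''`, while every term on the right vanishes.
  have heq := E.pattern_equation ht
  rw [ncard_pattern_eq_zero ht (Or.inr (Or.inr (Or.inl ⟨hdom, by omega⟩))),
    ncard_pattern hoff'' t1 t4 t2, ncard_peakPattern (AgreeOff.refl _ _ _ _) ec' ey ec,
    ncard_peakPattern hoff' s1 s2 s4,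
    ncard_peakPattern_eq_zero ht (Or.inr (Or.inr (Or.inl ⟨hdom, by omega⟩))),
    ← E.peakCard_eq ec s4 ey s1 ryc hread, hzero] at heq
  have := E.fiberCard_pos S''
  omega

/-- If `n` lies in a corner that is not the first one, after `n - 1`, then all objects over `S`
have a peak at `n`. -/
theorem peakCard_of_not_first [Nonempty A] {r x r' x' : ℕ} (hc : lam.IsCorner (r, x))
    (hc' : lam.IsCorner (r', x')) (hread : ReadLT (r', x') (r, x)) {S : ShSYT lam} {q : ℕ × ℕ}
    (hS : S.entry (r, x) = n) (hq : S.entry q = n - 1) (hqc : ReadLT q (r, x)) :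
    peakCard Peak f S = fiberCard f S := by
  have h3 := E.three_le
  have hm := E.mem_of_isCorner hc hc' hread
  obtain ⟨hr, hx⟩ := hc.lt_of_readLT hc' hread
  obtain ⟨y, rfl⟩ : ∃ y, x = y + 1 := ⟨x - 1, by omega⟩
  rw [Nat.add_sub_cancel] at hm
  obtain ⟨-, hend, hup⟩ := isCorner_iff.mp hc
  -- The top of the covered column is a corner; the cell below it is dominated by this corner and
  -- possibly by `(r, y + 1)` only, so these three cells can hold the largest letters.
  obtain ⟨t, hrt, ht, ht'⟩ := exists_top S hm
  obtain ⟨s, rfl⟩ : ∃ s, t = s + 1 := ⟨t - 1, by omega⟩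
  have hty := ht.1
  simp only at hty
  have htc : lam.IsCorner (s + 1, y) := isCorner_iff.mpr
    ⟨ht, fun h => hup (lam.below_mem_of_le hrt h), ht'⟩
  have hb : (s, y) ∈ lam.cells := lam.below_mem ht
  have hdb : ∀ q ∈ lam.cells, Dominates q (s, y) → q = (r, y + 1) ∨ q = (s + 1, y) := by
    rintro ⟨q1, q2⟩ hq (⟨h1, h2⟩ | ⟨h1, h2⟩)
    · simp only at h1 h2
      subst h1
      have h4 : q1 ≤ r := by
        by_contra hcon
        exact hup (lam.mem_of_le hq (by omega) (by omega) (by omega))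
      obtain rfl : q1 = r := by omega
      have := le_of_mem_row hend (by omega) hq
      rw [show q2 = y + 1 by omega]
      exact Or.inl rfl
    · simp only at h1 h2
      subst h1
      have := le_of_mem_col ht' hq
      rw [show q1 = s + 1 by omega]
      exact Or.inr rfl
  obtain ⟨S1, e1, e2, e3⟩ := S.exists_place h3 hc ht hb (by simp) (by simp) (by simp)
    (fun q hq hd => absurd hd (htc.2 q hq)) hdb
  have r1 : ReadLT (s + 1, y) (s, y) := Or.inl (by simp only; omega)
  have r2 : ReadLT (s, y) (r, y + 1) := by simp only [ReadLT]; omega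
  have r3 := r1.trans r2
  have htr : IsTriple S1 (s + 1, y) (s, y) (r, y + 1) := ⟨h3, r1, r2, by omega, by omega, by omega⟩
  obtain ⟨S2, s1, s2, s3⟩ := S1.exists_swap_cells (by omega) (by omega) e2 e1
    (htc.2 _ hc.1)
  have s4 : S2.entry (s, y) = n - 2 := by rw [s3 _ r1.ne.symm r2.ne, e3]
  have hoff : AgreeOff S1 (s + 1, y) (s, y) (r, y + 1) S2 := fun p p1 _ p3 => s3 p p1 p3
  have hdom : Dominates (s + 1, y) (s, y) := Or.inr ⟨rfl, by simp only; omega⟩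
  -- As `(s + 1, y)` lies above `(s, y)`, one filling survives on each side: a fibre equals a peak
  -- count.
  have heq := E.pattern_equation htr
  rw [ncard_pattern_eq_zero htr (Or.inr (Or.inl ⟨hdom, by omega⟩)),
    ncard_pattern hoff s1 s4 s2,
    ncard_peakPattern_eq_zero htr (Or.inr (Or.inl ⟨hdom, by omega⟩)),
    ncard_peakPattern (AgreeOff.refl _ _ _ _) e2 e3 e1,
    ncard_peakPattern_eq_zero htr (Or.inr (Or.inl ⟨hdom, by omega⟩))] at heq
  rw [E.peakCard_eq hS e1 hq e2 hqc r3, E.fiberCard_eq S S2]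
  omega

/-- There are at most two corners. -/
theorem not_three_corners [Nonempty A] {c₁ c₂ c₃ : ℕ × ℕ} (h₁ : lam.IsCorner c₁)
    (h₂ : lam.IsCorner c₂) (h₃ : lam.IsCorner c₃) (h12 : ReadLT c₁ c₂) (h23 : ReadLT c₂ c₃) : False := by
  have h3 := E.three_le
  have h13 := h12.trans h23
  obtain ⟨T₀⟩ := ‹Nonempty A›
  obtain ⟨S, e3, e2, e1⟩ := (f T₀).exists_place h3 h₃ h₂.1 h₁.1 h23.ne.symm h13.ne.symm
    h12.ne.symm (fun q hq hd => absurd hd (h₂.2 q hq)) (fun q hq hd => absurd hd (h₁.2 q hq))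
  have ht : IsTriple S c₁ c₂ c₃ := ⟨h3, h12, h23, by omega, by omega, by omega⟩
  -- the four other fillings
  obtain ⟨S1, a1, a2, a3⟩ := S.exists_swap_cells (l := n - 1) (by omega) (by omega) e1 e2
    (h₁.2 _ h₂.1)
  have a4 : S1.entry c₃ = n := by rw [a3 _ h13.ne.symm h23.ne.symm, e3]
  obtain ⟨S2, b1, b2, b3⟩ := S1.exists_swap_cells (by omega) (by omega) a1 a4 (h₁.2 _ h₃.1)
  have b4 : S2.entry c₂ = n - 2 := by rw [b3 _ h12.ne.symm h23.ne, a2]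
  obtain ⟨S3, d1, d2, d3⟩ := S.exists_swap_cells (by omega) (by omega) e2 e3 (h₂.2 _ h₃.1)
  have d4 : S3.entry c₁ = n - 2 := by rw [d3 _ h12.ne h13.ne, e1]
  obtain ⟨S4, g1, g2, g3⟩ := S3.exists_swap_cells (l := n - 1) (by omega) (by omega) d4 d2
    (h₁.2 _ h₃.1)
  have g4 : S4.entry c₂ = n := by rw [g3 _ h12.ne.symm h23.ne, d1]
  -- With fibre size `N`, the left side is `2 * N`. On the right all three counts are full by
  -- `peakCard_of_not_first`, which gives `3 * N`.
  have heq := E.pattern_equation ht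
  rw [ncard_pattern (fun p _ p2 p3 => d3 p p2 p3) d4 d1 d2,
    ncard_pattern (fun p p1 p2 p3 => (b3 p p1 p3).trans (a3 p p1 p2)) b1 b4 b2,
    ncard_peakPattern (AgreeOff.refl _ _ _ _) e1 e2 e3,
    ncard_peakPattern (fun p p1 p2 _ => a3 p p1 p2) a1 a2 a4,
    ncard_peakPattern (fun p p1 p2 p3 => (g3 p p1 p3).trans (d3 p p2 p3)) g1 g4 g2,
    E.peakCard_of_not_first h₃ h₂ h23 e3 e2 h23,
    E.peakCard_of_not_first h₃ h₂ h23 a4 a1 h13,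
    E.peakCard_of_not_first h₂ h₁ h12 g4 g1 h12] at heq
  have k1 := E.fiberCard_eq S3 S
  have k2 := E.fiberCard_eq S2 S
  have k3 := E.fiberCard_eq S1 S
  have k4 := E.fiberCard_eq S4 S
  have := E.fiberCard_pos S
  omega

/-- A last row of length one is not followed by a row of length two. -/
theorem mem_of_isCorner_diag [Nonempty A] {R : ℕ} (hc : lam.IsCorner (R + 1, R + 1)) :
    (R, R + 2) ∈ lam.cells := by
  have h3 := E.three_le
  by_contra hcon
  obtain ⟨T₀⟩ := ‹Nonempty A›
  have hq : (R, R + 1) ∈ lam.cells := lam.below_mem hc.1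
  have hq' : (R, R) ∈ lam.cells := lam.left_mem le_rfl (by omega) hq
  have hup := (isCorner_iff.mp hc).2.2
  obtain ⟨S, e1, e2, e3⟩ := (f T₀).exists_place h3 hc hq hq' (by simp) (by simp) (by simp)
    (by
      rintro ⟨q1, q2⟩ hx (⟨h1, h2⟩ | ⟨h1, h2⟩)
      · simp only at h1 h2
        subst h1
        have := le_of_mem_row hcon (by omega) hx
        omega
      · simp only at h1 h2
        subst h1
        have := le_of_mem_col hup hx
        rw [show q1 = R + 1 by omega])
    (by
      rintro ⟨q1, q2⟩ hx (⟨h1, h2⟩ | ⟨h1, h2⟩)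
      · simp only at h1 h2
        subst h1
        have := le_of_mem_row hcon (by omega) hx
        rw [show q2 = q1 + 1 by omega]
        exact Or.inr rfl
      · simp only at h1 h2
        subst h1
        have := hx.1
        simp only at this
        omega)
  have r1 : ReadLT (R + 1, R + 1) (R, R) := Or.inl (by simp only; omega)
  have r2 : ReadLT (R, R) (R, R + 1) := Or.inr ⟨rfl, by simp only; omega⟩
  have ht : IsTriple S (R + 1, R + 1) (R, R) (R, R + 1) :=
    ⟨h3, r1, r2, by omega, by omega, by omega⟩
  have hd : Dominates (R, R + 1) (R, R) := Or.inl ⟨rfl, by simp only; omega⟩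
  -- The third cell lies below the first, so it cannot carry `n`; the alternative `x = n` is
  -- discarded at each use. The relation then equates a fibre with zero.
  have hz : ∀ x y z, z = n → (peakPattern Peak f S (R + 1, R + 1) (R, R) (R, R + 1) x y z).ncard
      = 0 ∨ x = n := by
    intro x y z hz
    by_cases hx : x = n
    · exact Or.inr hx
    · left
      unfold peakPattern
      rw [Set.ncard_eq_zero (Set.toFinite _)]
      ext T
      simp only [Set.mem_empty_iff_false, iff_false]
      rintro ⟨⟨-, rfl, rfl, rfl⟩, -⟩
      have h4 := (f T).col_lt R (R + 1) (R + 1) (by omega) hq hc.1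
      have h5 := (f T).entry_le_size (R + 1, R + 1)
      omega
  have heq := E.pattern_equation ht
  rw [ncard_pattern_eq_zero ht (Or.inr (Or.inr (Or.inl ⟨hd, by omega⟩))),
    ncard_pattern (AgreeOff.refl _ _ _ _) e1 e3 e2,
    (hz (n - 2) (n - 1) n rfl).resolve_right (by omega),
    (hz (n - 1) (n - 2) n rfl).resolve_right (by omega),
    ncard_peakPattern_eq_zero ht (Or.inr (Or.inr (Or.inl ⟨hd, by omega⟩)))] at heq
  have := E.fiberCard_pos S
  omega

/-- The case in which the two last rows end in the same column. -/
theorem peakCard_of_equal_ends {R z : ℕ} (hz : R + 1 ≤ z) (hc : lam.IsCorner (R + 1, z + 1))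
    (htop : ∀ x, (R + 2, x) ∉ lam.cells) (hend : (R, z + 2) ∉ lam.cells)
    {S : ShSYT lam} {q : ℕ × ℕ} (hS : S.entry (R + 1, z + 1) = n) (hq : S.entry q = n - 1)
    (hqc : ReadLT q (R + 1, z + 1)) : peakCard Peak f S = fiberCard f S := by
  have h3 := E.three_le
  have hp : (R + 1, z) ∈ lam.cells := lam.left_mem hz (by omega) hc.1
  have hm : (R, z + 1) ∈ lam.cells := lam.below_mem hc.1
  have hcend := (isCorner_iff.mp hc).2.1
  obtain ⟨S1, e1, e2, e3⟩ := S.exists_place h3 hc hm hp (by simp) (by simp) (by simp)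
    (by
      rintro ⟨q1, q2⟩ hx (⟨h1, h2⟩ | ⟨h1, h2⟩)
      · simp only at h1 h2
        subst h1
        have := le_of_mem_row hend (by omega) hx
        omega
      · simp only at h1 h2
        subst h1
        have := le_of_mem_col (htop _) hx
        rw [show q1 = R + 1 by omega])
    (by
      rintro ⟨q1, q2⟩ hx (⟨h1, h2⟩ | ⟨h1, h2⟩)
      · simp only at h1 h2
        subst h1
        have := le_of_mem_row hcend (by omega) hx
        rw [show q2 = z + 1 by omega]
        exact Or.inl rfl
      · simp only at h1 h2
        subst h1
        have := le_of_mem_col (htop _) hx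
        omega)
  have r1 : ReadLT (R + 1, z) (R + 1, z + 1) := Or.inr ⟨rfl, by simp only; omega⟩
  have r2 : ReadLT (R + 1, z + 1) (R, z + 1) := Or.inl (by simp only; omega)
  have ht : IsTriple S1 (R + 1, z) (R + 1, z + 1) (R, z + 1) :=
    ⟨h3, r1, r2, by omega, by omega, by omega⟩
  have hd1 : Dominates (R + 1, z + 1) (R + 1, z) := Or.inl ⟨rfl, by simp only; omega⟩
  have hd2 : Dominates (R + 1, z + 1) (R, z + 1) := Or.inr ⟨rfl, by simp only; omega⟩
  obtain ⟨S2, s1, s2, s3⟩ := S1.exists_swap_cells (l := n - 1) (by omega) (by omega) e3 e2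
    (by simp only [Dominates]; omega)
  have s4 : S2.entry (R + 1, z + 1) = n := by rw [s3 _ r1.ne.symm r2.ne, e1]
  -- The middle cell dominates the other two, so it holds `n`: one fibre on the left, one peak count
  -- on the right.
  have heq := E.pattern_equation ht
  rw [ncard_pattern (AgreeOff.refl _ _ _ _) e3 e1 e2,
    ncard_pattern_eq_zero ht (Or.inl ⟨hd1, by omega⟩),
    ncard_peakPattern_eq_zero ht (Or.inr (Or.inr (Or.inr ⟨hd2, by omega⟩))),
    ncard_peakPattern_eq_zero ht (Or.inl ⟨hd1, by omega⟩),
    ncard_peakPattern (fun p p1 _ p3 => s3 p p1 p3) s1 s4 s2] at heq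
  rw [E.peakCard_eq hS s4 hq s1 hqc r1, E.fiberCard_eq S S1]
  omega

/-- The case of a last row of length at least two and a second corner. -/
theorem peakCard_of_second_corner [Nonempty A] {R z : ℕ} (hz : R ≤ z) (hc : lam.IsCorner (R, z + 1))
    (htop : ∀ x, (R + 1, x) ∉ lam.cells) {c : ℕ × ℕ} (hc' : lam.IsCorner c)
    (hread : ReadLT (R, z + 1) c) {S : ShSYT lam} {q : ℕ × ℕ} (hS : S.entry (R, z + 1) = n)
    (hq : S.entry q = n - 1) (hqc : ReadLT q (R, z + 1)) : peakCard Peak f S = 0 := by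
  have h3 := E.three_le
  have hp : (R, z) ∈ lam.cells := lam.left_mem hz (by omega) hc.1
  have hcend := (isCorner_iff.mp hc).2.1
  have r1 : ReadLT (R, z) (R, z + 1) := Or.inr ⟨rfl, by simp only; omega⟩
  have r3 := r1.trans hread
  have hdp : ∀ q ∈ lam.cells, Dominates q (R, z) → q = (R, z + 1) := by
    rintro ⟨q1, q2⟩ hx (⟨h1, h2⟩ | ⟨h1, h2⟩)
    · simp only at h1 h2
      subst h1
      have := le_of_mem_row hcend (by omega) hx
      rw [show q2 = z + 1 by omega]
    · simp only at h1 h2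
      subst h1
      have := le_of_mem_col (htop _) hx
      omega
  obtain ⟨S1, e3, e2, e1⟩ := S.exists_place h3 hc' hc.1 hp hread.ne.symm r3.ne.symm r1.ne.symm
    (fun q hq hd => absurd hd (hc.2 q hq)) (fun q hq hd => Or.inr (hdp q hq hd))
  have ht : IsTriple S1 (R, z) (R, z + 1) c := ⟨h3, r1, hread, by omega, by omega, by omega⟩
  have hd1 : Dominates (R, z + 1) (R, z) := Or.inl ⟨rfl, by simp only; omega⟩
  obtain ⟨S2, s1, s2, s3⟩ := S1.exists_swap_cells (by omega) (by omega) e2 e3 (hc.2 _ hc'.1)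
  have s4 : S2.entry (R, z) = n - 2 := by rw [s3 _ r1.ne r3.ne, e1]
  obtain ⟨S3, t1, t2, t3⟩ := S2.exists_swap_cells (l := n - 1) (by omega) (by omega) s4 s2
    (fun hd => hread.ne (hdp _ hc'.1 hd).symm)
  have t4 : S3.entry (R, z + 1) = n := by rw [t3 _ r1.ne.symm hread.ne, s1]
  -- One fibre on the left; on the right a count that is already full, with `n` in the second
  -- corner, plus the count in question.
  have heq := E.pattern_equation ht
  obtain ⟨c1, c2⟩ := c
  rw [ncard_pattern (fun p _ p2 p3 => s3 p p2 p3) s4 s1 s2,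
    ncard_pattern_eq_zero ht (Or.inl ⟨hd1, by omega⟩),
    ncard_peakPattern (AgreeOff.refl _ _ _ _) e1 e2 e3,
    ncard_peakPattern_eq_zero ht (Or.inl ⟨hd1, by omega⟩),
    ncard_peakPattern (fun p p1 p2 p3 => (t3 p p1 p3).trans (s3 p p2 p3)) t1 t4 t2,
    E.peakCard_of_not_first hc' hc hread e3 e2 hread] at heq
  rw [E.peakCard_eq hS t4 hq t1 hqc r1]
  have := E.fiberCard_eq S1 S2
  omega

/-- The case of a last row of length at least three. -/
theorem peakCard_of_long_row {R z : ℕ} (hz : R ≤ z) (hc : lam.IsCorner (R, z + 2))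
    (htop : ∀ x, (R + 1, x) ∉ lam.cells) {S : ShSYT lam} {q : ℕ × ℕ}
    (hS : S.entry (R, z + 2) = n) (hq : S.entry q = n - 1) (hqc : ReadLT q (R, z + 2)) :
    peakCard Peak f S = 0 := by
  have h3 := E.three_le
  have hp : (R, z + 1) ∈ lam.cells := lam.left_mem (by omega) (by omega) hc.1
  have hp' : (R, z) ∈ lam.cells := lam.left_mem hz (by omega) hc.1
  have hcend := (isCorner_iff.mp hc).2.1
  have hdp : ∀ y, ∀ q ∈ lam.cells, Dominates q (R, y) → ∃ x, q = (R, x) ∧ y < x ∧ x ≤ z + 2 := by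
    rintro y ⟨q1, q2⟩ hx (⟨h1, h2⟩ | ⟨h1, h2⟩)
    · simp only at h1 h2
      subst h1
      exact ⟨q2, rfl, h2, le_of_mem_row hcend (by omega) hx⟩
    · simp only at h1 h2
      subst h1
      have := le_of_mem_col (htop _) hx
      omega
  obtain ⟨S1, e3, e2, e1⟩ := S.exists_place h3 hc hp hp' (by simp) (by simp) (by simp)
    (fun q hq hd => by
      obtain ⟨x, rfl, h1, h2⟩ := hdp _ q hq hd
      rw [show x = z + 2 by omega])
    (fun q hq hd => by
      obtain ⟨x, rfl, h1, h2⟩ := hdp _ q hq hd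
      rcases (show x = z + 2 ∨ x = z + 1 by omega) with rfl | rfl
      · exact Or.inl rfl
      · exact Or.inr rfl)
  have r1 : ReadLT (R, z) (R, z + 1) := Or.inr ⟨rfl, by simp only; omega⟩
  have r2 : ReadLT (R, z + 1) (R, z + 2) := Or.inr ⟨rfl, by simp only; omega⟩
  have ht : IsTriple S1 (R, z) (R, z + 1) (R, z + 2) := ⟨h3, r1, r2, by omega, by omega, by omega⟩
  have hd1 : Dominates (R, z + 1) (R, z) := Or.inl ⟨rfl, by simp only; omega⟩
  have hd2 : Dominates (R, z + 2) (R, z + 1) := Or.inl ⟨rfl, by simp only; omega⟩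
  -- Three cells in one row allow the increasing filling only, and it contributes nothing to the
  -- left side.
  have heq := E.pattern_equation ht
  rw [ncard_pattern_eq_zero ht (Or.inr (Or.inr (Or.inl ⟨hd2, by omega⟩))),
    ncard_pattern_eq_zero ht (Or.inl ⟨hd1, by omega⟩),
    ncard_peakPattern (AgreeOff.refl _ _ _ _) e1 e2 e3,
    ncard_peakPattern_eq_zero ht (Or.inl ⟨hd1, by omega⟩),
    ncard_peakPattern_eq_zero ht (Or.inr (Or.inr (Or.inl ⟨hd2, by omega⟩)))] at heq
  rw [E.peakCard_eq hS e3 hq e2 hqc r2]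
  omega

end IsAugmented

/-! ### Adding a cell to a shape. -/

namespace StrictPartition

variable {n : ℕ}

/-- A cell above the last row, or at its end, can be added if its lower neighbour is present. -/
theorem exists_insert (lam : StrictPartition n) {R : ℕ} (hrow : lam.row (R + 1) = 0)
    (hbelow : ∀ r, r + 1 = R → (r, R + lam.row R) ∈ lam.cells) :
    ∃ mu : StrictPartition (n + 1), mu.cells = insert (R, R + lam.row R) lam.cells := by
  have hlen : lam.parts.length ≤ R + 1 := by
    have := lam.lt_length_iff (R + 1)
    omega
  have hlen' : R ≤ lam.parts.length := by
    rcases Nat.eq_zero_or_pos R with rfl | hR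
    · exact Nat.zero_le _
    · have h1 := hbelow (R - 1) (by omega)
      have := lam.lt_length_iff (R - 1)
      rw [mem_cells] at h1
      omega
  have hlt : ∀ r, r < R → lam.row R + 1 < lam.row r := by
    intro r hr
    have h1 := lam.below_mem_of_le (show r ≤ R - 1 by omega) (hbelow (R - 1) (by omega))
    rw [mem_cells] at h1
    omega
  -- Row `R` may be the last row or the first empty one; in the latter case both sides are zero.
  have hsum : (lam.parts.drop R).sum = lam.row R := by
    unfold row
    rcases hlen'.eq_or_lt with h | h
    · rw [List.drop_eq_nil_of_le (by omega), List.getD_eq_default _ _ (by omega), List.sum_nil]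
    · rw [List.drop_eq_getElem_cons h, List.drop_eq_nil_of_le (by omega),
        List.getD_eq_getElem _ _ h, List.sum_singleton]
  have hgt : ∀ x ∈ lam.parts.take R, lam.row R + 1 < x := by
    intro x hx
    obtain ⟨r, hr, rfl⟩ := List.mem_iff_getElem.mp hx
    rw [List.length_take] at hr
    have := hlt r (by omega)
    unfold row at this ⊢
    rw [List.getElem_take]
    rwa [List.getD_eq_getElem (n := r) _ _ (by omega)] at this
  let mu : StrictPartition (n + 1) :=
    { parts := lam.parts.take R ++ [lam.row R + 1]
      decreasing := by
        rw [List.pairwise_append]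
        refine ⟨lam.decreasing.sublist (List.take_sublist _ _), List.pairwise_singleton _ _, ?_⟩
        intro x hx y hy
        rw [List.mem_singleton.mp hy]
        exact hgt x hx
      pos := by
        intro x hx
        rw [List.mem_append, List.mem_singleton] at hx
        rcases hx with hx | rfl
        · exact lam.pos x (List.mem_of_mem_take hx)
        · omega
      sum_eq := by
        have h1 := List.sum_take_add_sum_drop lam.parts R
        rw [hsum, lam.sum_eq] at h1
        rw [List.sum_append, List.sum_singleton]
        omega }
  have hrow' : ∀ r, mu.row r = if r = R then lam.row R + 1 else lam.row r := by
    intro r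
    change (lam.parts.take R ++ [lam.row R + 1]).getD r 0 = _
    have hl : (lam.parts.take R).length = R := by
      rw [List.length_take]
      omega
    split_ifs with h
    · rw [List.getD_append_right _ _ _ _ (by omega), hl, h, Nat.sub_self, List.getD_cons_zero]
    · rcases lt_or_gt_of_ne h with h | h
      · rw [List.getD_append _ _ _ _ (by omega), row, List.getD_eq_getElem _ _ (by omega),
          List.getD_eq_getElem _ _ (by omega), List.getElem_take]
      · have := lam.lt_length_iff r
        rw [List.getD_eq_default _ _ (by rw [List.length_append, hl, List.length_singleton]; omega)]
        omega
  refine ⟨mu, ?_⟩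
  ext ⟨r, x⟩
  rw [Set.mem_insert_iff, mem_cells, mem_cells, hrow', Prod.mk.injEq]
  split_ifs with h
  · subst h
    omega
  · omega

theorem row_eq_of_end {lam : StrictPartition n} {r x : ℕ} (h : (r, x) ∈ lam.cells)
    (h' : (r, x + 1) ∉ lam.cells) : r + lam.row r = x + 1 := by
  rw [mem_cells] at h h'
  omega

theorem row_eq_zero {lam : StrictPartition n} {r : ℕ} (h : ∀ x, (r, x) ∉ lam.cells) :
    lam.row r = 0 := by
  have := h r
  rw [mem_cells] at this
  omega

end StrictPartition

open StrictPartition ShSYT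

namespace ShSYT

variable {n : ℕ} {lam : StrictPartition n} {mu : StrictPartition (n + 1)} {c : ℕ × ℕ}

theorem isCorner_of_entry_eq (S : ShSYT lam) {p : ℕ × ℕ} (hn : 1 ≤ n) (hp : S.entry p = n) :
    lam.IsCorner p := by
  have hm : p ∈ lam.cells := S.mem_iff_entry_pos.mpr (by omega)
  refine ⟨hm, fun q hq hd => ?_⟩
  have h1 := S.entry_lt_of_dominates hm hq hd
  have h2 := S.entry_le_size q
  omega

/-- The largest letter is in `c`, so deleting it leaves a tableau of shape `lam`. -/
theorem exists_extend_eq (V : ShSYT mu) (hc : c ∉ lam.cells) (hmu : mu.cells = insert c lam.cells)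
    (hV : V.entry c = n + 1) : ∃ S : ShSYT lam, S.extend hc hmu = V := by
  have hne : ∀ p ∈ lam.cells, p ≠ c := fun p hp h => hc (h ▸ hp)
  have hm : ∀ p ∈ lam.cells, p ∈ mu.cells := fun p hp => hmu ▸ Set.mem_insert_of_mem _ hp
  have hcm : c ∈ mu.cells := hmu ▸ Set.mem_insert _ _
  let S : ShSYT lam :=
    { entry := fun p => if p = c then 0 else V.entry p
      entry_eq_zero := by
        intro p hp
        split_ifs with h
        · rfl
        · exact V.entry_eq_zero p (by rw [hmu, Set.mem_insert_iff]; tauto)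
      bijOn := by
        refine ⟨fun p hp => ?_, fun p hp q hq h => ?_, fun x hx => ?_⟩
        · simp only [if_neg (hne p hp)]
          have h1 : V.entry p ≠ V.entry c := fun h => hne p hp (V.cell_eq (hm p hp) hcm h)
          have h2 := V.entry_le_size p
          exact ⟨V.one_le_entry (hm p hp), by omega⟩
        · simp only [if_neg (hne p hp), if_neg (hne q hq)] at h
          exact V.cell_eq (hm p hp) (hm q hq) h
        · have h1 := V.pos_mem hx.1 (hx.2.trans n.le_succ)
          have h2 := V.entry_pos hx.1 (hx.2.trans n.le_succ)
          have h3 : V.pos x ≠ c := by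
            intro h
            have := hx.2
            rw [h] at h2
            omega
          rw [hmu, Set.mem_insert_iff] at h1
          exact ⟨V.pos x, h1.resolve_left h3, by simp only [if_neg h3, h2]⟩
      row_lt := by
        intro r x y hxy hx hy
        rw [if_neg (hne _ hx), if_neg (hne _ hy)]
        exact V.row_lt r x y hxy (hm _ hx) (hm _ hy)
      col_lt := by
        intro r r' x hr hx hy
        rw [if_neg (hne _ hx), if_neg (hne _ hy)]
        exact V.col_lt r r' x hr (hm _ hx) (hm _ hy) }
  refine ⟨S, ?_⟩
  ext p
  rw [entry_extend]
  split_ifs with h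
  · rw [h, hV]
  · exact if_neg h

end ShSYT

/-! ### The choice of the new cell. -/

namespace IsAugmented

variable {A : Type*} {n : ℕ} {lam : StrictPartition n} {Peak : A → Set ℕ}
  {φ : ℕ → A → A} {f : A → ShSYT lam}

theorem not_mem_peak_of_peakCard [Finite A] {T : A} (h : peakCard Peak f (f T) = 0) : n ∉ Peak T := by
  unfold peakCard at h
  rw [Set.ncard_eq_zero (Set.toFinite _)] at h
  intro hT
  exact (h ▸ (⟨rfl, hT⟩ : T ∈ {U | f U = f T ∧ n ∈ Peak U}) : T ∈ (∅ : Set A))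

theorem mem_peak_of_peakCard [Finite A] {T : A} (h : peakCard Peak f (f T) = fiberCard f (f T)) :
    n ∈ Peak T := by
  have := Set.eq_of_subset_of_ncard_le (s := {U | f U = f T ∧ n ∈ Peak U})
    (t := {U | f U = f T}) (fun U hU => hU.1) h.ge (Set.toFinite _)
  have hT : T ∈ {U | f U = f T} := rfl
  rw [← this] at hT
  exact hT.2

/-- The cell `c` can be added to the diagram of `lam` so that it becomes the only corner, and it
precedes the letter `n` exactly for the objects with a peak at `n`, if `n - 1` does. -/
structure IsNewCell (Peak : A → Set ℕ) (f : A → ShSYT lam) (mu : StrictPartition (n + 1))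
    (c : ℕ × ℕ) : Prop where
  not_mem : c ∉ lam.cells
  cells_eq : mu.cells = insert c lam.cells
  dominates : ∀ p, lam.IsCorner p → Dominates c p
  mem_peak_iff : ∀ T, n ∈ Peak T ↔
    ReadLT ((f T).pos (n - 1)) ((f T).pos n) ∧ ReadLT c ((f T).pos n)

variable (E : IsAugmented Peak φ f)
include E

/-- Only tableaux in which `n - 1` precedes `n` have to be examined: over the others
`readLT_of_mem_peak` excludes a peak at `n`. -/
theorem isNewCell_of_isCorner {mu : StrictPartition (n + 1)} {c : ℕ × ℕ} (hc : c ∉ lam.cells)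
    (hmu : mu.cells = insert c lam.cells) (hdom : ∀ p, lam.IsCorner p → Dominates c p)
    (hpeak : ∀ T p q, lam.IsCorner p → (f T).entry p = n → (f T).entry q = n - 1 → ReadLT q p →
      (n ∈ Peak T ↔ ReadLT c p)) : IsNewCell Peak f mu c := by
  have h3 := E.three_le
  refine ⟨hc, hmu, hdom, fun T => ?_⟩
  have e1 := (f T).entry_pos (x := n) (by omega) le_rfl
  have e2 := (f T).entry_pos (x := n - 1) (by omega) (by omega)
  have hp := hpeak T _ _ ((f T).isCorner_of_entry_eq (by omega) e1) e1 e2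
  constructor
  · intro hT
    have hread := E.readLT_of_mem_peak hT
    exact ⟨hread, (hp hread).mp hT⟩
  · rintro ⟨h1, h2⟩
    exact (hp h1).mpr h2

variable [Finite A] [Nonempty A]

/-- The last row ends exactly one column before the row below it, and nothing lies further right;
the new cell fills this gap. With `n` in the corner below the gap, the peak count is full; with `n`
at the end of the last row, it is zero. -/
theorem exists_isNewCell_of_two_corners {R z : ℕ} (hc : lam.IsCorner (R, z))
    (htop : ∀ x, (R + 1, x) ∉ lam.cells) {c₂ : ℕ × ℕ} (hc₂ : lam.IsCorner c₂)
    (hread : ReadLT (R, z) c₂) : ∃ mu c, IsNewCell Peak f mu c := by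
  have h3 := E.three_le
  obtain ⟨hcm, hend, -⟩ := isCorner_iff.mp hc
  have hRz := hcm.1
  obtain ⟨r₂, x₂⟩ := c₂
  obtain ⟨hr, hx⟩ := hc₂.lt_of_readLT hc hread
  obtain ⟨T₀⟩ := ‹Nonempty A›
  obtain ⟨s, rfl⟩ : ∃ s, R = s + 1 := ⟨R - 1, by omega⟩
  simp only at hRz
  -- If row `s` also ended in column `z`, the peak count for `n` in the upper corner would be both
  -- full and zero; a last row of length one is handled by `mem_of_isCorner_diag`.
  have hs : (s, z + 1) ∈ lam.cells := by
    by_contra hcon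
    rcases hRz.eq_or_lt with rfl | hlt
    · exact hcon (E.mem_of_isCorner_diag hc)
    obtain ⟨z, rfl⟩ : ∃ y, z = y + 1 := ⟨z - 1, by omega⟩
    obtain ⟨S, e1, e2, -⟩ := (f T₀).exists_place h3 hc
      (lam.left_mem (c := z) (by omega) (by omega) hcm) hc₂.1 (by simp)
      (by simp only [ne_eq, Prod.mk.injEq]; omega) (by simp only [ne_eq, Prod.mk.injEq]; omega)
      (by
        rintro ⟨q1, q2⟩ hq (⟨h1, h2⟩ | ⟨h1, h2⟩)
        · simp only at h1 h2
          subst h1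
          have := le_of_mem_row hend (by omega) hq
          rw [show q2 = z + 1 by omega]
        · simp only at h1 h2
          subst h1
          have := le_of_mem_col (htop _) hq
          omega)
      (fun q hq hd => absurd hd (hc₂.2 q hq))
    have hr : ReadLT (s + 1, z) (s + 1, z + 1) := Or.inr ⟨rfl, by simp only; omega⟩
    have h4 := E.peakCard_of_equal_ends (by omega) hc htop hcon e1 e2 hr
    have h5 := E.peakCard_of_second_corner (by omega) hc htop hc₂ hread e1 e2 hr
    have := E.fiberCard_pos S
    omega
  -- A longer row `s` would end in a corner whose left neighbour is not covered from above.
  have hs0 : (s, z + 2) ∉ lam.cells := by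
    intro h
    obtain ⟨x, hx, hxm, hxe⟩ := exists_end (f T₀) h
    have hcor : lam.IsCorner (s, x) := isCorner_iff.mpr ⟨hxm, hxe, fun h => by
      have := le_of_mem_row hend (by omega) h
      omega⟩
    have := E.mem_of_isCorner hcor hc (Or.inl (by simp only; omega))
    have := le_of_mem_row hend (by omega) this
    omega
  have hcor : lam.IsCorner (s, z + 1) := isCorner_iff.mpr ⟨hs, hs0, hend⟩
  -- A cell further right would produce a third corner in a lower row.
  have hcol : ∀ r x, (r, x) ∈ lam.cells → x ≤ z + 1 := by
    intro r x hm
    by_contra hcon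
    have hm0 : (0, z + 2) ∈ lam.cells := lam.mem_of_le hm (by omega) (by omega) (by omega)
    obtain ⟨t, -, ht, ht'⟩ := exists_top (f T₀) hm0
    obtain ⟨x', hx', hxm, hxe⟩ := exists_end (f T₀) ht
    have htz := ht.1
    simp only at htz
    have hts : t < s := by
      by_contra hcon
      exact hs0 (lam.mem_of_le ht (by omega) le_rfl (by omega))
    have hcor' : lam.IsCorner (t, x') := isCorner_iff.mpr ⟨hxm, hxe, fun h =>
      ht' (lam.left_mem (by omega) hx' h)⟩
    exact E.not_three_corners hc hcor hcor' (Or.inl (by simp only; omega)) (Or.inl hts)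
  have hrow := row_eq_of_end hcm hend
  obtain ⟨mu, hmu⟩ := lam.exists_insert (R := s + 1) (row_eq_zero htop) (by
    intro r hr
    obtain rfl : r = s := by omega
    rwa [hrow])
  rw [hrow] at hmu
  have hother : ∀ p, lam.IsCorner p → p = (s + 1, z) ∨ (p.1 ≤ s ∧ p.2 = z + 1) := by
    rintro ⟨r, x⟩ hp
    by_cases he : (r, x) = (s + 1, z)
    · exact Or.inl he
    right
    have hpz := hcol r x hp.1
    rcases ReadLT.trichotomy he with h | h
    · have := (hc.lt_of_readLT hp h).1
      exact absurd (lam.below_mem_of_le (by omega) hp.1) (htop x)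
    · obtain ⟨h1, h2⟩ := hp.lt_of_readLT hc h
      simp only
      omega
  refine ⟨mu, (s + 1, z + 1), E.isNewCell_of_isCorner hend hmu ?_ ?_⟩
  · intro p hp
    rcases hother p hp with rfl | ⟨h1, h2⟩
    · exact Or.inl ⟨rfl, by simp only; omega⟩
    · exact Or.inr ⟨h2.symm, by simp only; omega⟩
  · intro T p q hp e1 e2 hqp
    rcases hother p hp with rfl | ⟨h1, h2⟩
    · refine iff_of_false ?_ (by simp only [ReadLT]; omega)
      rcases hRz.eq_or_lt with rfl | hlt
      · have hq : q ∈ lam.cells := (f T).mem_iff_entry_pos.mpr (by omega)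
        obtain ⟨q1, q2⟩ := q
        have hq' := hq.1
        simp only [ReadLT] at hqp hq'
        exact absurd (lam.below_mem_of_le (by omega) hq) (htop q2)
      · obtain ⟨z, rfl⟩ : ∃ y, z = y + 1 := ⟨z - 1, by omega⟩
        exact not_mem_peak_of_peakCard
          (E.peakCard_of_second_corner (by omega) hc htop hcor (Or.inl (by simp only; omega))
            e1 e2 hqp)
    · obtain ⟨p1, p2⟩ := p
      simp only at h1 h2
      refine iff_of_true (mem_peak_of_peakCard (E.peakCard_of_not_first hp hc
        (Or.inl (by simp only; omega)) e1 e2 hqp)) (Or.inl (by simp only; omega))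

/-- With a single corner all rows end in the same column. A single row is prolonged, and no object
has a peak at `n`. With several rows the last one has length two, a new row starts on the diagonal,
and `n` is a peak whenever `n - 1` precedes it. -/
theorem exists_isNewCell_of_one_corner {R z : ℕ} (hc : lam.IsCorner (R, z))
    (htop : ∀ x, (R + 1, x) ∉ lam.cells) (huniq : ∀ p, lam.IsCorner p → p = (R, z)) :
    ∃ mu c, IsNewCell Peak f mu c := by
  have h3 := E.three_le
  obtain ⟨hcm, hend, -⟩ := isCorner_iff.mp hc
  have hRz := hcm.1
  simp only at hRz
  obtain ⟨T₀⟩ := ‹Nonempty A›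
  have hcol : ∀ r x, (r, x) ∈ lam.cells → x ≤ z := by
    intro r x hm
    by_contra hcon
    have hm0 : (0, z + 1) ∈ lam.cells := lam.mem_of_le hm (by omega) (by omega) (by omega)
    obtain ⟨t, -, ht, ht'⟩ := exists_top (f T₀) hm0
    obtain ⟨x', hx', hxm, hxe⟩ := exists_end (f T₀) ht
    have htR := le_of_mem_col (htop _) ht
    have := huniq _ (isCorner_iff.mpr ⟨hxm, hxe, fun h => ht' (lam.left_mem (by omega) hx' h)⟩)
    rw [Prod.mk.injEq] at this
    omega
  have hrow := row_eq_of_end hcm hend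
  have hlast : ∀ y, R ≤ y → ∀ q ∈ lam.cells, Dominates q (R, y) →
      ∃ x, q = (R, x) ∧ y < x ∧ x ≤ z := by
    rintro y hy ⟨q1, q2⟩ hq (⟨h1, h2⟩ | ⟨h1, h2⟩)
    · simp only at h1 h2
      subst h1
      exact ⟨q2, rfl, h2, hcol _ _ hq⟩
    · simp only at h1 h2
      subst h1
      have := le_of_mem_col (htop _) hq
      omega
  rcases Nat.eq_zero_or_pos R with rfl | hR
  · obtain ⟨mu, hmu⟩ := lam.exists_insert (R := 0) (row_eq_zero htop) (by omega)
    rw [hrow] at hmu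
    refine ⟨mu, (0, z + 1), E.isNewCell_of_isCorner hend hmu ?_ ?_⟩
    · intro p hp
      rw [huniq p hp]
      exact Or.inl ⟨rfl, by simp only; omega⟩
    · intro T p q hp e1 e2 hqp
      obtain rfl := huniq p hp
      refine iff_of_false ?_ (by simp only [ReadLT]; omega)
      have hz : 2 ≤ z := by
        have hpos : ∀ x, 1 ≤ x → x ≤ 3 → ∃ y, y ≤ z ∧ (f T).entry (0, y) = x := by
          intro x h1 h2
          have hm := (f T).pos_mem h1 (by omega)
          have he := (f T).entry_pos h1 (show x ≤ n by omega)
          obtain ⟨⟨r, y⟩, hry⟩ : ∃ p, (f T).pos x = p := ⟨_, rfl⟩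
          rw [hry] at hm he
          obtain rfl : r = 0 := by
            have := le_of_mem_col (htop _) hm
            omega
          exact ⟨y, hcol _ _ hm, he⟩
        obtain ⟨y1, l1, h1⟩ := hpos 1 le_rfl (by omega)
        obtain ⟨y2, l2, h2⟩ := hpos 2 (by omega) (by omega)
        obtain ⟨y3, l3, h3⟩ := hpos 3 (by omega) le_rfl
        have n1 : y1 ≠ y2 := by
          rintro rfl
          omega
        have n2 : y1 ≠ y3 := by
          rintro rfl
          omega
        have n3 : y2 ≠ y3 := by
          rintro rfl
          omega
        omega
      obtain ⟨z, rfl⟩ : ∃ y, z = y + 2 := ⟨z - 2, by omega⟩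
      exact not_mem_peak_of_peakCard (E.peakCard_of_long_row (by omega) hc htop e1 e2 hqp)
  · obtain ⟨s, rfl⟩ : ∃ s, R = s + 1 := ⟨R - 1, by omega⟩
    -- Length one is impossible by `mem_of_isCorner_diag`. For length at least three, the peak count
    -- would be full by `peakCard_of_equal_ends` and zero by `peakCard_of_long_row`.
    have hz : z = s + 2 := by
      rcases hRz.eq_or_lt with rfl | hlt
      · have := hcol _ _ (E.mem_of_isCorner_diag hc)
        omega
      by_contra hcon
      obtain ⟨z, rfl⟩ : ∃ y, z = y + 2 := ⟨z - 2, by omega⟩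
      obtain ⟨S, e1, e2, -⟩ := (f T₀).exists_place h3 hc
        (lam.left_mem (c := z + 1) (by omega) (by omega) hcm)
        (lam.left_mem (c := z) (by omega) (by omega) hcm) (by simp) (by simp) (by simp)
        (fun q hq hd => by
          obtain ⟨x, rfl, h1, h2⟩ := hlast _ (by omega) q hq hd
          rw [show x = z + 2 by omega])
        (fun q hq hd => by
          obtain ⟨x, rfl, h1, h2⟩ := hlast _ (by omega) q hq hd
          rcases (show x = z + 2 ∨ x = z + 1 by omega) with rfl | rfl
          · exact Or.inl rfl
          · exact Or.inr rfl)
      have hr : ReadLT (s + 1, z + 1) (s + 1, z + 2) := Or.inr ⟨rfl, by simp only; omega⟩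
      have h4 := E.peakCard_of_equal_ends (by omega) hc htop
        (fun h => by have := hcol _ _ h; omega) e1 e2 hr
      have h5 := E.peakCard_of_long_row (by omega) hc htop e1 e2 hr
      have := E.fiberCard_pos S
      omega
    subst hz
    have hrow0 := row_eq_zero htop
    obtain ⟨mu, hmu⟩ := lam.exists_insert (R := s + 2)
      (row_eq_zero fun x h => htop x (lam.below_mem h)) (by
        intro r hr
        obtain rfl : r = s + 1 := by omega
        rwa [hrow0])
    rw [hrow0] at hmu
    refine ⟨mu, (s + 2, s + 2), E.isNewCell_of_isCorner (htop _) hmu ?_ ?_⟩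
    · intro p hp
      rw [huniq p hp]
      exact Or.inr ⟨rfl, by simp only; omega⟩
    · intro T p q hp e1 e2 hqp
      obtain rfl := huniq p hp
      exact iff_of_true (mem_peak_of_peakCard (E.peakCard_of_equal_ends (by omega) hc htop
        (fun h => by have := hcol _ _ h; omega) e1 e2 hqp)) (Or.inl (by simp only; omega))

theorem exists_isNewCell : ∃ mu c, IsNewCell Peak f mu c := by
  have h3 := E.three_le
  obtain ⟨T₀⟩ := ‹Nonempty A›
  obtain ⟨⟨r, x⟩, hm⟩ : ∃ p, p ∈ lam.cells := ⟨_, (f T₀).pos_mem (x := 1) le_rfl (by omega)⟩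
  have hm0 : (0, 0) ∈ lam.cells := lam.mem_of_le hm (by omega) (by omega) le_rfl
  have hlen := lam.lt_length_iff
  have h0 := hlen 0
  rw [mem_cells] at hm0
  obtain ⟨R, hR⟩ : ∃ R, lam.parts.length = R + 1 := ⟨lam.parts.length - 1, by omega⟩
  have htop : ∀ x, (R + 1, x) ∉ lam.cells := by
    intro x
    have := hlen (R + 1)
    rw [mem_cells]
    omega
  have hRR : (R, R) ∈ lam.cells := by
    have := hlen R
    rw [mem_cells]
    omega
  obtain ⟨z, hz, hcm, hend⟩ := exists_end (f T₀) hRR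
  have hc : lam.IsCorner (R, z) := isCorner_iff.mpr ⟨hcm, hend, htop _⟩
  by_cases huniq : ∀ p, lam.IsCorner p → p = (R, z)
  · exact E.exists_isNewCell_of_one_corner hc htop huniq
  · push Not at huniq
    obtain ⟨⟨r, x⟩, hp, hne⟩ := huniq
    refine E.exists_isNewCell_of_two_corners hc htop hp
      ((ReadLT.trichotomy hne).resolve_left fun h => ?_)
    have := (hc.lt_of_readLT hp h).1
    exact htop _ (lam.below_mem_of_le (by omega) hp.1)

/-! ### Compatibility with the last involution. -/

/-- A tableau with a peak at `n - 1` is determined by the cells of the letters up to `n - 3`. -/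
theorem eq_of_mem_peak {S S' : ShSYT lam} (hS : n - 1 ∈ S.peak) (hS' : n - 1 ∈ S'.peak)
    (h : ∀ x, 1 ≤ x → x + 3 ≤ n → S'.pos x = S.pos x) : S = S' := by
  have h3 := E.three_le
  have hp := hS
  rw [ShSYT.mem_peak_iff, ← readLT_iff_key _ (by omega) (by omega) (by omega) (by omega),
    ← readLT_iff_key _ (by omega) (by omega) (by omega) (by omega),
    show n - 1 - 1 = n - 2 by omega, Nat.sub_add_cancel (by omega)] at hp
  obtain ⟨-, -, hx3, hy3⟩ := hp
  have ex := S.entry_pos (x := n - 2) (by omega) (by omega)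
  have ey := S.entry_pos (x := n) (by omega) le_rfl
  have e3 := S.entry_pos (x := n - 1) (by omega) (by omega)
  generalize S.pos (n - 2) = x at *
  generalize S.pos n = y at *
  generalize S.pos (n - 1) = a₃ at *
  have hoff : ∀ p, p ≠ x → p ≠ y → p ≠ a₃ → S'.entry p = S.entry p := by
    intro p p1 p2 p4
    by_cases hp : p ∈ lam.cells
    swap
    · rw [ShSYT.entry_eq_zero _ p hp, ShSYT.entry_eq_zero _ p hp]
    have hm : ∀ q, 1 ≤ S.entry q → q ∈ lam.cells := fun q hq => S.mem_iff_entry_pos.mpr hq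
    have d1 : S.entry p ≠ S.entry x := fun e => p1 (S.cell_eq hp (hm _ (by omega)) e)
    have d2 : S.entry p ≠ S.entry y := fun e => p2 (S.cell_eq hp (hm _ (by omega)) e)
    have d3 : S.entry p ≠ S.entry a₃ := fun e => p4 (S.cell_eq hp (hm _ (by omega)) e)
    have l1 := S.entry_le_size p
    have l2 := S.one_le_entry hp
    have h4 := h (S.entry p) l2 (by omega)
    rw [S.pos_entry hp] at h4
    conv_lhs => rw [← h4]
    exact S'.entry_pos l2 (by omega)
  have hxy : x ≠ y := by
    rintro rfl
    omega
  -- In both tableaux `n - 1` is in the last of the three cells; the reading order of `x` and `y` is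
  -- not known, so both triples are treated.
  have key : S'.entry a₃ = n - 1 ∧ n ≤ S'.entry x + 2 ∧ n ≤ S'.entry y + 2 ∧
      S'.entry x ≤ n ∧ S'.entry y ≤ n ∧ S'.entry x ≠ S'.entry y ∧ S'.entry x ≠ S'.entry a₃ ∧
      S'.entry y ≠ S'.entry a₃ := by
    rcases ReadLT.trichotomy hxy with hr | hr
    · have ht : IsTriple S x y a₃ := ⟨h3, hr, hy3, by omega, by omega, by omega⟩
      have ho : AgreeOff S x y a₃ S' := hoff
      have := (ht.mem_peak_iff_of_agreeOff ho).mp hS'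
      have := ht.cases_of_agreeOff ho
      omega
    · have ht : IsTriple S y x a₃ := ⟨h3, hr, hx3, by omega, by omega, by omega⟩
      have ho : AgreeOff S y x a₃ S' := fun p p1 p2 p3 => hoff p p2 p1 p3
      have := (ht.mem_peak_iff_of_agreeOff ho).mp hS'
      have := ht.cases_of_agreeOff ho
      omega
  obtain ⟨k3, k1, k2, k4, k5, k6, k7, k8⟩ := key
  by_cases hn : S'.entry y = n
  · ext p
    by_cases p1 : p = x
    · rw [p1]
      omega
    by_cases p2 : p = y
    · rw [p2]
      omega
    by_cases p4 : p = a₃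
    · rw [p4]
      omega
    exact (hoff p p1 p2 p4).symm
  -- Otherwise `n - 2` and `n` have changed places. Then `x` and `y` are corners, each carrying `n`
  -- in one tableau, and a cell dominating `a₃` would have to be both of them; so there are three
  -- corners.
  · exfalso
    have hcy := S.isCorner_of_entry_eq (by omega) ey
    have hcx := S'.isCorner_of_entry_eq (p := x) (by omega) (by omega)
    have hc3 : lam.IsCorner a₃ := by
      have hm : a₃ ∈ lam.cells := S.mem_iff_entry_pos.mpr (by omega)
      refine ⟨hm, fun q hq hd => ?_⟩
      have h1 := S.entry_lt_of_dominates hm hq hd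
      have h2 := S'.entry_lt_of_dominates hm hq hd
      have h4 := S.entry_le_size q
      have h5 := S'.entry_le_size q
      have h6 := S.cell_eq hq hcy.1 (by omega)
      have h7 := S'.cell_eq hq hcx.1 (by omega)
      exact hxy (h7.symm.trans h6)
    rcases ReadLT.trichotomy hxy with hr | hr
    · exact E.not_three_corners hcx hcy hc3 hr hy3
    · exact E.not_three_corners hcy hcx hc3 hr hx3

/-- Both sides have `n + 1` in `c`. Without it, both have a peak at `n - 1` and the same letters up
to `n - 3`, so `eq_of_mem_peak` identifies them. -/
theorem extend_last {mu : StrictPartition (n + 1)} {c : ℕ × ℕ} (hN : IsNewCell Peak f mu c)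
    (hpeak : ∀ T, n ∈ Peak T ↔ n ∈ ((f T).extend hN.not_mem hN.cells_eq).peak) {T : A}
    (hT : n ∈ Peak T) : (f (φ (n - 1) T)).extend hN.not_mem hN.cells_eq =
      ((f T).extend hN.not_mem hN.cells_eq).b (n - 1) := by
  have h3 := E.three_le
  set V := ((f T).extend hN.not_mem hN.cells_eq).b (n - 1) with hV
  have hVc : V.entry c = n + 1 := by
    have hm := V.pos_mem (x := n + 1) (by omega) le_rfl
    have he := V.entry_pos (x := n + 1) (by omega) le_rfl
    have hcor := V.isCorner_of_entry_eq (by omega) he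
    have hcm : c ∈ mu.cells := hN.cells_eq ▸ Set.mem_insert _ _
    by_cases h : V.pos (n + 1) = c
    · rwa [h] at he
    -- Otherwise the cell of `n + 1` is a corner of `mu` and hence of `lam`, but `c` dominates every
    -- corner of `lam`.
    · refine absurd (hN.dominates _ ⟨?_, fun q hq => hcor.2 q ?_⟩) (hcor.2 _ hcm)
      · exact (hN.cells_eq ▸ hm : _ ∈ insert c lam.cells).resolve_left h
      · exact hN.cells_eq ▸ Set.mem_insert_of_mem _ hq
  obtain ⟨S, hS⟩ := V.exists_extend_eq hN.not_mem hN.cells_eq hVc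
  rw [← hS]
  congr 1
  refine E.eq_of_mem_peak ?_ ?_ ?_
  · rw [← E.mem_peak_iff (by omega), E.mem_peak_last_iff']
    exact hT
  · rw [← mem_peak_extend S hN.not_mem hN.cells_eq (by omega), hS, hV]
    apply mem_peak_b (by omega) (by omega)
    rw [Nat.sub_add_cancel (by omega)]
    exact (hpeak T).mp hT
  · intro x h1 h2
    rw [← E.pos_last T h1 h2, ← pos_extend S hN.not_mem hN.cells_eq h1 (by omega), hS, hV,
      pos_b_of_lt h1 (by omega) (Or.inl (by omega)), pos_extend _ _ _ h1 (by omega)]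

theorem exists_isMorphismOn : ∃ (mu : StrictPartition (n + 1)) (g : A → ShSYT mu),
    IsMorphismOn Set.univ (indices (n + 1)) Peak φ ShSYT.peak ShSYT.b g := by
  have h3 := E.three_le
  obtain ⟨mu, c, hN⟩ := E.exists_isNewCell
  have hpeak : ∀ T h, h ∈ Peak T ↔ h ∈ ((f T).extend hN.not_mem hN.cells_eq).peak := by
    intro T h
    rcases lt_trichotomy h n with hn | rfl | hn
    · rw [mem_peak_extend _ _ _ hn, E.mem_peak_iff hn]
    · rw [self_mem_peak_extend, hN.mem_peak_iff]
      exact ⟨fun h => ⟨by omega, h⟩, fun h => h.2⟩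
    · refine iff_of_false (fun hT => ?_) (fun hT => ?_)
      · have := (E.isPeakMap T).1 h hT
        omega
      · have := ((ShSYT.mem_peak_iff _).mp hT).2.1
        omega
  have hlast := fun T => E.extend_last hN (fun T => hpeak T n) (T := T)
  refine ⟨mu, fun T => (f T).extend hN.not_mem hN.cells_eq, fun T _ =>
    ⟨Set.ext (hpeak T), fun i hi => ?_⟩⟩
  obtain ⟨h1, h2⟩ := hi
  beta_reduce
  rcases (show i + 1 < n ∨ i = n - 1 by omega) with hlt | rfl
  · rw [E.map_eq h1 hlt, b_extend _ _ _ (by omega)]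
  by_cases hT : n ∈ Peak T
  · exact hlast T hT
  -- If `n - 1` is a peak of `T`, then `n` is a peak of `φ (n - 1) T`, and the previous case applies
  -- there. If neither is a peak, both involutions fix their arguments.
  by_cases hT' : n - 1 ∈ Peak T
  · rw [E.mem_peak_last_iff] at hT'
    have := hlast _ hT'
    rw [E.last_last] at this
    rw [this, b_b]
  · have hsub : n - 1 + 1 = n := Nat.sub_add_cancel (by omega)
    rw [(E.conditionI _ E.last_index T).mpr ⟨hT', by rwa [hsub]⟩, eq_comm,
      b_eq_self_iff h1 h2, hsub, ← hpeak, ← hpeak]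
    exact ⟨hT', hT⟩

end IsAugmented

/-! ### Small sizes and the conclusion. -/

/-- The case of size at most two, where there are no involutions. -/
theorem exists_isMorphismOn_of_le_two {A : Type*} [Nonempty A] {n : ℕ} (hn : n ≤ 2)
    {lam : StrictPartition n} {Peak : A → Set ℕ} (φ : ℕ → A → A) (f : A → ShSYT lam)
    (hPeak : IsPeakMap (n + 1) Peak) (htwo : n = 2 → ∀ S T : A, Peak S = Peak T) :
    ∃ (mu : StrictPartition (n + 1)) (g : A → ShSYT mu),
      IsMorphismOn Set.univ (indices (n + 1)) Peak φ ShSYT.peak ShSYT.b g := by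
  obtain ⟨T₀⟩ := ‹Nonempty A›
  -- A cell in the second row forces at least three cells, so `lam` is a single row.
  have htop : ∀ x, (1, x) ∉ lam.cells := by
    intro x h
    have h1 : (1, 1) ∈ lam.cells := lam.left_mem le_rfl h.1 h
    have h2 : (0, 1) ∈ lam.cells := lam.below_mem h1
    have h3 : (0, 0) ∈ lam.cells := lam.left_mem le_rfl (by omega) h2
    have := (f T₀).one_le_entry h3
    have := (f T₀).row_lt 0 0 1 (by omega) h3 h2
    have := (f T₀).col_lt 0 1 1 (by omega) h2 h1
    have := (f T₀).entry_le_size (1, 1)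
    omega
  have hpos : ∀ (S : ShSYT lam) x, 1 ≤ x → x ≤ n → ∃ y, S.pos x = (0, y) ∧ (0, y) ∈ lam.cells := by
    intro S x h1 h2
    have hm := S.pos_mem h1 h2
    obtain ⟨⟨r, y⟩, hry⟩ : ∃ p, S.pos x = p := ⟨_, rfl⟩
    rw [hry] at hm ⊢
    obtain rfl : r = 0 := by
      have := le_of_mem_col (htop _) hm
      omega
    exact ⟨y, rfl, hm⟩
  suffices h : ∃ (mu : StrictPartition (n + 1)) (c : ℕ × ℕ) (hc : c ∉ lam.cells)
      (hmu : mu.cells = insert c lam.cells),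
      ∀ T, n ∈ Peak T ↔ n ∈ ((f T).extend hc hmu).peak by
    obtain ⟨mu, c, hc, hmu, h⟩ := h
    refine ⟨mu, fun T => (f T).extend hc hmu, fun T _ => ⟨?_, fun i hi => ?_⟩⟩
    · ext k
      by_cases hk : k = n
      · rw [hk]
        exact h T
      · refine iff_of_false (fun hT => ?_) (fun hT => ?_)
        · have := (hPeak T).1 k hT
          omega
        · have := (ShSYT.mem_peak_iff _).mp hT
          omega
    · have h1 := hi.1
      have h2 := hi.2
      omega
  -- A peak at `n` requires `n = 2`, where the peak set is constant; hence one choice between a new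
  -- row and the end of the first row serves all objects.
  by_cases hT₀ : n ∈ Peak T₀
  · have h2 := ((hPeak T₀).1 n hT₀).1
    obtain rfl : n = 2 := by omega
    obtain ⟨mu, hmu⟩ := lam.exists_insert (R := 1)
      (row_eq_zero fun x h => htop x (lam.below_mem h)) (by
        intro r hr
        obtain rfl : r = 0 := by omega
        rw [row_eq_zero htop]
        obtain ⟨y1, p1, m1⟩ := hpos (f T₀) 1 le_rfl (by omega)
        obtain ⟨y2, p2, m2⟩ := hpos (f T₀) 2 (by omega) le_rfl
        have e1 := (f T₀).entry_pos (x := 1) le_rfl (by omega)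
        have e2 := (f T₀).entry_pos (x := 2) (by omega) le_rfl
        rw [p1] at e1
        rw [p2] at e2
        refine lam.left_mem (by omega) (?_ : 1 ≤ y2) m2
        by_contra hcon
        have := (f T₀).row_le (show y2 ≤ y1 by omega) m2 m1
        omega)
    rw [row_eq_zero htop] at hmu
    refine ⟨mu, _, htop _, hmu, fun T => ?_⟩
    rw [htwo rfl T T₀, self_mem_peak_extend]
    refine iff_of_true hT₀ ⟨by omega, ?_⟩
    obtain ⟨y1, p1, m1⟩ := hpos (f T) 1 le_rfl (by omega)
    obtain ⟨y2, p2, m2⟩ := hpos (f T) 2 (by omega) le_rfl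
    have e1 := (f T).entry_pos (x := 1) le_rfl (by omega)
    have e2 := (f T).entry_pos (x := 2) (by omega) le_rfl
    rw [p1] at e1
    rw [p2] at e2
    rw [p2, show 2 - 1 = 1 from rfl, p1]
    refine ⟨Or.inr ⟨rfl, ?_⟩, Or.inl (by simp only; omega)⟩
    by_contra hcon
    simp only at hcon
    have := (f T).row_le (show y2 ≤ y1 by omega) m2 m1
    omega
  · obtain ⟨mu, hmu⟩ := lam.exists_insert (R := 0) (row_eq_zero htop) (by omega)
    refine ⟨mu, _, by rw [mem_cells]; omega, hmu, fun T => ?_⟩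
    rw [self_mem_peak_extend]
    refine iff_of_false (fun hT => ?_) ?_
    · have h2 := ((hPeak T).1 n hT).1
      rw [htwo (by omega) T T₀] at hT
      exact hT₀ hT
    · rintro ⟨h1, -, h2⟩
      obtain ⟨y, hy, hm⟩ := hpos (f T) n (by omega) le_rfl
      rw [hy] at h2
      rw [mem_cells] at hm
      simp only [ReadLT] at h2
      omega

theorem mainTheorem5 {A : Type*} [Finite A] [Nonempty A] (n : ℕ)
    (Peak : A → Set ℕ) (φ : ℕ → A → A)
    (hPeak : IsPeakMap (n + 1) Peak)
    (hinv : ∀ i ∈ indices (n + 1), Function.Involutive (φ i))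
    (hI : ConditionI (n + 1) Peak φ)
    (hII : ConditionII (n + 1) Peak φ)
    (hIII : ConditionIII (n + 1) φ)
    (hV : ConditionV (n + 1) Peak φ)
    (htwo : n = 2 → ∀ S T : A, Peak S = Peak T)
    (hmor : ∃ (lam : StrictPartition n) (f : A → ShSYT lam),
      IsMorphismOn Set.univ (indices n) (truncPeak n Peak) φ ShSYT.peak ShSYT.b f) :
    ∃! mu : StrictPartition (n + 1), ∃ f : A → ShSYT mu,
      IsMorphismOn Set.univ (indices (n + 1)) Peak φ ShSYT.peak ShSYT.b f := by
  obtain ⟨lam, f, hf⟩ := hmor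
  have hex : ∃ (mu : StrictPartition (n + 1)) (g : A → ShSYT mu),
      IsMorphismOn Set.univ (indices (n + 1)) Peak φ ShSYT.peak ShSYT.b g := by
    by_cases hn : n ≤ 2
    · exact exists_isMorphismOn_of_le_two hn φ f hPeak htwo
    · exact IsAugmented.exists_isMorphismOn (f := f)
        ⟨by omega, hPeak, hinv, hI, hII, hIII, hV, hf⟩
  obtain ⟨mu, g, hg⟩ := hex
  exact ⟨mu, ⟨g, hg⟩, fun nu ⟨g', hg'⟩ => shape_unique hg' hg⟩
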